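/- Let $K$ be an algebraically closed field of characteristic zero and let $A_1$ be the Weyl algebra over $K$, generated by $X,Y$ with $[Y,X]=1$; the monomials $X^iY^j$ form a $K$-basis, and $\mathrm{Supp}(P)\subset\mathbb{N}_0\times\mathbb{N}_0$ is the set of exponents $(i,j)$ occurring in $P$. *Notation.* A direction is a pair $(\rho,\sigma)$ of coprime integers with $\rho+\sigma>0$. Put $v_{\rho,\sigma}(i,j)=\rho i+\sigma j$, and for $P\in A_1\setminus\{0\}$ let $v_{\rho,\sigma}(P)=\max\{v_{\rho,\sigma}(p):p\in\mathrm{Supp}(P)\}$ (and $v_{\rho,\sigma}(0)=-\infty$). The leading term $\ell_{\rho,\sigma}(P)\in K[x,y]$ is the sum of the terms $a_{ij}x^iy^j$ of $P=\sum a_{ij}X^iY^j$ with $v_{\rho,\sigma}(i,j)=v_{\rho,\sigma}(P)$. The points $\mathrm{st}_{\rho,\sigma}(P)$ and $\mathrm{en}_{\rho,\sigma}(P)$ are the points of $\mathrm{Supp}(\ell_{\rho,\sigma}(P))$ at which $i-j$, respectively $j-i$, is maximal. $\mathrm{Dir}(P)$ is the set of directions for which $\ell_{\rho,\sigma}(P)$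 is not a monomial. For nonzero $P,Q$, $[P,Q]_{\rho,\sigma}=0$ if $v_{\rho,\sigma}([P,Q])<v_{\rho,\sigma}(P)+v_{\rho,\sigma}(Q)-(\rho+\sigma)$, and $[P,Q]_{\rho,\sigma}=\ell_{\rho,\sigma}([P,Q])$ otherwise. $P$ is $(\rho,\sigma)$-homogeneous if $P=0$ or all points of $\mathrm{Supp}(P)$ have the same $(\rho,\sigma)$-degree. For integers $r\neq s$, $\mathrm{dir}(r,s)$ is the unique direction $(\rho,\sigma)$ with $\rho r+\sigma s=0$. A counterexample (to the Dixmier conjecture) is a pair $(P,Q)$ in $A_1$ such that $X\mapsto P$, $Y\mapsto Q$ defines an algebra endomorphism of $A_1$ that is not an automorphism. A minimal pair is a counterexample for which $\gcd(v_{1,1}(P),v_{1,1}(Q))$ is the minimum over all counterexamples. $P$ is subrectangular if there are integers $a,b\ge 1$ with $(a,b)\in\mathrm{Supp}(P)\subseteq[0,a]\times[0,b]$. A minimal pair $(P,Q)$ is standard if $P$ and $Q$ are subrectangular and $v_{1,-1}(\mathrm{st}_{1,0}(P))<0$, $v_{1,-1}(\mathrm{st}_{1,0}(Q))<0$. **Proposition.**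 Let $(P,Q)$ be a standard minimal pair, and let $m,n$ be coprime positive integers with $\frac mn=\frac{v_{1,1}(P)}{v_{1,1}(Q)}$. Then there exists $(\rho,\sigma)\in\mathrm{Dir}(P)\cap\mathrm{Dir}(Q)$ such that $\sigma<0$; $v_{\rho,\sigma}(P)>0$ and $v_{\rho,\sigma}(Q)>0$; $[P,Q]_{\rho,\sigma}=0$; $\frac{v_{\rho,\sigma}(P)}{v_{\rho,\sigma}(Q)}=\frac{v_{1,1}(P)}{v_{1,1}(Q)}$; neither $\frac{v_{\rho,\sigma}(P)}{v_{\rho,\sigma}(Q)}$ nor $\frac{v_{\rho,\sigma}(Q)}{v_{\rho,\sigma}(P)}$ is an integer; and $v_{1,-1}(\mathrm{st}_{\rho,\sigma}(P))>0>v_{1,-1}(\mathrm{en}_{\rho,\sigma}(P))$. Let $(\rho,\sigma)$ be any such direction. Then there exists a $(\rho,\sigma)$-homogeneous $F\in A_1$ with $[P,F]_{\rho,\sigma}=\ell_{\rho,\sigma}(P)$ and $v_{\rho,\sigma}(F)=\rho+\sigma$. For any such $F$ write $(f_1,f_2)=\mathrm{en}_{\rho,\sigma}(F)$, and set $C_0=\frac1m\mathrm{en}_{\rho,\sigma}(P)=(u,v)$,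 $C_1=\frac1m\mathrm{st}_{\rho,\sigma}(P)=(r',s')$ and $\gamma=(v-s')/\rho$. Then $C_0,C_1\in\mathbb{N}_0\times\mathbb{N}_0$ and $v_{\rho,\sigma}(C_0)=v_{\rho,\sigma}(C_1)$. Moreover: 1. $u<v$ and $r'>s'$; 2. $f_1\ge 2$ and $u\ge 3$; 3. $\gcd(u,v)>1$; 4. $\mathrm{en}_{\rho,\sigma}(F)=\mu C_0$ for some $0<\mu<1$; 5. $(\rho,\sigma)=\mathrm{dir}(f_1-1,f_2-1)$; 6. if $\gcd(f_1-1,f_2-1)=1$, then $C_2:=C_1+(\gamma-s')\left(-\frac{\sigma}{\rho},1\right)$ is not of the form $\left(\bar r-\frac1\rho,\bar r\right)$ for any rational number $\bar r\ge 2$. -/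

import Mathlib

noncomputable section

namespace Dixmier

open MvPolynomial

/-! ### The Weyl algebra by generators and relations -/

/-- The defining relation `Y X = X Y + 1`, i.e. `[Y, X] = 1`, of the Weyl algebra;
the generators `X` and `Y` are the free generators with index `0` and `1`. -/
inductive WeylRel (K : Type*) [Field K] : FreeAlgebra K (Fin 2) → FreeAlgebra K (Fin 2) → Prop
  | comm : WeylRel K (FreeAlgebra.ι K 1 * FreeAlgebra.ι K 0)
      (FreeAlgebra.ι K 0 * FreeAlgebra.ι K 1 + 1)

/-- The (first) Weyl algebra `A₁` over `K`. -/
abbrev WeylAlgebra (K : Type*) [Field K] : Type _ := RingQuot (WeylRel K)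

variable {K : Type*} [Field K]

/-- The generator `X` of `A₁`. -/
def genX : WeylAlgebra K := RingQuot.mkAlgHom K (WeylRel K) (FreeAlgebra.ι K 0)

/-- The generator `Y` of `A₁`. -/
def genY : WeylAlgebra K := RingQuot.mkAlgHom K (WeylRel K) (FreeAlgebra.ι K 1)

theorem genY_mul_genX : (genY * genX : WeylAlgebra K) = genX * genY + 1 := by
  have h := RingQuot.mkAlgHom_rel K (WeylRel.comm (K := K))
  simpa [genX, genY] using h

/-- Left multiplication by `X`, `Y` in normally ordered coordinates, on the free generators:
`X` acts on `K[x, y]` as `x` and `Y` acts as `y + ∂/∂x`. -/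
def regularRepFree (K : Type*) [Field K] :
    FreeAlgebra K (Fin 2) →ₐ[K] Module.End K (MvPolynomial (Fin 2) K) :=
  FreeAlgebra.lift K ![LinearMap.mulLeft K (X 0),
    LinearMap.mulLeft K (X 1) + (pderiv (R := K) (0 : Fin 2)).toLinearMap]

theorem regularRepFree_rel {a b : FreeAlgebra K (Fin 2)} (h : WeylRel K a b) :
    regularRepFree K a = regularRepFree K b := by
  cases h
  refine LinearMap.ext fun p => ?_
  simp [regularRepFree]
  ring

/-- The regular representation of `A₁` in normally ordered coordinates. -/
def regularRep (K : Type*) [Field K] :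
    WeylAlgebra K →ₐ[K] Module.End K (MvPolynomial (Fin 2) K) :=
  RingQuot.liftAlgHom K ⟨regularRepFree K, fun _ _ h => regularRepFree_rel h⟩

theorem regularRep_genX (p : MvPolynomial (Fin 2) K) :
    regularRep K genX p = X 0 * p := by
  simp [regularRep, genX, regularRepFree]

theorem regularRep_genY (p : MvPolynomial (Fin 2) K) :
    regularRep K genY p = X 1 * p + pderiv 0 p := by
  simp [regularRep, genY, regularRepFree]

/-- The linear map `Ψ : A₁ → K[x, y]` with `Ψ (X ^ i * Y ^ j) = x ^ i * y ^ j`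
(see `symbol_monomial` and `symbol_bijective`). -/
def symbol : WeylAlgebra K →ₗ[K] MvPolynomial (Fin 2) K :=
  (LinearMap.applyₗ (1 : MvPolynomial (Fin 2) K)) ∘ₗ (regularRep K).toLinearMap

theorem symbol_monomial (i j : ℕ) :
    symbol (genX ^ i * genY ^ j : WeylAlgebra K) = X 0 ^ i * X 1 ^ j := by
  have hY : ∀ j : ℕ, symbol (genY ^ j : WeylAlgebra K) = X 1 ^ j := by
    intro j
    induction j with
    | zero => simp [symbol]
    | succ j ih =>
      have h : symbol (genY ^ (j + 1) : WeylAlgebra K)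
          = regularRep K genY (symbol (genY ^ j : WeylAlgebra K)) := by
        simp [symbol, pow_succ']
      rw [h, ih, regularRep_genY]
      simp [Derivation.leibniz_pow, pderiv_X, pow_succ']
  induction i with
  | zero => simpa using hY j
  | succ i ih =>
    have h : symbol (genX ^ (i + 1) * genY ^ j : WeylAlgebra K)
        = regularRep K genX (symbol (genX ^ i * genY ^ j : WeylAlgebra K)) := by
      simp [symbol, pow_succ', mul_assoc]
    rw [h, ih, regularRep_genX]
    ring

theorem genY_mul_genX_pow (i : ℕ) :
    (genY * genX ^ i : WeylAlgebra K) = genX ^ i * genY + (i : K) • genX ^ (i - 1) := by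
  induction i with
  | zero => simp
  | succ i ih =>
    rw [pow_succ', ← mul_assoc, genY_mul_genX, add_mul, mul_assoc, ih]
    rcases i with _ | i
    · simp
    · simp only [Nat.add_sub_cancel, mul_add, mul_smul_comm, ← pow_succ', ← mul_assoc, one_mul]
      push_cast
      module

/-- The monomials `X ^ i * Y ^ j` form a basis of `A₁`. -/
theorem symbol_bijective : Function.Bijective (symbol : WeylAlgebra K → MvPolynomial (Fin 2) K) := by
  let g : MvPolynomial (Fin 2) K →ₗ[K] WeylAlgebra K :=
    Finsupp.linearCombination K (fun e : Fin 2 →₀ ℕ => (genX ^ e 0 * genY ^ e 1 : WeylAlgebra K)) ∘ₗ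
      (MvPolynomial.basisMonomials (Fin 2) K).repr.toLinearMap
  have hg : ∀ e : Fin 2 →₀ ℕ, g (monomial e 1) = genX ^ e 0 * genY ^ e 1 := by
    intro e
    have : (MvPolynomial.basisMonomials (Fin 2) K).repr (monomial e 1) = Finsupp.single e 1 := by
      rfl
    simp [g, this]
  have hmon : ∀ e : Fin 2 →₀ ℕ, (X 0 ^ e 0 * X 1 ^ e 1 : MvPolynomial (Fin 2) K) = monomial e 1 := by
    intro e
    rw [MvPolynomial.monomial_eq, Finsupp.prod_fintype _ _ (by simp)]
    simp
  have hright : ∀ p, symbol (g p) = p := by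
    intro p
    induction p using MvPolynomial.induction_on' with
    | monomial e a =>
      have : (monomial e a : MvPolynomial (Fin 2) K) = a • monomial e 1 := by
        simp [MvPolynomial.smul_monomial]
      rw [this, map_smul, map_smul, hg, symbol_monomial, hmon]
    | add p q hp hq => rw [map_add, map_add, hp, hq]
  have hmem : ∀ i j : ℕ, (genX ^ i * genY ^ j : WeylAlgebra K) ∈ LinearMap.range g := by
    intro i j
    refine ⟨monomial (Finsupp.single 0 i + Finsupp.single 1 j) 1, ?_⟩
    rw [hg]
    simp
  have hXmem : ∀ z ∈ LinearMap.range g, genX * z ∈ LinearMap.range g := by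
    rintro _ ⟨p, rfl⟩
    induction p using MvPolynomial.induction_on' with
    | monomial e a =>
      have : (monomial e a : MvPolynomial (Fin 2) K) = a • monomial e 1 := by
        simp [MvPolynomial.smul_monomial]
      rw [this, map_smul, hg, mul_smul_comm, ← mul_assoc, ← pow_succ']
      exact Submodule.smul_mem _ _ (hmem _ _)
    | add p q hp hq => rw [map_add, mul_add]; exact Submodule.add_mem _ hp hq
  have hYmem : ∀ z ∈ LinearMap.range g, genY * z ∈ LinearMap.range g := by
    rintro _ ⟨p, rfl⟩
    induction p using MvPolynomial.induction_on' with
    | monomial e a =>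
      have : (monomial e a : MvPolynomial (Fin 2) K) = a • monomial e 1 := by
        simp [MvPolynomial.smul_monomial]
      rw [this, map_smul, hg, mul_smul_comm, ← mul_assoc, genY_mul_genX_pow, add_mul, mul_assoc,
        ← pow_succ', smul_mul_assoc]
      exact Submodule.smul_mem _ _ (Submodule.add_mem _ (hmem _ _)
        (Submodule.smul_mem _ _ (hmem _ _)))
    | add p q hp hq => rw [map_add, mul_add]; exact Submodule.add_mem _ hp hq
  have hall : ∀ a : FreeAlgebra K (Fin 2), ∀ z ∈ LinearMap.range g,
      RingQuot.mkAlgHom K (WeylRel K) a * z ∈ LinearMap.range g := by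
    intro a
    induction a using FreeAlgebra.induction with
    | grade0 r =>
      intro z hz
      rw [AlgHom.commutes, ← Algebra.smul_def]
      exact Submodule.smul_mem _ _ hz
    | grade1 i =>
      intro z hz
      fin_cases i
      · exact hXmem z hz
      · exact hYmem z hz
    | mul a b ha hb => intro z hz; rw [map_mul, mul_assoc]; exact ha _ (hb z hz)
    | add a b ha hb =>
      intro z hz; rw [map_add, add_mul]; exact Submodule.add_mem _ (ha z hz) (hb z hz)
  have hsurj : ∀ z : WeylAlgebra K, ∃ p, g p = z := by
    intro z
    obtain ⟨a, rfl⟩ := RingQuot.mkAlgHom_surjective K (WeylRel K) z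
    have h1 : (1 : WeylAlgebra K) ∈ LinearMap.range g := by simpa using hmem 0 0
    simpa using hall a 1 h1
  refine ⟨fun a b hab => ?_, fun p => ⟨g p, hright p⟩⟩
  obtain ⟨p, rfl⟩ := hsurj a
  obtain ⟨q, rfl⟩ := hsurj b
  rw [hright, hright] at hab
  rw [hab]

/-! ### Directions, supports, degrees and leading terms -/

/-- The set `𝔙` of directions: coprime pairs `(ρ, σ)` of integers with `ρ + σ > 0`. -/
def directions : Set (ℤ × ℤ) := {d | Int.gcd d.1 d.2 = 1 ∧ 0 < d.1 + d.2}

/-- `v_{ρ,σ}(i, j) = ρ i + σ j` for a point `(i, j)` (with integral or rational coordinates). -/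
def pointDeg {R : Type*} [CommRing R] (d : ℤ × ℤ) (p : R × R) : R :=
  (d.1 : R) * p.1 + (d.2 : R) * p.2

/-- The point `(i, j)` given by the exponent of the monomial `x ^ i * y ^ j`. -/
def expPoint (e : Fin 2 →₀ ℕ) : ℤ × ℤ := ((e 0 : ℤ), (e 1 : ℤ))

/-- The support of a polynomial in `x`, `y`. -/
def suppL (f : MvPolynomial (Fin 2) K) : Finset (ℤ × ℤ) := f.support.image expPoint

/-- The `(ρ,σ)`-degree of a polynomial (`⊥ = -∞` for the zero polynomial). -/
def degL (d : ℤ × ℤ) (f : MvPolynomial (Fin 2) K) : WithBot ℤ :=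
  (suppL f).sup fun p => ((pointDeg d p : ℤ) : WithBot ℤ)

/-- The `(ρ,σ)`-leading term `ℓ_{ρ,σ}` of a polynomial. -/
def leadL (d : ℤ × ℤ) (f : MvPolynomial (Fin 2) K) : MvPolynomial (Fin 2) K :=
  ∑ e ∈ f.support with ((pointDeg d (expPoint e) : ℤ) : WithBot ℤ) = degL d f,
    monomial e (f.coeff e)

/-- The point `w(f) = (i₀, i₀ - v_{1,-1}(f))` for `f ≠ 0`, with
`i₀ = max {i | (i, i - v_{1,-1}(f)) ∈ Supp(ℓ_{1,-1}(f))}`. -/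
def wL (f : MvPolynomial (Fin 2) K) : ℤ × ℤ :=
  let c : ℤ := (degL (1, -1) f).unbotD 0
  let i₀ : ℤ := sSup {i : ℤ | (i, i - c) ∈ suppL (leadL (1, -1) f)}
  (i₀, i₀ - c)

/-- The point `w̄(f) = (i₀ - v_{-1,1}(f), i₀)` for `f ≠ 0`, with
`i₀ = max {i | (i - v_{-1,1}(f), i) ∈ Supp(ℓ_{-1,1}(f))}`. -/
def wbarL (f : MvPolynomial (Fin 2) K) : ℤ × ℤ :=
  let c : ℤ := (degL (-1, 1) f).unbotD 0
  let i₀ : ℤ := sSup {i : ℤ | (i - c, i) ∈ suppL (leadL (-1, 1) f)}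
  (i₀ - c, i₀)

/-- The support of an element of `A₁`. -/
def supp (P : WeylAlgebra K) : Finset (ℤ × ℤ) := suppL (symbol P)

/-- The `(ρ,σ)`-degree of an element of `A₁`, with value `⊥ = -∞` at `0`. -/
def deg (d : ℤ × ℤ) (P : WeylAlgebra K) : WithBot ℤ := degL d (symbol P)

/-- The `(ρ,σ)`-degree of a nonzero element of `A₁`, as an integer (`0` at `0`). -/
def degInt (d : ℤ × ℤ) (P : WeylAlgebra K) : ℤ := (deg d P).unbotD 0

/-- The `(ρ,σ)`-leading term of an element of `A₁`, an element of `K[x, y]`. -/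
def lead (d : ℤ × ℤ) (P : WeylAlgebra K) : MvPolynomial (Fin 2) K := leadL d (symbol P)

/-- The starting point `st_{ρ,σ}(P)` of `ℓ_{ρ,σ}(P)`. -/
def st (d : ℤ × ℤ) (P : WeylAlgebra K) : ℤ × ℤ := wL (lead d P)

/-- The end point `en_{ρ,σ}(P)` of `ℓ_{ρ,σ}(P)`. -/
def en (d : ℤ × ℤ) (P : WeylAlgebra K) : ℤ × ℤ := wbarL (lead d P)

/-- `Dir(P)`: the directions for which the leading term of `P` is not a monomial. -/
def Dir (P : WeylAlgebra K) : Set (ℤ × ℤ) :=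
  {d | d ∈ directions ∧ 1 < (suppL (lead d P)).card}

/-- `P ∈ A₁` is `(ρ,σ)`-homogeneous. -/
def IsHomog (d : ℤ × ℤ) (P : WeylAlgebra K) : Prop := P = 0 ∨ symbol P = lead d P

/-- `P` and `Q` are `(ρ,σ)`-proportional:
`v_{ρ,σ}([P, Q]) < v_{ρ,σ}(P) + v_{ρ,σ}(Q) - (ρ + σ)`. -/
def IsProportional (d : ℤ × ℤ) (P Q : WeylAlgebra K) : Prop :=
  deg d (P * Q - Q * P) + ((d.1 + d.2 : ℤ) : WithBot ℤ) < deg d P + deg d Q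

open Classical in
/-- The bracket `[P, Q]_{ρ,σ}` of nonzero elements of `A₁`. -/
def bracket (d : ℤ × ℤ) (P Q : WeylAlgebra K) : MvPolynomial (Fin 2) K :=
  if IsProportional d P Q then 0 else lead d (P * Q - Q * P)

/-- For an integral point `p = (r, s)` with `r ≠ s`, the unique direction `(ρ, σ) ∈ 𝔙` with
`ρ r + σ s = 0` (see `dir_spec`). -/
def dir (p : ℤ × ℤ) : ℤ × ℤ :=
  if p.2 < p.1 then (-p.2 / (Int.gcd p.1 p.2 : ℤ), p.1 / (Int.gcd p.1 p.2 : ℤ))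
  else (p.2 / (Int.gcd p.1 p.2 : ℤ), -p.1 / (Int.gcd p.1 p.2 : ℤ))

theorem dir_spec (p : ℤ × ℤ) (hp : p.1 ≠ p.2) (d : ℤ × ℤ) :
    d = dir p ↔ d ∈ directions ∧ pointDeg d p = 0 := by
  obtain ⟨r, s⟩ := p
  obtain ⟨ρ, σ⟩ := d
  simp only at hp
  have hg : 0 < Int.gcd r s := by
    rw [Nat.pos_iff_ne_zero, Ne, Int.gcd_eq_zero_iff]
    rintro ⟨rfl, rfl⟩
    exact hp rfl
  obtain ⟨g, r', s', hgpos, hcop, hr, hs⟩ := Int.exists_gcd_one' hg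
  have hgcd : Int.gcd r s = g := by
    rw [hr, hs, Int.gcd_mul_right, hcop]
    simp
  have hgz : (g : ℤ) ≠ 0 := by exact_mod_cast hgpos.ne'
  have hgp : (0 : ℤ) < g := by exact_mod_cast hgpos
  have hne : r' ≠ s' := by
    rintro rfl
    exact hp (hr.trans hs.symm)
  have h2 : -s / (g : ℤ) = -s' := by rw [hs, ← neg_mul]; exact Int.mul_ediv_cancel _ hgz
  have h3 : r / (g : ℤ) = r' := by rw [hr]; exact Int.mul_ediv_cancel _ hgz
  have h4 : s / (g : ℤ) = s' := by rw [hs]; exact Int.mul_ediv_cancel _ hgz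
  have h5 : -r / (g : ℤ) = -r' := by rw [hr, ← neg_mul]; exact Int.mul_ediv_cancel _ hgz
  have hlt : s < r ↔ s' < r' := by
    rw [hr, hs]
    exact mul_lt_mul_iff_left₀ hgp
  have hdir : dir (r, s) = if s' < r' then (-s', r') else (s', -r') := by
    simp only [dir, hgcd, h2, h3, h4, h5, hlt]
  have hz : pointDeg (ρ, σ) (r, s) = (ρ * r' + σ * s') * g := by
    simp only [pointDeg, Int.cast_id]
    rw [hr, hs]
    ring
  rw [hdir, hz]
  simp only [directions, Set.mem_ofPred_eq, mul_eq_zero, hgz, or_false]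
  have hc : IsCoprime r' s' := Int.isCoprime_iff_gcd_eq_one.2 hcop
  constructor
  · intro h
    split_ifs at h with hlt'
    · obtain ⟨rfl, rfl⟩ := Prod.mk.inj h
      refine ⟨⟨?_, by omega⟩, by ring⟩
      rw [Int.neg_gcd, Int.gcd_comm]
      exact hcop
    · obtain ⟨rfl, rfl⟩ := Prod.mk.inj h
      refine ⟨⟨?_, by omega⟩, by ring⟩
      rw [Int.gcd_neg, Int.gcd_comm]
      exact hcop
  · rintro ⟨⟨h1, hpos⟩, h0⟩
    have hd : IsCoprime ρ σ := Int.isCoprime_iff_gcd_eq_one.2 h1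
    obtain ⟨a, b, hab⟩ := hc
    obtain ⟨k, hk⟩ : ∃ k, k = a * σ - b * ρ := ⟨_, rfl⟩
    have hσ : σ = k * r' := by
      rw [hk]
      linear_combination (-σ) * hab + b * h0
    have hρ : ρ = -(k * s') := by
      rw [hk]
      linear_combination (-ρ) * hab + a * h0
    have hku : IsUnit k :=
      hd.isUnit_of_dvd' ⟨-s', by rw [hρ]; ring⟩ ⟨r', hσ⟩
    rcases Int.isUnit_iff.1 hku with rfl | rfl
    · rw [if_pos (by omega), hρ, hσ]
      simp
    · rw [if_neg (by omega), hρ, hσ]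
      simp

/-! ### Counterexamples to the Dixmier conjecture, standard minimal pairs -/

/-- `(P, Q)` is a counterexample to the Dixmier conjecture: `X ↦ P`, `Y ↦ Q` defines an
endomorphism of `A₁` (that is, `[Q, P] = 1`) which is not an automorphism. -/
def IsCounterexample (P Q : WeylAlgebra K) : Prop :=
  ∃ φ : WeylAlgebra K →ₐ[K] WeylAlgebra K, φ genX = P ∧ φ genY = Q ∧ ¬ Function.Bijective φ

/-- `gcd(v_{1,1}(P), v_{1,1}(Q))`, the greatest common divisor of the total degrees. -/
def degGcd (P Q : WeylAlgebra K) : ℕ := Int.gcd (degInt (1, 1) P) (degInt (1, 1) Q)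

variable (K) in
/-- The minimum `B` of `gcd(v_{1,1}(P), v_{1,1}(Q))` over all counterexamples `(P, Q)`;
it is `∞` if there is none. -/
def minGcd : ℕ∞ :=
  ⨅ (P : WeylAlgebra K) (Q : WeylAlgebra K) (_ : IsCounterexample P Q), (degGcd P Q : ℕ∞)

/-- A counterexample at which the minimum `B` is attained. -/
def IsMinimalPair (P Q : WeylAlgebra K) : Prop :=
  IsCounterexample P Q ∧ (degGcd P Q : ℕ∞) = minGcd K

/-- `P` is subrectangular (with some vertex `(a, b)`, `a, b ≥ 1`). -/
def IsSubrectangular (P : WeylAlgebra K) : Prop :=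
  ∃ a b : ℤ, 0 < a ∧ 0 < b ∧ (a, b) ∈ supp P ∧
    ∀ p ∈ supp P, 0 ≤ p.1 ∧ p.1 ≤ a ∧ 0 ≤ p.2 ∧ p.2 ≤ b

/-- Standard minimal pairs. -/
structure IsStandardMinimalPair (P Q : WeylAlgebra K) : Prop where
  minimal : IsMinimalPair P Q
  subrectangular_left : IsSubrectangular P
  subrectangular_right : IsSubrectangular Q
  st_left : pointDeg (1, -1) (st (1, 0) P) < 0
  st_right : pointDeg (1, -1) (st (1, 0) Q) < 0

/-- The directions `(ρ, σ) ∈ Dir(P) ∩ Dir(Q)` along which the lower right edge of the supports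
of a standard minimal pair `(P, Q)` is cut. -/
structure IsCuttingDirection (P Q : WeylAlgebra K) (d : ℤ × ℤ) : Prop where
  mem_left : d ∈ Dir P
  mem_right : d ∈ Dir Q
  sigma_neg : d.2 < 0
  deg_left_pos : 0 < deg d P
  deg_right_pos : 0 < deg d Q
  bracket_eq_zero : bracket d P Q = 0
  ratio : (degInt d P : ℚ) / degInt d Q = (degInt (1, 1) P : ℚ) / degInt (1, 1) Q
  ratio_right_left : ∀ k : ℕ, (degInt d Q : ℚ) / degInt d P ≠ k
  ratio_left_right : ∀ k : ℕ, (degInt d P : ℚ) / degInt d Q ≠ k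
  st_pos : 0 < pointDeg (1, -1) (st d P)
  en_neg : pointDeg (1, -1) (en d P) < 0

/-- `F ∈ A₁` is `(ρ,σ)`-homogeneous with `[P, F]_{ρ,σ} = ℓ_{ρ,σ}(P)` and
`v_{ρ,σ}(F) = ρ + σ`. -/
structure IsBracketFixing (d : ℤ × ℤ) (P F : WeylAlgebra K) : Prop where
  homog : IsHomog d F
  bracket_eq : bracket d P F = lead d P
  deg_eq : deg d F = ((d.1 + d.2 : ℤ) : WithBot ℤ)

/-- The rational point `(1 / m) p`. -/
def scaled (m : ℕ) (p : ℤ × ℤ) : ℚ × ℚ := ((p.1 : ℚ) / m, (p.2 : ℚ) / m)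

/-- For `C₀ = (u, v)` and `C₁ = (r', s')`, the point `C₂ = C₁ + (γ - s') (-σ / ρ, 1)`
with `γ = (v - s') / ρ`. -/
def derivedPoint (d : ℤ × ℤ) (C₀ C₁ : ℚ × ℚ) : ℚ × ℚ :=
  let γ : ℚ := (C₀.2 - C₁.2) / (d.1 : ℚ)
  C₁ + (γ - C₁.2) • (-(d.2 : ℚ) / (d.1 : ℚ), (1 : ℚ))

end Dixmier

end

open Dixmier

noncomputable section

namespace Dixmier

section

open Polynomial

variable {K : Type*} [Field K]

/-! Sending `X` to `w` and `Y` to `E w⁻¹` embeds `A₁` in the skew Laurent ring `K[E][w, w⁻¹]`. There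
`X^i Y^j` becomes `E^j w^(i - j)` up to terms of lower degree in `E`, and the `(ρ, σ)`-degree
becomes the weight in which `w` has weight `ρ` and `E` has weight `ρ + σ`. For `ρ > 0` a leading
form is thus a polynomial in the single variable `E`, whose top and bottom exponents are the second
coordinates of `en` and `st`. The leading part of a commutator is the Poisson bracket `pois`, so
everything turns into statements about degrees and root multiplicities.

Since `[Q, P] = 1` has weight `0`, the leading forms of `P` and `Q` Poisson-commute once their
weights add up to more than `ρ + σ`. If these weights are in the ratio `m : n`, the forms are, up to
constants, `r^m` and `r^n` (`exists_root_of_pois_eq_zero`, `exists_commonEdge`). Minimality gives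
`m, n ≥ 2`, by subtracting powers of one element from the other. From the start of the `(1,
0)`-edge, which lies above the diagonal, one descends along the edges: a vertex above the diagonal
always has a next edge (`exists_next_edge`), and no vertex of the walk lies on the diagonal, so some
edge crosses it (`exists_crossing_edge`). That edge is the cutting direction.

For the fixing element, a dimension count together with the local nilpotence of `[P, ·]` yields `g`
with `h = [p, g] ≠ 0` and `[p, h] = 0`, where `p` is the leading form of `P`. Then `f = g p / h` is
a polynomial and `[p, f]` is proportional to `p` (`exists_fixing`). The relation `pois κ (ρ + σ) r f
= c r` carries the rest. Every root of `r` is a root of `f`, and the top coefficients give `(ρ + σ)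
deg r = κ deg f`, which is the proportionality of `en F` and `C₀`; the numerical claims follow in
`endpoint_arith`.

For the last claim, coprimality forces `f = a E + b E^(ρ + 1)`, so that all nonzero roots of `r`
have the same multiplicity, namely `γ`. If `C₂` had the forbidden form, the embedding `X ↦ w^ρ` and
a shear moving such a root to `0` would give a pair with vertices `m (-1, γ)` and `n (-1, γ)`, which
`no_pair_with_vertex` excludes by infinite descent. -/

/-! ### The skew Laurent ring `K[E][w, w⁻¹]` with `E w = w (E + 1)` -/

/-- The action of `ℤ` on `K[E]` by shifts, `a • p = p (E - a)`. -/
instance shiftAction : MulSemiringAction (Multiplicative ℤ) K[X] where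
  smul a p := p.comp (X - C ((Multiplicative.toAdd a : ℤ) : K))
  one_smul p := by
    change p.comp (X - C ((0 : ℤ) : K)) = p
    simp
  mul_smul a b p := by
    change p.comp (X - C (((Multiplicative.toAdd a + Multiplicative.toAdd b : ℤ)) : K))
      = (p.comp (X - C ((Multiplicative.toAdd b : ℤ) : K))).comp
          (X - C ((Multiplicative.toAdd a : ℤ) : K))
    rw [Polynomial.comp_assoc]
    congr 1
    simp only [sub_comp, X_comp, Int.cast_add, C_add]
    simp
    ring
  smul_zero a := Polynomial.zero_comp
  smul_add a p q := Polynomial.add_comp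
  smul_one a := Polynomial.one_comp
  smul_mul a p q := Polynomial.mul_comp _ _ _

theorem shift_smul_def (a : Multiplicative ℤ) (p : K[X]) :
    a • p = p.comp (X - C ((Multiplicative.toAdd a : ℤ) : K)) := rfl

instance shiftAction_smulCommClass : SMulCommClass (Multiplicative ℤ) K K[X] where
  smul_comm a c p := by
    simp only [shift_smul_def, Polynomial.smul_comp]

variable (K) in
/-- The skew Laurent ring `K[E][w, w⁻¹]` with `E w = w (E + 1)`. -/
abbrev SkewLaurent : Type _ := SkewMonoidAlgebra K[X] (Multiplicative ℤ)

/-- The element `p(E) w ^ a`. -/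
def polyMul (a : ℤ) : K[X] →ₗ[K] SkewLaurent K :=
  SkewMonoidAlgebra.lsingle K (Multiplicative.ofAdd a)

theorem polyMul_mul (a b : ℤ) (p q : K[X]) :
    polyMul a p * polyMul b q = polyMul (a + b) (p * q.comp (X - C (a : K))) := by
  simp only [polyMul, SkewMonoidAlgebra.lsingle_apply, SkewMonoidAlgebra.single_mul_single]
  rfl

theorem polyMul_one : (polyMul 0 1 : SkewLaurent K) = 1 := rfl

theorem zero_smul_skew (b : SkewLaurent K) : (0 : K) • b = 0 := zero_smul K b

/-- The monomial `E ^ j w ^ a`. -/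
def mono (a : ℤ) (j : ℕ) : SkewLaurent K := polyMul a (X ^ j)

/-- The coefficient of `E ^ j w ^ a`. -/
def coef (a : ℤ) (j : ℕ) : SkewLaurent K →ₗ[K] K :=
  Polynomial.lcoeff K j ∘ₗ Finsupp.lapply (Multiplicative.ofAdd a) ∘ₗ
    (SkewMonoidAlgebra.coeffLinearEquiv (S := K)).toLinearMap

theorem coef_polyMul (a b : ℤ) (p : K[X]) (j : ℕ) :
    coef a j (polyMul b p) = if b = a then p.coeff j else 0 := by
  simp only [coef, polyMul, SkewMonoidAlgebra.lsingle_apply]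
  change (Finsupp.single (Multiplicative.ofAdd b) p (Multiplicative.ofAdd a)).coeff j = _
  rw [Finsupp.single_apply]
  simp only [EmbeddingLike.apply_eq_iff_eq]
  split_ifs <;> simp

theorem coef_mono (a b : ℤ) (i j : ℕ) :
    coef a i (mono b j : SkewLaurent K) = if b = a ∧ j = i then 1 else 0 := by
  rw [mono, coef_polyMul, coeff_X_pow]
  by_cases h : b = a <;> by_cases h' : i = j <;> simp [h, h', eq_comm]

theorem polyMul_eq_sum (a : ℤ) (p : K[X]) :
    polyMul a p = ∑ i ∈ p.support, p.coeff i • mono a i := by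
  conv_lhs => rw [p.as_sum_support_C_mul_X_pow]
  simp [mono, ← smul_eq_C_mul, map_sum]

theorem span_mono_eq_top :
    Submodule.span K (Set.range fun x : ℤ × ℕ => (mono x.1 x.2 : SkewLaurent K)) = ⊤ := by
  rw [eq_top_iff]
  intro b _
  refine SkewMonoidAlgebra.induction_on b (Submodule.zero_mem _) (fun a p => ?_)
    fun p q hp hq => Submodule.add_mem _ hp hq
  have : SkewMonoidAlgebra.single a p = polyMul (Multiplicative.toAdd a) p := rfl
  rw [this, polyMul_eq_sum]
  exact Submodule.sum_mem _ fun i _ => Submodule.smul_mem _ _ (Submodule.subset_span ⟨(_, i), rfl⟩)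

theorem ext_coef {b : SkewLaurent K} (h : ∀ a j, coef a j b = 0) : b = 0 := by
  refine SkewMonoidAlgebra.ext fun a => Polynomial.ext fun j => ?_
  exact h (Multiplicative.toAdd a) j

/-! ### Weights, the filtration and symbols -/

/-- The span of the monomials `E ^ j w ^ a` with `α a + β j ≤ N`. -/
def fil (α β N : ℤ) : Submodule K (SkewLaurent K) :=
  Submodule.span K {b | ∃ (a : ℤ) (j : ℕ), α * a + β * j ≤ N ∧ b = mono a j}

/-- The part of weight `N`, with `w` set to `1`. -/
def sym (α β N : ℤ) : SkewLaurent K →ₗ[K] K[X] :=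
  Finsupp.lsum K (fun a : Multiplicative ℤ => (Polynomial.basisMonomials K).constr K
    fun j : ℕ => if α * Multiplicative.toAdd a + β * j = N then (X ^ j : K[X]) else 0) ∘ₗ
    (SkewMonoidAlgebra.coeffLinearEquiv (S := K)).toLinearMap

variable {α β : ℤ}

theorem sym_mono (N a : ℤ) (j : ℕ) :
    sym α β N (mono a j : SkewLaurent K) = if α * a + β * j = N then X ^ j else 0 := by
  simp only [sym, mono, polyMul, SkewMonoidAlgebra.lsingle_apply, LinearMap.comp_apply]
  change (Finsupp.lsum K _) (Finsupp.single (Multiplicative.ofAdd a) (X ^ j)) = _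
  rw [Finsupp.lsum_single]
  have : (X ^ j : K[X]) = Polynomial.basisMonomials K j := by simp [X_pow_eq_monomial]
  conv_lhs => rw [this]
  rw [Module.Basis.constr_basis]
  simp

theorem mono_mem_fil {N a : ℤ} {j : ℕ} (h : α * a + β * j ≤ N) :
    (mono a j : SkewLaurent K) ∈ fil α β N :=
  Submodule.subset_span ⟨a, j, h, rfl⟩

theorem polyMul_mem_fil {N a : ℤ} {p : K[X]} (h : ∀ j, p.coeff j ≠ 0 → α * a + β * j ≤ N) :
    (polyMul a p : SkewLaurent K) ∈ fil α β N := by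
  rw [polyMul_eq_sum]
  exact Submodule.sum_mem _ fun i hi =>
    Submodule.smul_mem _ _ (mono_mem_fil (h i (mem_support_iff.1 hi)))

theorem fil_mono {N M : ℤ} (h : N ≤ M) : (fil α β N : Submodule K (SkewLaurent K)) ≤ fil α β M := by
  refine Submodule.span_mono ?_
  rintro _ ⟨a, j, hj, rfl⟩
  exact ⟨a, j, hj.trans h, rfl⟩

theorem fil_induction {N : ℤ} {motive : SkewLaurent K → Prop}
    (hm : ∀ (a : ℤ) (j : ℕ), α * a + β * j ≤ N → motive (mono a j)) (h0 : motive 0)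
    (hadd : ∀ x y, motive x → motive y → motive (x + y))
    (hsmul : ∀ (c : K) x, motive x → motive (c • x)) {b : SkewLaurent K} (hb : b ∈ fil α β N) :
    motive b := by
  induction hb using Submodule.span_induction with
  | mem x hx => obtain ⟨a, j, h, rfl⟩ := hx; exact hm a j h
  | zero => exact h0
  | add x y _ _ hx hy => exact hadd x y hx hy
  | smul c x _ hx => exact hsmul c x hx

theorem sym_eq_zero_of_mem_fil {N M : ℤ} (h : N < M) {b : SkewLaurent K} (hb : b ∈ fil α β N) :
    sym α β M b = 0 := by
  refine fil_induction (motive := fun b => sym α β M b = 0) (fun a j hj => ?_) (map_zero _)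
    (fun x y hx hy => by rw [map_add, hx, hy, add_zero])
    (fun c x hx => by rw [map_smul, hx, smul_zero]) hb
  rw [sym_mono, if_neg (by omega)]

theorem coef_eq_zero_of_mem_fil {N a : ℤ} {j : ℕ} (h : N < α * a + β * j) {b : SkewLaurent K}
    (hb : b ∈ fil α β N) : coef a j b = 0 := by
  refine fil_induction (motive := fun b => coef a j b = 0) (fun a' j' hj => ?_) (map_zero _)
    (fun x y hx hy => by rw [map_add, hx, hy, add_zero])
    (fun c x hx => by rw [map_smul, hx, smul_zero]) hb
  rw [coef_mono, if_neg]
  rintro ⟨rfl, rfl⟩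
  omega

theorem exists_mem_fil (b : SkewLaurent K) : ∃ N, b ∈ fil α β N := by
  have hb : b ∈ Submodule.span K (Set.range fun x : ℤ × ℕ => (mono x.1 x.2 : SkewLaurent K)) := by
    rw [span_mono_eq_top]; trivial
  induction hb using Submodule.span_induction with
  | mem x hx => obtain ⟨y, rfl⟩ := hx; exact ⟨_, mono_mem_fil le_rfl⟩
  | zero => exact ⟨0, Submodule.zero_mem _⟩
  | add x y _ _ hx hy =>
    obtain ⟨N, hN⟩ := hx
    obtain ⟨M, hM⟩ := hy
    exact ⟨max N M, Submodule.add_mem _ (fil_mono (le_max_left _ _) hN)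
      (fil_mono (le_max_right _ _) hM)⟩
  | smul c x _ hx => obtain ⟨N, hN⟩ := hx; exact ⟨N, Submodule.smul_mem _ _ hN⟩

theorem eq_sum_coef (b : SkewLaurent K) :
    ∃ s : Finset (ℤ × ℕ), b = ∑ x ∈ s, coef x.1 x.2 b • mono x.1 x.2 := by
  have hb : b ∈ Submodule.span K (Set.range fun x : ℤ × ℕ => (mono x.1 x.2 : SkewLaurent K)) := by
    rw [span_mono_eq_top]; trivial
  rw [Finsupp.mem_span_range_iff_exists_finsupp] at hb
  obtain ⟨c, hc⟩ := hb
  refine ⟨c.support, ?_⟩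
  have : ∀ x, coef x.1 x.2 b = c x := by
    intro x
    rw [← hc, Finsupp.sum, map_sum]
    simp only [map_smul, coef_mono, smul_eq_mul, mul_ite, mul_one, mul_zero]
    have : ∀ y : ℤ × ℕ, (y.1 = x.1 ∧ y.2 = x.2) ↔ y = x := fun y => Prod.ext_iff.symm
    simp only [this]
    simp
  simp only [this]
  exact hc.symm

theorem mem_fil_iff {N : ℤ} {b : SkewLaurent K} :
    b ∈ fil α β N ↔ ∀ (a : ℤ) (j : ℕ), coef a j b ≠ 0 → α * a + β * j ≤ N := by
  constructor
  · intro hb a j h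
    by_contra! hlt
    exact h (coef_eq_zero_of_mem_fil hlt hb)
  · intro h
    obtain ⟨s, hs⟩ := eq_sum_coef b
    rw [hs]
    refine Submodule.sum_mem _ fun x _ => ?_
    by_cases hx : coef x.1 x.2 b = 0
    · rw [hx, zero_smul_skew]
      exact Submodule.zero_mem _
    · exact Submodule.smul_mem _ _ (mono_mem_fil (h _ _ hx))

/-- For `α ≠ 0` the weight and the exponent of `E` determine the exponent of `w`, so setting `w = 1`
loses nothing within one weight. -/
theorem coeff_sym (hα : α ≠ 0) (N : ℤ) (b : SkewLaurent K) (j : ℕ) (a : ℤ)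
    (h : α * a + β * j = N) : (sym α β N b).coeff j = coef a j b := by
  obtain ⟨s, hs⟩ := eq_sum_coef b
  rw [hs]
  simp only [map_sum, map_smul, finsetSum_coeff, coeff_smul, sym_mono, coef_mono]
  refine Finset.sum_congr rfl fun x _ => ?_
  congr 1
  split_ifs with h1 h2 h2
  · rw [coeff_X_pow, if_pos h2.2.symm]
  · rw [coeff_X_pow, if_neg]
    rintro rfl
    exact h2 ⟨mul_left_cancel₀ hα (by omega), rfl⟩
  · exfalso
    apply h1
    rw [h2.1, h2.2, h]
  · simp

theorem exists_of_coeff_sym_ne_zero {N : ℤ} {b : SkewLaurent K} {j : ℕ}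
    (h : (sym α β N b).coeff j ≠ 0) : ∃ a : ℤ, α * a + β * j = N := by
  by_contra! hno
  apply h
  obtain ⟨s, hs⟩ := eq_sum_coef b
  rw [hs]
  simp only [map_sum, map_smul, finsetSum_coeff, coeff_smul, sym_mono]
  refine Finset.sum_eq_zero fun x _ => ?_
  split_ifs with h1
  · rw [coeff_X_pow, if_neg, smul_zero]
    rintro rfl
    exact hno _ h1
  · simp

theorem mem_fil_of_sym_eq_zero (hα : α ≠ 0) {N : ℤ} {b : SkewLaurent K} (hb : b ∈ fil α β N)
    (h : sym α β N b = 0) : b ∈ fil α β (N - 1) := by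
  rw [mem_fil_iff] at hb ⊢
  intro a j hc
  have h1 := hb a j hc
  rcases h1.lt_or_eq with h2 | h2
  · omega
  · exact absurd (by rw [← coeff_sym hα N b j a h2, h, coeff_zero]) hc

theorem exists_sym_ne_zero (hα : α ≠ 0) {b : SkewLaurent K} (hb : b ≠ 0) :
    ∃ N, b ∈ fil α β N ∧ sym α β N b ≠ 0 := by
  obtain ⟨a, j, haj⟩ : ∃ a j, coef a j b ≠ 0 := by
    by_contra! h
    exact hb (ext_coef h)
  obtain ⟨N, hN, hmin⟩ := Int.exists_least_of_bdd (P := fun N => b ∈ fil α β N)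
    ⟨α * a + β * j, fun z hz => mem_fil_iff.1 hz a j haj⟩ (exists_mem_fil b)
  refine ⟨N, hN, fun h => ?_⟩
  have := hmin _ (mem_fil_of_sym_eq_zero hα hN h)
  omega

/-! ### Symbols of products and commutators -/

theorem X_sub_C_pow_expand (c : K) (j : ℕ) :
    ∃ r : K[X], (X - C c) ^ j = X ^ j - C (c * j) * X ^ (j - 1) + r ∧
      ∀ i, r.coeff i ≠ 0 → i + 2 ≤ j := by
  induction j with
  | zero => exact ⟨0, by simp, by simp⟩
  | succ j ih =>
    obtain ⟨r, hr, hd⟩ := ih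
    rcases j with _ | j
    · exact ⟨0, by simp, by simp⟩
    refine ⟨C (c * c * (j + 1 : ℕ)) * X ^ j + r * X - C c * r, ?_, ?_⟩
    · rw [pow_succ, hr]
      simp only [Nat.add_sub_cancel, pow_succ, C_mul, Nat.cast_add, Nat.cast_one, C_add, C_1]
      ring
    · intro i hi
      by_contra! hlt
      apply hi
      have h1 : r.coeff i = 0 := by
        by_contra h; have := hd i h; omega
      have h2 : (r * X).coeff i = 0 := by
        rcases i with _ | i
        · simp
        · rw [coeff_mul_X]; by_contra h; have := hd i h; omega
      rw [coeff_sub, coeff_add, coeff_C_mul, coeff_C_mul, coeff_X_pow, h1, h2, if_neg (by omega)]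
      simp

/-- Moving `w ^ a` past `E ^ j'` replaces `E` by `E - a`. The expansion is kept to second order
because the first-order terms are what survives in a commutator. -/
theorem mono_mul_mono (a a' : ℤ) (j j' : ℕ) :
    ∃ r : K[X], (mono a j * mono a' j' : SkewLaurent K) = mono (a + a') (j + j')
      - ((a : K) * j') • mono (a + a') (j + j' - 1) + polyMul (a + a') r ∧
      ∀ i, r.coeff i ≠ 0 → i + 2 ≤ j + j' := by
  obtain ⟨r, hr, hd⟩ := X_sub_C_pow_expand (a : K) j'
  refine ⟨X ^ j * r, ?_, ?_⟩
  · rw [mono, mono, polyMul_mul, X_pow_comp, hr, mono, mono, ← map_smul, ← map_sub, ← map_add]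
    congr 1
    rcases j' with _ | j'
    · simp [mul_add]
    · rw [smul_eq_C_mul, show j + (j' + 1) - 1 = j + j' by omega, show j' + 1 - 1 = j' by omega]
      ring
  · intro i hi
    rw [coeff_X_pow_mul'] at hi
    split_ifs at hi with h
    · have := hd _ hi; omega
    · exact absurd rfl hi

/-- The hypothesis on `c` takes care of the truncated `j - 1` at `j = 0`. -/
theorem smul_mono_pred_mem {N a : ℤ} {j : ℕ} {c : K} (hc : j = 0 → c = 0)
    (h : α * a + β * j ≤ N) : (c • mono a (j - 1) : SkewLaurent K) ∈ fil α β (N - β) := by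
  rcases j with _ | j
  · rw [hc rfl, zero_smul_skew]
    exact Submodule.zero_mem _
  · refine Submodule.smul_mem _ _ (mono_mem_fil ?_)
    rw [Nat.add_sub_cancel]
    push_cast at h
    linarith

theorem polyMul_mem_fil_of_coeff (hβ : 0 < β) {N a : ℤ} {j : ℕ} {r : K[X]}
    (hr : ∀ i, r.coeff i ≠ 0 → i + 2 ≤ j)
    (h : α * a + β * j ≤ N) : (polyMul a r : SkewLaurent K) ∈ fil α β (N - 2 * β) := by
  refine polyMul_mem_fil fun i hi => ?_
  have : (i : ℤ) + 2 ≤ j := by exact_mod_cast hr i hi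
  nlinarith

theorem mono_mul_mono_sub_mem (hβ : 0 < β) {N M a a' : ℤ} {j j' : ℕ} (h : α * a + β * j ≤ N)
    (h' : α * a' + β * j' ≤ M) :
    (mono a j * mono a' j' - mono (a + a') (j + j') : SkewLaurent K) ∈ fil α β (N + M - β) := by
  obtain ⟨r, hr, hd⟩ := mono_mul_mono (K := K) a a' j j'
  have hw : α * (a + a') + β * (j + j' : ℕ) ≤ N + M := by push_cast; linarith
  have h1 := smul_mono_pred_mem (α := α) (β := β) (c := (a : K) * j') (j := j + j')
    (fun h0 => by simp [show j' = 0 by omega]) hw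
  have h2 := fil_mono (by omega) (polyMul_mem_fil_of_coeff hβ hd hw) (M := N + M - β)
  have h3 : (mono a j * mono a' j' - mono (a + a') (j + j') : SkewLaurent K)
      = polyMul (a + a') r - ((a : K) * j') • mono (a + a') (j + j' - 1) := by rw [hr]; abel
  rw [h3]
  exact Submodule.sub_mem _ h2 h1

theorem mono_comm_mono_sub_mem (hβ : 0 < β) {N M a a' : ℤ} {j j' : ℕ} (h : α * a + β * j ≤ N)
    (h' : α * a' + β * j' ≤ M) :
    (mono a j * mono a' j' - mono a' j' * mono a j
      - ((a' : K) * j - (a : K) * j') • mono (a + a') (j + j' - 1) : SkewLaurent K)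
        ∈ fil α β (N + M - 2 * β) := by
  obtain ⟨r, hr, hd⟩ := mono_mul_mono (K := K) a a' j j'
  obtain ⟨r', hr', hd'⟩ := mono_mul_mono (K := K) a' a j' j
  have hw : α * (a + a') + β * (j + j' : ℕ) ≤ N + M := by push_cast; linarith
  have hw' : α * (a' + a) + β * (j' + j : ℕ) ≤ N + M := by push_cast; linarith
  have h2 := polyMul_mem_fil_of_coeff hβ hd hw
  have h2' := polyMul_mem_fil_of_coeff hβ hd' hw'
  have h3 : (mono a j * mono a' j' - mono a' j' * mono a j
      - ((a' : K) * j - (a : K) * j') • mono (a + a') (j + j' - 1) : SkewLaurent K)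
      = polyMul (a + a') r - polyMul (a' + a) r' := by
    rw [hr, hr', add_comm a' a, add_comm j' j, sub_smul]
    abel
  rw [h3]
  exact Submodule.sub_mem _ h2 h2'

/-- By bilinearity it is enough to treat monomials, where every correction term loses at least `β >
0` in weight. The graded ring is therefore commutative. -/
theorem fil_mul (hβ : 0 < β) {N M : ℤ} {b c : SkewLaurent K} (hb : b ∈ fil α β N)
    (hc : c ∈ fil α β M) :
    b * c ∈ fil α β (N + M) ∧ sym α β (N + M) (b * c) = sym α β N b * sym α β M c := by
  refine fil_induction (motive := fun b => b * c ∈ fil α β (N + M) ∧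
    sym α β (N + M) (b * c) = sym α β N b * sym α β M c) (fun a j h => ?_) (by simp)
    (fun x y hx hy => ?_) (fun k x hx => ?_) hb
  · refine fil_induction (motive := fun c => mono a j * c ∈ fil α β (N + M) ∧
      sym α β (N + M) (mono a j * c) = sym α β N (mono a j) * sym α β M c) (fun a' j' h' => ?_)
      (by simp) (fun x y hx hy => ?_) (fun k x hx => ?_) hc
    · have h1 := mono_mul_mono_sub_mem (K := K) hβ h h'
      have h2 : (mono (a + a') (j + j') : SkewLaurent K) ∈ fil α β (N + M) :=
        mono_mem_fil (by push_cast; linarith)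
      have h3 := Submodule.add_mem _ (fil_mono (by omega) h1) h2
      rw [sub_add_cancel] at h3
      refine ⟨h3, ?_⟩
      have h4 := sym_eq_zero_of_mem_fil (M := N + M) (by omega) h1
      rw [map_sub, sub_eq_zero] at h4
      rw [h4, sym_mono, sym_mono, sym_mono]
      by_cases e1 : α * a + β * j = N <;> by_cases e2 : α * a' + β * j' = M
      · rw [if_pos e1, if_pos e2, if_pos (by push_cast; linarith), pow_add]
      · rw [if_neg e2, mul_zero, if_neg]
        push_cast
        intro e3
        apply e2
        linarith
      · rw [if_neg e1, zero_mul, if_neg]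
        push_cast
        intro e3
        apply e1
        linarith
      · rw [if_neg e1, zero_mul, if_neg]
        push_cast
        intro e3
        apply e1
        linarith
    · rw [mul_add, map_add, map_add, mul_add, hx.2, hy.2]
      exact ⟨Submodule.add_mem _ hx.1 hy.1, rfl⟩
    · rw [mul_smul_comm, map_smul, map_smul, mul_smul_comm, hx.2]
      exact ⟨Submodule.smul_mem _ _ hx.1, rfl⟩
  · rw [add_mul, map_add, map_add, add_mul, hx.2, hy.2]
    exact ⟨Submodule.add_mem _ hx.1 hy.1, rfl⟩
  · rw [smul_mul_assoc, map_smul, map_smul, smul_mul_assoc, hx.2]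
    exact ⟨Submodule.smul_mem _ _ hx.1, rfl⟩

/-- The Poisson bracket of weighted-homogeneous elements of degrees `N`, `M`, multiplied by `α`
and with `w` set to `1`. -/
def pois (N M : ℤ) (p q : K[X]) : K[X] :=
  (M : K) • (derivative p * q) - (N : K) • (p * derivative q)

/-- For monomials of exact weights `N = α a + β j` and `M = α a' + β j'` the first-order coefficient
is `a' j - a j'`, and `α (a' j - a j') = M j - N j'`, which is the coefficient of `pois` on `E ^ j`,
`E ^ j'`. The factor `α` avoids a division. -/
theorem fil_comm (hβ : 0 < β) {N M : ℤ} {b c : SkewLaurent K} (hb : b ∈ fil α β N)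
    (hc : c ∈ fil α β M) :
    b * c - c * b ∈ fil α β (N + M - β) ∧
      (α : K) • sym α β (N + M - β) (b * c - c * b) = pois N M (sym α β N b) (sym α β M c) := by
  refine fil_induction (motive := fun b => b * c - c * b ∈ fil α β (N + M - β) ∧
    (α : K) • sym α β (N + M - β) (b * c - c * b) = pois N M (sym α β N b) (sym α β M c))
    (fun a j h => ?_) (by simp [pois]) (fun x y hx hy => ?_) (fun k x hx => ?_) hb
  · refine fil_induction (motive := fun c => mono a j * c - c * mono a j ∈ fil α β (N + M - β) ∧
      (α : K) • sym α β (N + M - β) (mono a j * c - c * mono a j)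
        = pois N M (sym α β N (mono a j)) (sym α β M c))
      (fun a' j' h' => ?_) (by simp [pois]) (fun x y hx hy => ?_) (fun k x hx => ?_) hc
    · have h1 := mono_comm_mono_sub_mem (K := K) hβ h h'
      have hw : α * (a + a') + β * (j + j' : ℕ) ≤ N + M := by push_cast; linarith
      have h2 := smul_mono_pred_mem (α := α) (β := β) (c := (a' : K) * j - (a : K) * j')
        (j := j + j') (fun h0 => by simp [show j' = 0 by omega, show j = 0 by omega]) hw
      have h3 := Submodule.add_mem _ (fil_mono (by omega) h1) h2
      rw [sub_add_cancel] at h3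
      refine ⟨h3, ?_⟩
      have h4 := sym_eq_zero_of_mem_fil (M := N + M - β) (by omega) h1
      rw [map_sub, sub_eq_zero] at h4
      rw [h4, map_smul, sym_mono, sym_mono, sym_mono, pois]
      by_cases e1 : α * a + β * j = N <;> by_cases e2 : α * a' + β * j' = M
      · rw [if_pos e1, if_pos e2, ← e1, ← e2]
        rcases j with _ | j <;> rcases j' with _ | j'
        · simp
        · rw [if_pos (by push_cast; simp; ring)]
          simp [smul_eq_C_mul]
          ring
        · rw [if_pos (by push_cast; simp; ring)]
          simp [smul_eq_C_mul]
          ring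
        · rw [if_pos (by push_cast; rw [show j + 1 + (j' + 1) - 1 = j + j' + 1 by omega]; push_cast; ring),
            show j + 1 + (j' + 1) - 1 = j + j' + 1 by omega]
          simp [smul_eq_C_mul]
          ring
      · rcases (j + j').eq_zero_or_pos with h0 | h0
        · obtain rfl : j' = 0 := by omega
          obtain rfl : j = 0 := by omega
          split_ifs <;> simp
        · rw [if_neg e2, if_neg]
          · simp
          · have : ((j + j' - 1 : ℕ) : ℤ) = j + j' - 1 := by omega
            rw [this]
            intro e3
            apply e2
            linarith
      all_goals
        rcases (j + j').eq_zero_or_pos with h0 | h0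
        · obtain rfl : j' = 0 := by omega
          obtain rfl : j = 0 := by omega
          split_ifs <;> simp
        · rw [if_neg e1, if_neg]
          · simp
          · have : ((j + j' - 1 : ℕ) : ℤ) = j + j' - 1 := by omega
            rw [this]
            intro e3
            apply e1
            linarith
    · have e : mono a j * (x + y) - (x + y) * mono a j
        = (mono a j * x - x * mono a j) + (mono a j * y - y * mono a j) := by
        rw [mul_add, add_mul]; abel
      rw [e, map_add, smul_add, hx.2, hy.2, map_add]
      refine ⟨Submodule.add_mem _ hx.1 hy.1, ?_⟩
      simp only [pois, map_add, smul_eq_C_mul]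
      ring
    · rw [mul_smul_comm, smul_mul_assoc, ← smul_sub, map_smul, smul_comm, hx.2, map_smul]
      refine ⟨Submodule.smul_mem _ _ hx.1, ?_⟩
      simp only [pois, smul_eq_C_mul, derivative_C_mul]
      ring
  · have e : (x + y) * c - c * (x + y) = (x * c - c * x) + (y * c - c * y) := by
      rw [mul_add, add_mul]; abel
    rw [e, map_add, smul_add, hx.2, hy.2, map_add]
    refine ⟨Submodule.add_mem _ hx.1 hy.1, ?_⟩
    simp only [pois, map_add, smul_eq_C_mul]
    ring
  · rw [mul_smul_comm, smul_mul_assoc, ← smul_sub, map_smul, smul_comm, hx.2, map_smul]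
    refine ⟨Submodule.smul_mem _ _ hx.1, ?_⟩
    simp only [pois, smul_eq_C_mul, derivative_C_mul]
    ring

theorem one_mem_fil : (1 : SkewLaurent K) ∈ fil α β 0 := by
  have h : (1 : SkewLaurent K) = mono 0 0 := by rw [mono, pow_zero, polyMul_one]
  rw [h]
  exact mono_mem_fil (by simp)

theorem sym_one : sym α β 0 (1 : SkewLaurent K) = 1 := by
  have h : (1 : SkewLaurent K) = mono 0 0 := by rw [mono, pow_zero, polyMul_one]
  rw [h, sym_mono]
  simp

theorem fil_pow (hβ : 0 < β) {N : ℤ} {b : SkewLaurent K} (hb : b ∈ fil α β N) (n : ℕ) :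
    b ^ n ∈ fil α β (n * N) ∧ sym α β (n * N) (b ^ n) = sym α β N b ^ n := by
  induction n with
  | zero => simpa using ⟨one_mem_fil, sym_one⟩
  | succ n ih =>
    have h := fil_mul hβ ih.1 hb
    have e : ((n + 1 : ℕ) : ℤ) * N = n * N + N := by push_cast; ring
    rw [pow_succ, pow_succ, e, ← ih.2]
    exact h

/-! ### The endomorphism `w ↦ w`, `E ↦ E + c w ^ k` -/

theorem semiconj_aeval {A : Type*} [Ring A] [Algebra K A] {g u v : A} (h : SemiconjBy g u v)
    (p : K[X]) : SemiconjBy g (Polynomial.aeval u p) (Polynomial.aeval v p) := by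
  induction p using Polynomial.induction_on' with
  | add p q hp hq => rw [map_add, map_add]; exact hp.add_right hq
  | monomial n c =>
    rw [aeval_monomial, aeval_monomial]
    exact SemiconjBy.mul_right (Algebra.commutes c g).symm (h.pow_right n)

theorem aeval_sub_algebraMap {A : Type*} [Ring A] [Algebra K A] (u : A) (a : K)
    (p : K[X]) : Polynomial.aeval (u - algebraMap K A a) p
      = Polynomial.aeval u (p.comp (X - C a)) := by
  rw [Polynomial.aeval_comp, map_sub, aeval_X, aeval_C]

/-- The endomorphism of `K[E][w, w⁻¹]` with `w ↦ w` and `E ↦ E + c w ^ k`. -/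
def shear (k : ℤ) (c : K) : SkewLaurent K →ₐ[K] SkewLaurent K :=
  SkewMonoidAlgebra.liftNCAlgHom (Polynomial.aeval (polyMul 0 X + polyMul k (C c)))
    (SkewMonoidAlgebra.of K[X] (Multiplicative ℤ)) (by
      intro p y
      have hg : ∀ y : Multiplicative ℤ, SkewMonoidAlgebra.of K[X] (Multiplicative ℤ) y
        = polyMul (Multiplicative.toAdd y) (1 : K[X]) := fun y => rfl
      have h := semiconj_aeval (g := SkewMonoidAlgebra.of K[X] (Multiplicative ℤ) y)
        (u := polyMul 0 X + polyMul k (C c))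
        (v := polyMul 0 X + polyMul k (C c)
          - algebraMap K (SkewLaurent K) ((Multiplicative.toAdd y : ℤ) : K)) (by
          have h1 : algebraMap K (SkewLaurent K) ((Multiplicative.toAdd y : ℤ) : K)
            = polyMul 0 (C ((Multiplicative.toAdd y : ℤ) : K)) := rfl
          rw [SemiconjBy, hg, h1, mul_add, sub_mul, add_mul, polyMul_mul, polyMul_mul, polyMul_mul,
            polyMul_mul, polyMul_mul, add_comm k]
          simp only [one_mul, X_comp, C_comp, mul_one, one_comp, add_zero, zero_add, map_sub]
          abel) p
      rw [shift_smul_def, ← aeval_sub_algebraMap, ← h.eq])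

theorem shear_polyMul (k : ℤ) (c : K) (a : ℤ) (p : K[X]) :
    shear k c (polyMul a p)
      = Polynomial.aeval (polyMul 0 X + polyMul k (C c)) p * polyMul a 1 := by
  simp only [shear, polyMul, SkewMonoidAlgebra.lsingle_apply]
  exact SkewMonoidAlgebra.liftNC_single _ _ _ _

/-- With weights `(1, k)` both `E` and `w ^ k` have weight `k`, so the shear preserves weights and
becomes the translation `E ↦ E + c` once `w = 1`. -/
theorem shear_mem_fil {k : ℤ} (hk : 0 < k) (c : K) {N : ℤ} {b : SkewLaurent K}
    (hb : b ∈ fil 1 k N) :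
    shear k c b ∈ fil 1 k N ∧ sym 1 k N (shear k c b) = (sym 1 k N b).comp (X + C c) := by
  refine fil_induction (motive := fun b => shear k c b ∈ fil 1 k N ∧
    sym 1 k N (shear k c b) = (sym 1 k N b).comp (X + C c)) (fun a j h => ?_) (by simp)
    (fun x y hx hy => ?_) (fun r x hx => ?_) hb
  · have e1 : (polyMul 0 X : SkewLaurent K) = mono 0 1 := by rw [mono, pow_one]
    have e2 : (polyMul k (C c) : SkewLaurent K) = c • mono k 0 := by
      rw [mono, ← map_smul, pow_zero, smul_eq_C_mul, mul_one]
    have hu : polyMul 0 X + polyMul k (C c) ∈ fil 1 k k ∧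
        sym 1 k k (polyMul 0 X + polyMul k (C c) : SkewLaurent K) = X + C c := by
      rw [e1, e2]
      refine ⟨Submodule.add_mem _ (mono_mem_fil (by simp))
        (Submodule.smul_mem _ _ (mono_mem_fil (by simp))), ?_⟩
      rw [map_add, map_smul, sym_mono, sym_mono]
      simp [smul_eq_C_mul]
    have hw : (polyMul a 1 : SkewLaurent K) = mono a 0 := by rw [mono, pow_zero]
    have h1 := fil_pow hk hu.1 j
    have h2 := fil_mul hk h1.1 (mono_mem_fil (K := K) (α := 1) (β := k) (N := a) (a := a) (j := 0)
      (by simp))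
    rw [h1.2, hu.2, sym_mono, if_pos (by simp), pow_zero, mul_one] at h2
    rw [mono, shear_polyMul, hw, map_pow, aeval_X, ← mono, sym_mono]
    have hle : j * k + a ≤ N := by linarith
    refine ⟨fil_mono hle h2.1, ?_⟩
    split_ifs with he
    · rw [show N = j * k + a by linarith, h2.2, X_pow_comp]
    · rw [zero_comp]
      refine sym_eq_zero_of_mem_fil (lt_of_le_of_ne hle fun h3 => he ?_) h2.1
      linarith
  · rw [map_add, map_add, map_add, hx.2, hy.2, add_comp]
    exact ⟨Submodule.add_mem _ hx.1 hy.1, rfl⟩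
  · rw [map_smul, map_smul, map_smul, hx.2, smul_comp]
    exact ⟨Submodule.smul_mem _ _ hx.1, rfl⟩

end

section

open Polynomial

variable {K : Type*} [Field K]

/-! ### Multiplicities of roots and Poisson brackets -/

theorem X_sub_C_mul_derivative_pow (z : K) (s : ℕ) :
    (X - C z) * derivative ((X - C z) ^ s) = C (s : K) * (X - C z) ^ s := by
  rcases s with _ | s
  · simp
  · rw [derivative_X_sub_C_pow]
    simp only [Nat.add_sub_cancel]
    rw [pow_succ]
    simp
    ring

/-- Splitting off the powers of `X - z` leaves a factor whose value at `z` is `(M s - N t) p(z)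
q(z)`. All local arguments below read off this value. -/
theorem pois_local (N M : ℤ) (z : K) (s t : ℕ) (p q : K[X]) :
    (X - C z) * pois N M ((X - C z) ^ s * p) ((X - C z) ^ t * q) = (X - C z) ^ (s + t) *
      (C ((M : K) * s - N * t) * (p * q) + (X - C z) * pois N M p q) := by
  have h1 := X_sub_C_mul_derivative_pow z s
  have h2 := X_sub_C_mul_derivative_pow z t
  simp only [pois, derivative_mul, smul_eq_C_mul, pow_add, C_sub, C_mul]
  linear_combination (C (M : K) * p * (X - C z) ^ t * q) * h1
    - (C (N : K) * p * (X - C z) ^ s * q) * h2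

theorem exists_eq_pow_mul_eval_ne_zero {p : K[X]} (hp : p ≠ 0) (z : K) :
    ∃ p₁ : K[X], p = (X - C z) ^ (rootMultiplicity z p) * p₁ ∧ p₁.eval z ≠ 0 := by
  obtain ⟨g, hg, hd⟩ := exists_eq_pow_rootMultiplicity_mul_and_not_dvd p hp z
  exact ⟨g, hg, fun h => hd (dvd_iff_isRoot.2 h)⟩

theorem rootMultiplicity_pow_mul {z : K} {u : K[X]} (hu : u.eval z ≠ 0) (s : ℕ) :
    rootMultiplicity z ((X - C z) ^ s * u) = s := by
  have hu0 : u ≠ 0 := by rintro rfl; simp at hu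
  have h0 : (X - C z) ^ s * u ≠ 0 := mul_ne_zero (pow_ne_zero _ (X_sub_C_ne_zero z)) hu0
  rw [rootMultiplicity_mul h0, rootMultiplicity_X_sub_C_pow, rootMultiplicity_eq_zero hu, add_zero]

theorem rootMultiplicity_pois [CharZero K] {N M : ℤ} {p q : K[X]} (hp : p ≠ 0) (hq : q ≠ 0) {z : K}
    (h : M * rootMultiplicity z p ≠ N * rootMultiplicity z q) :
    pois N M p q ≠ 0 ∧
      rootMultiplicity z (pois N M p q) + 1 = rootMultiplicity z p + rootMultiplicity z q := by
  obtain ⟨p₁, hp₁, hp0⟩ := exists_eq_pow_mul_eval_ne_zero hp z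
  obtain ⟨q₁, hq₁, hq0⟩ := exists_eq_pow_mul_eval_ne_zero hq z
  set s := rootMultiplicity z p
  set t := rootMultiplicity z q
  have e := pois_local N M z s t p₁ q₁
  rw [← hp₁, ← hq₁] at e
  have hc : (M : K) * s - N * t ≠ 0 := by
    rw [sub_ne_zero]
    exact_mod_cast h
  have hW : (C ((M : K) * s - N * t) * (p₁ * q₁) + (X - C z) * pois N M p₁ q₁).eval z ≠ 0 := by
    simp only [eval_add, eval_mul, eval_C, eval_sub, eval_X, sub_self, zero_mul, add_zero]
    exact mul_ne_zero hc (mul_ne_zero hp0 hq0)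
  have hm := rootMultiplicity_pow_mul hW (s + t)
  have hne : (X - C z) * pois N M p q ≠ 0 := by
    rw [e]
    refine mul_ne_zero (pow_ne_zero _ (X_sub_C_ne_zero z)) ?_
    intro h0
    rw [h0] at hW
    simp at hW
  refine ⟨right_ne_zero_of_mul hne, ?_⟩
  rw [← hm, ← e, rootMultiplicity_mul hne, rootMultiplicity_X_sub_C_self, add_comm]

theorem mul_rootMultiplicity_eq_of_pois_eq_zero [CharZero K] {N M : ℤ} {p q : K[X]} (hp : p ≠ 0)
    (hq : q ≠ 0) (h : pois N M p q = 0) (z : K) :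
    M * rootMultiplicity z p = N * rootMultiplicity z q := by
  by_contra hne
  exact (rootMultiplicity_pois hp hq hne).1 h

theorem natDegree_X_mul_derivative_le (p : K[X]) : (X * derivative p).natDegree ≤ p.natDegree := by
  rw [natDegree_le_iff_coeff_eq_zero]
  intro n hn
  rcases n with _ | n
  · simp
  · rw [coeff_X_mul, coeff_derivative, coeff_eq_zero_of_natDegree_lt hn, zero_mul]

theorem coeff_X_mul_derivative (p : K[X]) (n : ℕ) : (X * derivative p).coeff n = n * p.coeff n := by
  rcases n with _ | n
  · simp
  · rw [coeff_X_mul, coeff_derivative]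
    push_cast
    ring

/-- The counterpart at infinity of `pois_local`: the extra factor `X` makes both derivatives act by
`n` on the `n`-th coefficient. -/
theorem coeff_X_mul_pois (N M : ℤ) (p q : K[X]) :
    (X * pois N M p q).coeff (p.natDegree + q.natDegree)
      = ((M : K) * p.natDegree - N * q.natDegree) * (p.leadingCoeff * q.leadingCoeff) := by
  have e : X * pois N M p q = C (M : K) * ((X * derivative p) * q)
      - C (N : K) * (p * (X * derivative q)) := by
    simp only [pois, smul_eq_C_mul]
    ring
  rw [e, coeff_sub, coeff_C_mul, coeff_C_mul,
    coeff_mul_add_eq_of_natDegree_le (natDegree_X_mul_derivative_le p) le_rfl,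
    coeff_mul_add_eq_of_natDegree_le le_rfl (natDegree_X_mul_derivative_le q),
    coeff_X_mul_derivative, coeff_X_mul_derivative]
  simp only [leadingCoeff]
  ring

theorem mul_natDegree_eq_of_pois_eq_zero [CharZero K] {N M : ℤ} {p q : K[X]} (hp : p ≠ 0)
    (hq : q ≠ 0) (h : pois N M p q = 0) : M * p.natDegree = N * q.natDegree := by
  have e := coeff_X_mul_pois N M p q
  rw [h, mul_zero, coeff_zero] at e
  rcases mul_eq_zero.1 e.symm with h1 | h1
  · rw [sub_eq_zero] at h1
    exact_mod_cast h1
  · exact absurd h1 (mul_ne_zero (leadingCoeff_ne_zero.2 hp) (leadingCoeff_ne_zero.2 hq))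

/-- Weighted-homogeneous elements whose bracket vanishes are powers of a common element. -/
theorem exists_root_of_pois_eq_zero [CharZero K] [IsAlgClosed K] {m n : ℕ} (hm : 0 < m)
    (hmn : m.Coprime n) {κ : ℤ} (hκ : κ ≠ 0) {p q : K[X]} (hp : p ≠ 0) (hq : q ≠ 0)
    (h : pois (m * κ) (n * κ) p q = 0) :
    ∃ (r : K[X]) (c d : K), r ≠ 0 ∧ c ≠ 0 ∧ d ≠ 0 ∧ p = C c * r ^ m ∧ q = C d * r ^ n := by
  classical
  -- At every point the multiplicities of `p` and `q` are in the ratio `m : n`. By coprimality `m`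
  -- divides the former, and the quotients are the multiplicities of the common root `r`.
  have key : ∀ z, n * p.roots.count z = m * q.roots.count z := by
    intro z
    have := mul_rootMultiplicity_eq_of_pois_eq_zero hp hq h z
    rw [count_roots, count_roots]
    have h2 : κ * ((n : ℤ) * rootMultiplicity z p) = κ * (m * rootMultiplicity z q) := by linarith
    exact_mod_cast mul_left_cancel₀ hκ h2
  have hdiv : ∀ z, m ∣ p.roots.count z := fun z =>
    hmn.dvd_of_dvd_mul_left (Dvd.intro _ (key z).symm)
  let W : Multiset K := ∑ z ∈ p.roots.toFinset, (p.roots.count z / m) • {z}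
  have hW : ∀ z, W.count z = p.roots.count z / m := by
    intro z
    simp only [W, Multiset.count_sum', Multiset.count_nsmul, Multiset.count_singleton]
    simp only [mul_ite, mul_one, mul_zero, Finset.sum_ite_eq, Multiset.mem_toFinset]
    split_ifs with hz
    · rfl
    · rw [Multiset.count_eq_zero_of_notMem hz, Nat.zero_div]
  have h1 : p.roots = m • W := by
    ext z
    rw [Multiset.count_nsmul, hW, Nat.mul_div_cancel' (hdiv z)]
  have h2 : q.roots = n • W := by
    ext z
    rw [Multiset.count_nsmul, hW]
    obtain ⟨k, hk⟩ := hdiv z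
    have := key z
    rw [hk, Nat.mul_div_cancel_left _ hm]
    rw [hk] at this
    nlinarith
  refine ⟨(W.map fun a => X - C a).prod, p.leadingCoeff, q.leadingCoeff, ?_,
    leadingCoeff_ne_zero.2 hp, leadingCoeff_ne_zero.2 hq, ?_, ?_⟩
  · exact (monic_multiset_prod_of_monic _ _ fun a _ => monic_X_sub_C a).ne_zero
  · conv_lhs => rw [(IsAlgClosed.splits p).eq_prod_roots]
    rw [h1, Multiset.map_nsmul, Multiset.prod_nsmul]
  · conv_lhs => rw [(IsAlgClosed.splits q).eq_prod_roots]
    rw [h2, Multiset.map_nsmul, Multiset.prod_nsmul]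

theorem pois_pow_left (m : ℕ) (hm : 0 < m) (κ M : ℤ) (c : K) (r f : K[X]) :
    pois (m * κ) M (C c * r ^ m) f = C (c * m) * r ^ (m - 1) * pois κ M r f := by
  obtain ⟨m, rfl⟩ : ∃ k, m = k + 1 := ⟨m - 1, by omega⟩
  simp only [pois, smul_eq_C_mul, derivative_C_mul, derivative_pow, Nat.add_sub_cancel, C_mul]
  push_cast
  simp only [map_mul, map_add, map_natCast, map_one]
  ring

/-- If `[p, f] = c p` and `p` is a power of `r` then `[r, f]` is a multiple of `r`. -/
theorem pois_root [CharZero K] {m : ℕ} (hm : 0 < m) {κ M : ℤ} {c d : K} (hd : d ≠ 0) {r f : K[X]}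
    (hr : r ≠ 0) (h : pois (m * κ) M (C d * r ^ m) f = C c * (C d * r ^ m)) :
    pois κ M r f = C (c / m) * r := by
  have hm' : (m : K) ≠ 0 := by exact_mod_cast hm.ne'
  rw [pois_pow_left m hm] at h
  have h0 : C (d * m) * r ^ (m - 1) ≠ 0 :=
    mul_ne_zero (C_ne_zero.2 (mul_ne_zero hd hm')) (pow_ne_zero _ hr)
  refine mul_left_cancel₀ h0 (h.trans ?_)
  have e : C c = C (c / m) * C (m : K) := by rw [← C_mul, div_mul_cancel₀ _ hm']
  obtain ⟨k, rfl⟩ : ∃ k, m = k + 1 := ⟨m - 1, by omega⟩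
  rw [e, C_mul, Nat.add_sub_cancel, pow_succ]
  ring

/-- If `[p, g] = h ≠ 0` and `[p, h] = 0`, then `f = g p / h` is a polynomial with `[p, f]`
proportional to `p`. -/
theorem exists_quotient_of_pois [CharZero K] [IsAlgClosed K] {N D D' β : ℤ} (hN : 0 < N)
    (hβ : 0 < β) (hD : D' = D + N - β) {p g h : K[X]} (hp : p ≠ 0)
    {c : K} (hc : c ≠ 0) (hgh : pois N D p g = C c * h) (hh : h ≠ 0) (hph : pois N D' p h = 0) :
    ∃ f, h * f = g * p ∧ pois N β p f = C c * p := by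
  classical
  have hg : g ≠ 0 := by
    rintro rfl
    have : C c * h = 0 := by rw [← hgh]; simp [pois]
    exact mul_ne_zero (C_ne_zero.2 hc) hh this
  -- Compare multiplicities at each `z`. When `D s = N t` (with `s`, `t` those of `p`, `g`), `[p, h]
  -- = 0` gives `N` times the multiplicity of `h` as `N (t + s) - β s`; otherwise `h`, being
  -- proportional to `[p, g]`, has multiplicity `s + t - 1`. Neither exceeds that of `g p`.
  have hdvd : h ∣ g * p := by
    rw [(IsAlgClosed.splits h).dvd_iff_roots_le_roots hh (mul_ne_zero hg hp), Multiset.le_iff_count]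
    intro z
    rw [count_roots, count_roots, rootMultiplicity_mul (mul_ne_zero hg hp)]
    have e1 := mul_rootMultiplicity_eq_of_pois_eq_zero hp hh hph z
    by_cases e2 : D * rootMultiplicity z p = N * rootMultiplicity z g
    · have e3 : N * (rootMultiplicity z h : ℤ)
          = N * (rootMultiplicity z g + rootMultiplicity z p) - β * rootMultiplicity z p := by
        rw [← e1, hD]
        linarith
      have e4 : N * (rootMultiplicity z h : ℤ) ≤ N * (rootMultiplicity z g + rootMultiplicity z p) := by
        have : 0 ≤ β * (rootMultiplicity z p : ℤ) := by positivity
        linarith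
      exact_mod_cast le_of_mul_le_mul_left e4 hN
    · have e3 := (rootMultiplicity_pois hp hg e2).2
      rw [hgh, rootMultiplicity_mul (mul_ne_zero (C_ne_zero.2 hc) hh), rootMultiplicity_C] at e3
      omega
  obtain ⟨f, hf⟩ := hdvd
  refine ⟨f, hf.symm, ?_⟩
  have hf' := congrArg derivative hf
  simp only [derivative_mul] at hf'
  have hD' : C (D : K) = C (D' : K) - C (N : K) + C (β : K) := by
    rw [← C_sub, ← C_add]
    congr 1
    rw [hD]
    push_cast
    ring
  -- Cleared of the denominator `h ^ 2`, the claim is a combination of the two bracket relations, of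
  -- `h f = g p` and of its derivative.
  refine mul_left_cancel₀ (mul_ne_zero hh hh) ?_
  simp only [pois, smul_eq_C_mul, hD'] at hgh hph ⊢
  linear_combination (p * h) * hgh + (-(g * p)) * hph
    - (C (β : K) * derivative p * h + C (N : K) * p * derivative h) * hf
    + (C (N : K) * p * h) * hf'

/-! ### Common roots -/

/-- If `f z ≠ 0` at a root of `r` of multiplicity `s > 0`, the bracket has order exactly `s - 1` at
`z`, because `β s ≠ 0`. The right-hand side has order at least `s`. -/
theorem eval_eq_zero_of_pois [CharZero K] {κ β : ℤ} (hβ : 0 < β) {c : K}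
    {r f : K[X]} (hr : r ≠ 0) (h : pois κ β r f = C c * r) {z : K} (hz : r.eval z = 0) :
    f.eval z = 0 := by
  by_contra hf
  obtain ⟨r₁, hr₁, hr0⟩ := exists_eq_pow_mul_eval_ne_zero hr z
  have hs : 0 < rootMultiplicity z r := (rootMultiplicity_pos hr).2 hz
  have e := pois_local κ β z (rootMultiplicity z r) 0 r₁ f
  rw [pow_zero, one_mul, ← hr₁, h, add_zero] at e
  have e2 : (X - C z) * (C c * r₁) = C ((β : K) * rootMultiplicity z r - κ * (0 : ℕ)) * (r₁ * f)
      + (X - C z) * pois κ β r₁ f := by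
    refine mul_left_cancel₀ (pow_ne_zero (rootMultiplicity z r) (X_sub_C_ne_zero z)) (Eq.trans ?_ e)
    conv_rhs => rw [hr₁]
    ring
  have e3 := congrArg (eval z) e2
  simp only [eval_add, eval_mul, eval_C, eval_sub, eval_X, sub_self, zero_mul, add_zero,
    Nat.cast_zero, mul_zero, sub_zero] at e3
  have : (β : K) ≠ 0 := by exact_mod_cast hβ.ne'
  have h3 : ((rootMultiplicity z r : ℕ) : K) ≠ 0 := by exact_mod_cast hs.ne'
  exact mul_ne_zero (mul_ne_zero this h3) (mul_ne_zero hr0 hf) e3.symm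

/-- Comparison of the coefficients of order `s` at a root of `f`, where `s` is the multiplicity in
`r`. Consequently `f'` at the point determines `s` when `c ≠ 0`. -/
theorem sub_mul_eval_derivative_of_pois {κ β : ℤ} {c : K} {r f : K[X]} (hr : r ≠ 0)
    (h : pois κ β r f = C c * r) {z : K} (hz : f.eval z = 0) :
    ((β : K) * rootMultiplicity z r - κ) * (derivative f).eval z = c := by
  obtain ⟨r₁, hr₁, hr0⟩ := exists_eq_pow_mul_eval_ne_zero hr z
  obtain ⟨f₁, hf₁⟩ := dvd_iff_isRoot.2 hz
  have e := pois_local κ β z (rootMultiplicity z r) 1 r₁ f₁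
  rw [pow_one, ← hf₁, ← hr₁, h, pow_succ] at e
  have e2 : C c * r₁ = C ((β : K) * rootMultiplicity z r - κ * (1 : ℕ)) * (r₁ * f₁)
      + (X - C z) * pois κ β r₁ f₁ := by
    refine mul_left_cancel₀ (mul_ne_zero (pow_ne_zero (rootMultiplicity z r) (X_sub_C_ne_zero z))
      (X_sub_C_ne_zero z)) (Eq.trans ?_ e)
    conv_rhs => rw [hr₁]
    ring
  have e3 := congrArg (eval z) e2
  simp only [eval_add, eval_mul, eval_C, eval_sub, eval_X, sub_self, zero_mul, add_zero,
    Nat.cast_one, mul_one] at e3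
  have e4 : (derivative f).eval z = f₁.eval z := by
    conv_lhs => rw [hf₁]
    simp
  rw [e4]
  refine mul_right_cancel₀ hr0 ?_
  rw [e3]
  ring

/-- A root of `r` is a root of `f`, so `f` is not constant. If `deg f ≥ 2`, the coefficient of `[r,
f]` in degree `deg r + deg f - 1` lies above the degree of `c r` and must vanish. -/
theorem natDegree_of_pois [CharZero K] [IsAlgClosed K] {κ β : ℤ} (hβ : 0 < β) {c : K} (hc : c ≠ 0)
    {r f : K[X]} (hr : 0 < r.natDegree) (h : pois κ β r f = C c * r) :
    f ≠ 0 ∧ (f.natDegree = 1 ∨ 2 ≤ f.natDegree ∧ β * r.natDegree = κ * f.natDegree) := by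
  have hr0 : r ≠ 0 := by rintro rfl; simp at hr
  have hf : f ≠ 0 := by
    rintro rfl
    have : C c * r = 0 := by rw [← h]; simp [pois]
    exact mul_ne_zero (C_ne_zero.2 hc) hr0 this
  refine ⟨hf, ?_⟩
  obtain ⟨z, hz⟩ := IsAlgClosed.exists_root r (by
    rw [degree_eq_natDegree hr0]; exact_mod_cast hr.ne')
  have hfz := eval_eq_zero_of_pois hβ hr0 h hz
  have h1 : 0 < f.natDegree := by
    by_contra h0
    rw [eq_C_of_natDegree_eq_zero (by omega : f.natDegree = 0)] at hfz hf
    simp only [eval_C] at hfz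
    rw [hfz] at hf
    simp at hf
  by_cases h2 : f.natDegree = 1
  · exact Or.inl h2
  · right
    refine ⟨by omega, ?_⟩
    have e := coeff_X_mul_pois κ β r f
    rw [h, show r.natDegree + f.natDegree = (r.natDegree + f.natDegree - 1) + 1 by omega,
      coeff_X_mul, coeff_C_mul, coeff_eq_zero_of_natDegree_lt (by omega), mul_zero] at e
    rcases mul_eq_zero.1 e.symm with h3 | h3
    · rw [sub_eq_zero] at h3
      exact_mod_cast h3
    · exact absurd h3 (mul_ne_zero (leadingCoeff_ne_zero.2 hr0) (leadingCoeff_ne_zero.2 hf))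

theorem eq_C_mul_X_sub_C_pow [IsAlgClosed K] {r : K[X]} {a : K} (h : ∀ z ∈ r.roots, z = a) :
    r = C r.leadingCoeff * (X - C a) ^ r.natDegree := by
  have h1 := Multiset.eq_replicate_card.2 h
  rw [← (IsAlgClosed.splits r).natDegree_eq_card_roots] at h1
  conv_lhs => rw [(IsAlgClosed.splits r).eq_prod_roots, h1]
  simp

/-- If `f` is linear, then `r` has a single root. -/
theorem exists_eq_pow_of_natDegree_eq_one [CharZero K] [IsAlgClosed K] {κ β : ℤ} (hβ : 0 < β)
    {c : K} {r f : K[X]} (hr : r ≠ 0) (h : pois κ β r f = C c * r) (hf : f.natDegree = 1) :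
    ∃ a, f.eval a = 0 ∧ r = C r.leadingCoeff * (X - C a) ^ r.natDegree := by
  have hf1 : f.coeff 1 ≠ 0 := by
    have : f.leadingCoeff ≠ 0 := leadingCoeff_ne_zero.2 (by rintro rfl; simp at hf)
    rwa [leadingCoeff, hf] at this
  have hfe : f = C (f.coeff 1) * X + C (f.coeff 0) := eq_X_add_C_of_natDegree_le_one hf.le
  have hroot : ∀ z, f.eval z = 0 → z = -(f.coeff 0) / f.coeff 1 := by
    intro z hz
    rw [hfe] at hz
    simp only [eval_add, eval_mul, eval_C, eval_X] at hz
    rw [eq_div_iff hf1]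
    linear_combination hz
  refine ⟨-(f.coeff 0) / f.coeff 1, ?_, eq_C_mul_X_sub_C_pow fun z hz => ?_⟩
  · rw [hfe]
    simp only [eval_add, eval_mul, eval_C, eval_X]
    simp
    field_simp
    ring
  · exact hroot z (eval_eq_zero_of_pois hβ hr h (isRoot_of_mem_roots hz))

end

section

open Polynomial

variable {K : Type*} [Field K]

/-! ### Exponents of weighted-homogeneous elements -/

/-- The exponents of `p` are those of an element of weight `N`. -/
def ExpClass (α β N : ℤ) (p : K[X]) : Prop := ∀ j : ℕ, p.coeff j ≠ 0 → α ∣ N - β * j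

theorem expClass_sym (α β N : ℤ) (b : SkewLaurent K) : ExpClass α β N (sym α β N b) := by
  intro j hj
  obtain ⟨a, ha⟩ := exists_of_coeff_sym_ne_zero hj
  exact ⟨a, by linarith⟩

/-- A congruence condition on exponents is the eigenvector equation `p(ζ^β X) = ζ^N p`. In this form
it passes to products and quotients. -/
theorem expClass_iff {a : ℕ} (ha : 0 < a) {ζ : K} (hζ : IsPrimitiveRoot ζ a) (β N : ℤ) (p : K[X]) :
    ExpClass a β N p ↔ p.comp (C (ζ ^ β) * X) = C (ζ ^ N) * p := by
  have h0 : ζ ≠ 0 := hζ.ne_zero ha.ne'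
  have key : ∀ j : ℕ, (a : ℤ) ∣ N - β * j ↔ (ζ ^ β) ^ j = ζ ^ N := by
    intro j
    rw [← zpow_natCast (ζ ^ β), ← zpow_mul, eq_comm, ← hζ.zpow_eq_one_iff_dvd, zpow_sub₀ h0,
      div_eq_one_iff_eq (zpow_ne_zero _ h0)]
  constructor
  · intro h
    ext j
    rw [comp_C_mul_X_coeff, coeff_C_mul]
    by_cases hj : p.coeff j = 0
    · simp [hj]
    · rw [(key j).1 (h j hj), mul_comm]
  · intro h j hj
    rw [key]
    have := congrArg (fun q => q.coeff j) h
    simp only [comp_C_mul_X_coeff, coeff_C_mul] at this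
    rw [mul_comm] at this
    exact mul_right_cancel₀ hj this

theorem eq_pow_of_two_le_rootMultiplicity [IsAlgClosed K] {r : K[X]} (hr : r.natDegree = 2)
    (h : ∀ z, r.eval z = 0 → 2 ≤ rootMultiplicity z r) :
    ∃ a, r = C r.leadingCoeff * (X - C a) ^ 2 := by
  classical
  have hr0 : r ≠ 0 := by rintro rfl; simp at hr
  obtain ⟨a, ha⟩ := IsAlgClosed.exists_root r (by
    rw [degree_eq_natDegree hr0, hr]; norm_num)
  refine ⟨a, ?_⟩
  have h1 : Multiset.replicate 2 a ≤ r.roots := by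
    rw [← Multiset.le_count_iff_replicate_le, count_roots]
    exact h a ha
  have h2 : Multiset.replicate 2 a = r.roots := by
    refine Multiset.eq_of_le_of_card_le h1 ?_
    rw [← (IsAlgClosed.splits r).natDegree_eq_card_roots, hr, Multiset.card_replicate]
  have := eq_C_mul_X_sub_C_pow (r := r) (a := a) fun z hz => by
    rw [← h2] at hz
    exact Multiset.eq_of_mem_replicate hz
  rwa [hr] at this

section

variable [CharZero K] [IsAlgClosed K]

variable (K) in
theorem exists_primitiveRoot {a : ℕ} (ha : 0 < a) : ∃ ζ : K, IsPrimitiveRoot ζ a := by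
  have : NeZero a := ⟨ha.ne'⟩
  have : NeZero (a : K) := ⟨by exact_mod_cast ha.ne'⟩
  exact HasEnoughRootsOfUnity.exists_primitiveRoot K a

theorem ExpClass.mul {α β N M : ℤ} (hα : 0 < α) {p q : K[X]} (hp : ExpClass α β N p)
    (hq : ExpClass α β M q) : ExpClass α β (N + M) (p * q) := by
  lift α to ℕ using hα.le
  have ha : 0 < α := by exact_mod_cast hα
  obtain ⟨ζ, hζ⟩ := exists_primitiveRoot K ha
  rw [expClass_iff ha hζ] at *
  rw [mul_comp, hp, hq, zpow_add₀ (hζ.ne_zero ha.ne'), C_mul]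
  ring

theorem ExpClass.of_mul {α β N M : ℤ} (hα : 0 < α) {h f : K[X]} (h0 : h ≠ 0)
    (hh : ExpClass α β N h) (hu : ExpClass α β M (h * f)) : ExpClass α β (M - N) f := by
  lift α to ℕ using hα.le
  have ha : 0 < α := by exact_mod_cast hα
  obtain ⟨ζ, hζ⟩ := exists_primitiveRoot K ha
  rw [expClass_iff ha hζ] at *
  have hz := hζ.ne_zero ha.ne'
  rw [mul_comp, hh] at hu
  refine mul_left_cancel₀ (mul_ne_zero (C_ne_zero.2 (zpow_ne_zero N hz)) h0) (hu.trans ?_)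
  rw [show M = N + (M - N) by ring, zpow_add₀ hz, C_mul, add_sub_cancel_left]
  ring

/-- The substitution `X ↦ ζ^β X` preserves the roots of `r ^ m` with multiplicity, hence those of
`r`, and so only rescales `r`. The hypothesis on the leading exponent identifies the scalar among
the possible `m`-th roots. -/
theorem ExpClass.of_pow {α β κ : ℤ} (hα : 0 < α) {m : ℕ} (hm : 0 < m) {r : K[X]} {c : K}
    (hc : c ≠ 0) (hr : r ≠ 0) (h : ExpClass α β (m * κ) (C c * r ^ m))
    (htop : α ∣ κ - β * r.natDegree) : ExpClass α β κ r := by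
  classical
  lift α to ℕ using hα.le
  have ha : 0 < α := by exact_mod_cast hα
  obtain ⟨ζ, hζ⟩ := exists_primitiveRoot K ha
  have hz := hζ.ne_zero ha.ne'
  have h' := (expClass_iff ha hζ β (m * κ) _).1 h
  rw [expClass_iff ha hζ]
  have hzz : ζ ^ β ≠ 0 := zpow_ne_zero _ hz
  set u := r.comp (C (ζ ^ β) * X) with hu
  have hu0 : u ≠ 0 := by
    intro h0
    apply hr
    ext j
    have := congrArg (fun q => q.coeff j) h0
    simp only [hu, comp_C_mul_X_coeff, coeff_zero] at this
    simpa [hzz] using this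
  have e1 : C c * u ^ m = C (ζ ^ (m * κ)) * (C c * r ^ m) := by
    rw [← h', mul_comp, C_comp, pow_comp]
  have e2 : pois (m * 1) (m * 1) (C c * r ^ m) (C c * u ^ m) = 0 := by
    rw [e1]
    simp only [pois, derivative_C_mul, smul_eq_C_mul]
    ring
  have e3 : ∀ z, r.roots.count z = u.roots.count z := by
    intro z
    have := mul_rootMultiplicity_eq_of_pois_eq_zero
      (mul_ne_zero (C_ne_zero.2 hc) (pow_ne_zero m hr))
      (mul_ne_zero (C_ne_zero.2 hc) (pow_ne_zero m hu0)) e2 z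
    rw [← count_roots, ← count_roots, roots_C_mul _ hc, roots_C_mul _ hc, roots_pow, roots_pow,
      Multiset.count_nsmul, Multiset.count_nsmul] at this
    have hm' : (m : ℤ) * 1 * m ≠ 0 := by positivity
    have h5 : (m : ℤ) * 1 * m * r.roots.count z = (m : ℤ) * 1 * m * u.roots.count z := by
      push_cast at this
      linarith
    exact_mod_cast mul_left_cancel₀ hm' h5
  have e4 : r.roots = u.roots := Multiset.ext.2 e3
  have e5 : u = C (u.leadingCoeff / r.leadingCoeff) * r := by
    conv_lhs => rw [(IsAlgClosed.splits u).eq_prod_roots, ← e4]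
    conv_rhs => rw [(IsAlgClosed.splits r).eq_prod_roots]
    rw [← mul_assoc, ← C_mul, leadingCoeff_mul, leadingCoeff_C,
      (monic_multiset_prod_of_monic _ _ fun a _ => monic_X_sub_C a).leadingCoeff, mul_one,
      div_mul_cancel₀ _ (leadingCoeff_ne_zero.2 hr)]
  have e6 : u.coeff r.natDegree = ζ ^ κ * r.coeff r.natDegree := by
    rw [hu, comp_C_mul_X_coeff, mul_comm]
    congr 1
    rw [← zpow_natCast (ζ ^ β), ← zpow_mul, eq_comm, ← div_eq_one_iff_eq (zpow_ne_zero _ hz),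
      ← zpow_sub₀ hz, hζ.zpow_eq_one_iff_dvd]
    exact htop
  have e7 : u.leadingCoeff / r.leadingCoeff = ζ ^ κ := by
    have := congrArg (fun q => q.coeff r.natDegree) e5
    simp only [coeff_C_mul] at this
    rw [e6] at this
    exact (mul_right_cancel₀ (leadingCoeff_ne_zero.2 hr) this).symm
  rw [← e7]
  exact e5

/-- An edge ending at a vertex `(γ - 1 / l, γ)` which is not a monomial is a power of a linear form
of step one. -/
theorem single_root_of_pois {α β κ : ℤ} {γ : ℕ} (hα : 0 < α) (hβ : 0 < β) (hcop : IsCoprime α β)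
    (hγ : 2 ≤ γ) (hκ : κ = β * γ - α) {r f : K[X]} (hr : r.natDegree = γ) {c : K}
    (hc : c ≠ 0) (h : pois κ β r f = C c * r) (hcl : ExpClass α β κ r)
    (hfcl : ExpClass α β β f) (hmono : ∃ j < γ, r.coeff j ≠ 0) :
    α = 1 ∧ ∃ a, r = C r.leadingCoeff * (X - C a) ^ γ := by
  have hr0 : r ≠ 0 := by rintro rfl; simp at hr; omega
  have hexp : ∀ j : ℕ, r.coeff j ≠ 0 → α ∣ γ - j := by
    intro j hj
    have h1 := hcl j hj
    rw [hκ, show β * (γ : ℤ) - α - β * j = β * (γ - j) - α * 1 by ring,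
      dvd_sub_left (Dvd.intro _ rfl)] at h1
    exact hcop.dvd_of_dvd_mul_left h1
  obtain ⟨hf0, hdeg⟩ := natDegree_of_pois hβ hc (by omega) h
  obtain ⟨j₀, hj₀, hj₀'⟩ := hmono
  rcases hdeg with hdeg | ⟨hdeg2, hdeg⟩
  -- Linear `f`: `r` is a power of `X - a`, and `a ≠ 0` since `r` is not a monomial. The exponent `γ
  -- - 1` then occurs and forces `α ∣ 1`.
  · obtain ⟨a, -, ha⟩ := exists_eq_pow_of_natDegree_eq_one hβ hr0 h hdeg
    rw [hr] at ha
    refine ⟨?_, a, ha⟩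
    have hlc := leadingCoeff_ne_zero.2 hr0
    have ha0 : a ≠ 0 := by
      rintro rfl
      rw [ha] at hj₀'
      simp only [map_zero, sub_zero, coeff_C_mul, coeff_X_pow] at hj₀'
      rw [if_neg (by omega)] at hj₀'
      simp at hj₀'
    have h1 : r.coeff (γ - 1) ≠ 0 := by
      rw [ha, coeff_C_mul, sub_eq_add_neg, ← C_neg, coeff_X_add_C_pow,
        show γ - (γ - 1) = 1 by omega, pow_one]
      refine mul_ne_zero hlc (mul_ne_zero (neg_ne_zero.2 ha0) ?_)
      exact_mod_cast (Nat.choose_pos (by omega)).ne'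
    have h2 := hexp _ h1
    rw [show ((γ : ℤ) - (γ - 1 : ℕ)) = 1 by omega] at h2
    have := Int.le_of_dvd one_pos h2
    omega
  -- Otherwise `deg f = 1 - α e`, and `β γ = κ deg f` becomes `e (α - β γ) = 1`. Hence `e = -1`, `β
  -- γ = α + 1` and `κ = 1`, which leaves few cases.
  · have hlf := hfcl f.natDegree (leadingCoeff_ne_zero.2 hf0)
    rw [show β - β * (f.natDegree : ℤ) = β * (1 - f.natDegree) by ring] at hlf
    obtain ⟨e, he⟩ := hcop.dvd_of_dvd_mul_left hlf
    rw [hr] at hdeg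
    have hφ : (f.natDegree : ℤ) = 1 - α * e := by linarith
    have h1 : (2 : ℤ) ≤ f.natDegree := by exact_mod_cast hdeg2
    rw [hφ, hκ] at hdeg
    have h2 : 1 - α * e = -(β * γ * e) := by
      refine mul_left_cancel₀ hα.ne' ?_
      linear_combination hdeg
    have h3 : e * (α - β * γ) = 1 := by linarith
    have h4 : e < 0 := by nlinarith
    have h5 : e = -1 := by
      rcases Int.isUnit_iff.1 (IsUnit.of_mul_eq_one _ h3) with h | h <;> omega
    have h6 : β * γ = α + 1 := by rw [h5] at h3; linarith
    have hκ1 : κ = 1 := by rw [hκ, h6]; ring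
    have hγ' : (2 : ℤ) ≤ γ := by exact_mod_cast hγ
    rcases (show α = 1 ∨ 2 ≤ α by omega) with hα1 | hα2
    · refine ⟨hα1, ?_⟩
      have hβ1 : β = 1 := by nlinarith
      have hγ2 : γ = 2 := by
        rw [hα1, hβ1] at h6
        omega
      rw [hγ2] at hr ⊢
      refine eq_pow_of_two_le_rootMultiplicity hr fun z hz => ?_
      have hs : 0 < rootMultiplicity z r := (rootMultiplicity_pos hr0).2 hz
      -- With `β = κ = 1` a simple root would make the factor `β s - κ` vanish, contradicting `c ≠
      -- 0`.
      by_contra hlt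
      have hs1 : rootMultiplicity z r = 1 := by omega
      have := sub_mul_eval_derivative_of_pois hr0 h (eval_eq_zero_of_pois hβ hr0 h hz)
      rw [hs1, hβ1, hκ1] at this
      simp at this
      exact hc this.symm
    · exfalso
      rcases (show β = 1 ∨ 2 ≤ β by omega) with hβ1 | hβ2
      -- Here `γ = α + 1`, so the only exponent below `γ` is `1`. Then `0` is a simple root,
      -- excluded as before.
      · have hall : ∀ j : ℕ, j < γ → r.coeff j ≠ 0 → j = 1 := by
          intro j hj hj'
          obtain ⟨k, hk⟩ := hexp j hj'
          have hjγ : (j : ℤ) < γ := by exact_mod_cast hj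
          rw [hβ1] at h6
          have hk0 : 0 < k := by nlinarith
          have hk1 : k < 2 := by nlinarith
          have : k = 1 := by omega
          rw [this] at hk
          omega
        have hj1 := hall j₀ hj₀ hj₀'
        rw [hj1] at hj₀'
        have hc0 : r.coeff 0 = 0 := by
          by_contra h0
          have := hall 0 (by omega) h0
          omega
        have hz : r.eval 0 = 0 := by rw [← coeff_zero_eq_eval_zero, hc0]
        obtain ⟨u, hu⟩ := X_dvd_iff.2 hc0
        have hu0 : u.eval 0 ≠ 0 := by
          rw [← coeff_zero_eq_eval_zero]
          rw [hu, coeff_X_mul] at hj₀'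
          exact hj₀'
        have hs1 : rootMultiplicity 0 r = 1 := by
          rw [← rootMultiplicity_pow_mul hu0 1, hu]
          simp
        have := sub_mul_eval_derivative_of_pois hr0 h (eval_eq_zero_of_pois hβ hr0 h hz)
        rw [hs1, hβ1, hκ1] at this
        simp at this
        exact hc this.symm
      · have h7 := Int.le_of_dvd (by omega) (hexp j₀ hj₀')
        nlinarith

/-- If `f` is a combination of `E` and `E ^ (ρ + 1)`, then all nonzero roots of `r` have the same
multiplicity. -/
theorem exists_root_mul_rootMultiplicity {κ β : ℤ} (hβ : 0 < β) {ρ : ℕ} (hρ : 0 < ρ) {c : K}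
    (hc : c ≠ 0) {r : K[X]} {a b : K} (hr : r ≠ 0)
    (h : pois κ β r (C a * X + C b * X ^ (ρ + 1)) = C c * r)
    (hlt : rootMultiplicity 0 r < r.natDegree) :
    ∃ z, z ≠ 0 ∧ r.eval z = 0 ∧ rootMultiplicity 0 r + ρ * rootMultiplicity z r = r.natDegree := by
  classical
  set f : K[X] := C a * X + C b * X ^ (ρ + 1) with hf
  have hfe : ∀ y, f.eval y = y * (a + b * y ^ ρ) := by
    intro y
    simp only [hf, eval_add, eval_mul, eval_C, eval_X, eval_pow]
    ring
  have hfd : ∀ y, (derivative f).eval y = a + b * (ρ + 1) * y ^ ρ := by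
    intro y
    simp [hf]
    ring
  obtain ⟨z, hz, hz0⟩ : ∃ z ∈ r.roots, z ≠ 0 := by
    by_contra! hall
    have h1 := Multiset.eq_replicate_card.2 hall
    have h2 := congrArg (Multiset.count 0) h1
    rw [count_roots, Multiset.count_replicate_self,
      ← (IsAlgClosed.splits r).natDegree_eq_card_roots] at h2
    omega
  have hz' : r.eval z = 0 := isRoot_of_mem_roots hz
  refine ⟨z, hz0, hz', ?_⟩
  obtain ⟨ζ, hζ⟩ := exists_primitiveRoot K hρ
  have hfz := eval_eq_zero_of_pois hβ hr h hz'
  have hab : a + b * z ^ ρ = 0 := by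
    rw [hfe] at hfz
    exact (mul_eq_zero.1 hfz).resolve_left hz0
  have hsz := sub_mul_eval_derivative_of_pois hr h hfz
  have hb : b ≠ 0 := by
    rintro rfl
    have ha : a = 0 := by simpa using hab
    rw [hfd, ha] at hsz
    simp at hsz
    exact hc hsz.symm
  -- `f'(y)` depends only on `y ^ ρ`, and `(β s - κ) f'(y) = c ≠ 0` then determines the multiplicity
  -- `s`.
  have hsame : ∀ y, y ^ ρ = z ^ ρ → rootMultiplicity y r = rootMultiplicity z r := by
    intro y hy
    have hfy : f.eval y = 0 := by rw [hfe, hy, hab, mul_zero]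
    have hsy := sub_mul_eval_derivative_of_pois hr h hfy
    rw [hfd, hy, ← hfd] at hsy
    have hd0 : (derivative f).eval z ≠ 0 := by
      intro h0
      rw [h0, mul_zero] at hsz
      exact hc hsz.symm
    have := mul_right_cancel₀ hd0 (hsy.trans hsz.symm)
    have hβ' : (β : K) ≠ 0 := by exact_mod_cast hβ.ne'
    have h2 := mul_left_cancel₀ hβ' (sub_left_injective this)
    exact_mod_cast h2
  let S : Finset K := (Finset.range ρ).image fun i => ζ ^ i * z
  have hS : ∀ y, y ∈ S ↔ y ^ ρ = z ^ ρ := by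
    intro y
    simp only [S, Finset.mem_image, Finset.mem_range]
    constructor
    · rintro ⟨i, -, rfl⟩
      rw [mul_pow, ← pow_mul, mul_comm i, pow_mul, hζ.pow_eq_one, one_pow, one_mul]
    · intro hy
      have : NeZero ρ := ⟨hρ.ne'⟩
      obtain ⟨i, hi, he⟩ := hζ.eq_pow_of_pow_eq_one (ξ := y / z) (by
        rw [div_pow, hy, div_self (pow_ne_zero _ hz0)])
      exact ⟨i, hi, by rw [he, div_mul_cancel₀ _ hz0]⟩
  have hcard : S.card = ρ := by
    rw [Finset.card_image_of_injOn, Finset.card_range]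
    intro i hi j hj hij
    simp only [Finset.coe_range, Set.mem_Iio] at hi hj
    exact hζ.pow_inj hi hj (mul_right_cancel₀ hz0 hij)
  have h0S : (0 : K) ∉ S := by
    rw [hS, zero_pow hρ.ne']
    exact (pow_ne_zero _ hz0).symm
  -- A nonzero root of `r` annihilates `a + b y ^ ρ`, so it lies in the orbit of `z` under the
  -- `ρ`-th roots of unity.
  have hsub : r.roots.toFinset ⊆ insert 0 S := by
    intro y hy
    rw [Multiset.mem_toFinset] at hy
    have hfy := eval_eq_zero_of_pois hβ hr h (isRoot_of_mem_roots hy)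
    rw [hfe] at hfy
    rw [Finset.mem_insert, hS]
    rcases mul_eq_zero.1 hfy with h1 | h1
    · exact Or.inl h1
    · right
      refine mul_left_cancel₀ hb ?_
      linear_combination h1 - hab
  rw [(IsAlgClosed.splits r).natDegree_eq_card_roots,
    ← Multiset.sum_count_eq_card (s := insert 0 S) (fun y hy => hsub (Multiset.mem_toFinset.2 hy)),
    Finset.sum_insert h0S, count_roots]
  congr 1
  rw [Finset.sum_congr rfl fun y hy => (count_roots r).trans (hsame y ((hS y).1 hy)),
    Finset.sum_const, hcard, smul_eq_mul]

end

end

section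

variable {K : Type*} [Field K]

/-! ### Homomorphisms from the Weyl algebra -/

/-- The homomorphism `X ↦ x`, `Y ↦ y` for `y x = x y + 1`. -/
def weylLift {A : Type*} [Ring A] [Algebra K A] (x y : A) (h : y * x = x * y + 1) :
    WeylAlgebra K →ₐ[K] A :=
  RingQuot.liftAlgHom K ⟨FreeAlgebra.lift K ![x, y], by
    rintro _ _ ⟨⟩
    simpa using h⟩

@[simp]
theorem weylLift_genX {A : Type*} [Ring A] [Algebra K A] (x y : A) (h : y * x = x * y + 1) :
    weylLift (K := K) x y h genX = x := by
  simp [weylLift, genX]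

@[simp]
theorem weylLift_genY {A : Type*} [Ring A] [Algebra K A] (x y : A) (h : y * x = x * y + 1) :
    weylLift (K := K) x y h genY = y := by
  simp [weylLift, genY]

theorem weylHom_ext {A : Type*} [Ring A] [Algebra K A] {φ ψ : WeylAlgebra K →ₐ[K] A}
    (hX : φ genX = ψ genX) (hY : φ genY = ψ genY) : φ = ψ := by
  refine RingQuot.ringQuot_ext' K φ ψ (FreeAlgebra.hom_ext (funext fun i => ?_))
  fin_cases i
  · exact hX
  · exact hY

/-! ### Monomials -/

theorem symbol_injective : Function.Injective (symbol : WeylAlgebra K → _) := symbol_bijective.1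

theorem X_pow_mul_X_pow (e : Fin 2 →₀ ℕ) :
    (MvPolynomial.X 0 ^ e 0 * MvPolynomial.X 1 ^ e 1 : MvPolynomial (Fin 2) K)
      = MvPolynomial.monomial e 1 := by
  rw [MvPolynomial.monomial_eq, Finsupp.prod_fintype _ _ (by simp)]
  simp

theorem weyl_eq_sum (z : WeylAlgebra K) :
    z = ∑ e ∈ (symbol z).support, (symbol z).coeff e • (genX ^ e 0 * genY ^ e 1) := by
  apply symbol_injective
  rw [map_sum]
  simp only [map_smul, symbol_monomial, X_pow_mul_X_pow, MvPolynomial.smul_monomial, smul_eq_mul,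
    mul_one]
  exact (symbol z).as_sum

theorem weyl_induction {motive : WeylAlgebra K → Prop}
    (hm : ∀ i j : ℕ, motive (genX ^ i * genY ^ j)) (h0 : motive 0)
    (hadd : ∀ x y, motive x → motive y → motive (x + y))
    (hsmul : ∀ (c : K) x, motive x → motive (c • x)) (z : WeylAlgebra K) : motive z := by
  rw [weyl_eq_sum z]
  exact Finset.sum_induction _ motive hadd h0 fun e _ => hsmul _ _ (hm _ _)

theorem genY_pow_mul_genX (j : ℕ) :
    (genY ^ j * genX : WeylAlgebra K) = genX * genY ^ j + (j : K) • genY ^ (j - 1) := by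
  induction j with
  | zero => simp
  | succ j ih =>
    rw [pow_succ', mul_assoc, ih, mul_add, ← mul_assoc, genY_mul_genX, add_mul, mul_assoc,
      ← pow_succ', one_mul, mul_smul_comm]
    rcases j with _ | j
    · simp
    · simp only [Nat.add_sub_cancel, ← pow_succ']
      push_cast
      module

theorem symbol_genX_mul (z : WeylAlgebra K) : symbol (genX * z) = MvPolynomial.X 0 * symbol z := by
  simp [symbol, regularRep_genX]

theorem symbol_genY_mul (z : WeylAlgebra K) :
    symbol (genY * z) = MvPolynomial.X 1 * symbol z + MvPolynomial.pderiv 0 (symbol z) := by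
  simp [symbol, regularRep_genY]

theorem symbol_mul_genY (z : WeylAlgebra K) : symbol (z * genY) = MvPolynomial.X 1 * symbol z := by
  refine weyl_induction (motive := fun z => symbol (z * genY) = MvPolynomial.X 1 * symbol z)
    (fun i j => ?_) (by simp) (fun x y hx hy => by rw [add_mul, map_add, map_add, mul_add, hx, hy])
    (fun c x hx => by rw [smul_mul_assoc, map_smul, map_smul, mul_smul_comm, hx]) z
  rw [mul_assoc, ← pow_succ, symbol_monomial, symbol_monomial]
  ring

theorem symbol_mul_genX (z : WeylAlgebra K) :
    symbol (z * genX) = MvPolynomial.X 0 * symbol z + MvPolynomial.pderiv 1 (symbol z) := by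
  refine weyl_induction (motive := fun z => symbol (z * genX) = MvPolynomial.X 0 * symbol z
      + MvPolynomial.pderiv 1 (symbol z)) (fun i j => ?_) (by simp)
    (fun x y hx hy => by rw [add_mul, map_add, map_add, map_add, mul_add, hx, hy]; abel)
    (fun c x hx => by
      rw [smul_mul_assoc, map_smul, map_smul, mul_smul_comm, hx, Derivation.map_smul, smul_add]) z
  rw [mul_assoc, genY_pow_mul_genX, mul_add, mul_smul_comm, ← mul_assoc, ← pow_succ, map_add,
    map_smul, symbol_monomial, symbol_monomial, symbol_monomial]
  simp [Derivation.leibniz_pow, MvPolynomial.pderiv_X, MvPolynomial.smul_eq_C_mul]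
  ring

theorem symbol_algebraMap (c : K) :
    symbol (algebraMap K (WeylAlgebra K) c) = MvPolynomial.C c := by
  have h : (1 : WeylAlgebra K) = genX ^ 0 * genY ^ 0 := by simp
  rw [Algebra.algebraMap_eq_smul_one, map_smul, h, symbol_monomial]
  simp [MvPolynomial.smul_eq_C_mul]

/-! ### Inner derivations and simplicity of the Weyl algebra -/

theorem exists_iterate_pderiv_eq_zero (i : Fin 2) (s : MvPolynomial (Fin 2) K) :
    ∃ k, (MvPolynomial.pderiv i)^[k] s = 0 := by
  induction s using MvPolynomial.induction_on' with
  | monomial e a =>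
    obtain ⟨n, hn⟩ : ∃ n, e i = n := ⟨_, rfl⟩
    induction n generalizing e a with
    | zero => exact ⟨1, by simp [MvPolynomial.pderiv_monomial, hn]⟩
    | succ n ih =>
      obtain ⟨k, hk⟩ := ih (e - Finsupp.single i 1) (a * e i) (by simp [hn])
      exact ⟨k + 1, by rw [Function.iterate_succ_apply, MvPolynomial.pderiv_monomial, hk]⟩
  | add p q hp hq =>
    obtain ⟨k, hk⟩ := hp
    obtain ⟨l, hl⟩ := hq
    refine ⟨k + l, ?_⟩
    rw [iterate_map_add, add_comm k l, Function.iterate_add_apply, hk, add_comm l k,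
      Function.iterate_add_apply, hl, iterate_map_zero, iterate_map_zero, add_zero]

/-- The inner derivation `z ↦ [X, z]`. -/
def adX (z : WeylAlgebra K) : WeylAlgebra K := genX * z - z * genX

/-- The inner derivation `z ↦ [Y, z]`. -/
def adY (z : WeylAlgebra K) : WeylAlgebra K := genY * z - z * genY

theorem symbol_adX (z : WeylAlgebra K) : symbol (adX z) = -MvPolynomial.pderiv 1 (symbol z) := by
  rw [adX, map_sub, symbol_genX_mul, symbol_mul_genX]
  ring

theorem symbol_adY (z : WeylAlgebra K) : symbol (adY z) = MvPolynomial.pderiv 0 (symbol z) := by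
  rw [adY, map_sub, symbol_genY_mul, symbol_mul_genY]
  ring

theorem exists_iterate_adX_eq_zero (z : WeylAlgebra K) : ∃ k, adX^[k] z = 0 := by
  obtain ⟨k, hk⟩ := exists_iterate_pderiv_eq_zero 1 (symbol z)
  refine ⟨k, ?_⟩
  have key : ∀ (k : ℕ) (z : WeylAlgebra K), (MvPolynomial.pderiv 1)^[k] (symbol z) = 0 → adX^[k] z = 0 := by
    intro k
    induction k with
    | zero =>
      intro z hz
      exact symbol_injective (hz.trans (map_zero _).symm)
    | succ k ih =>
      intro z hz
      rw [Function.iterate_succ_apply] at hz ⊢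
      apply ih
      rw [symbol_adX, iterate_map_neg, hz, neg_zero]
  exact key k z hk

theorem exists_iterate_adY_eq_zero (z : WeylAlgebra K) : ∃ k, adY^[k] z = 0 := by
  obtain ⟨k, hk⟩ := exists_iterate_pderiv_eq_zero 0 (symbol z)
  refine ⟨k, ?_⟩
  have key : ∀ (k : ℕ) (z : WeylAlgebra K), (MvPolynomial.pderiv 0)^[k] (symbol z) = 0 → adY^[k] z = 0 := by
    intro k
    induction k with
    | zero =>
      intro z hz
      exact symbol_injective (hz.trans (map_zero _).symm)
    | succ k ih =>
      intro z hz
      rw [Function.iterate_succ_apply] at hz ⊢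
      apply ih
      rw [symbol_adY, hz]
  exact key k z hk

theorem eq_algebraMap_of_ad_eq_zero [CharZero K] {z : WeylAlgebra K} (hX : adX z = 0)
    (hY : adY z = 0) : ∃ c, z = algebraMap K (WeylAlgebra K) c := by
  have h0 : ∀ i : Fin 2, MvPolynomial.pderiv i (symbol z) = 0 := by
    intro i
    fin_cases i
    · have := symbol_adY z
      rw [hY, map_zero] at this
      exact this.symm
    · have := symbol_adX z
      rw [hX, map_zero, eq_comm, neg_eq_zero] at this
      exact this
  refine ⟨(symbol z).coeff 0, symbol_injective ?_⟩
  rw [symbol_algebraMap]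
  ext e
  rw [MvPolynomial.coeff_C]
  split_ifs with he
  · rw [he]
  · obtain ⟨i, hi⟩ : ∃ i, e i ≠ 0 := by
      by_contra! h
      exact he (Finsupp.ext h).symm
    have h1 := congrArg (MvPolynomial.coeff (e - Finsupp.single i 1)) (h0 i)
    rw [MvPolynomial.coeff_pderiv, MvPolynomial.coeff_zero,
      tsub_add_cancel_of_le (by simpa using Nat.one_le_iff_ne_zero.2 hi)] at h1
    refine (mul_eq_zero.1 h1).resolve_right ?_
    exact Nat.cast_add_one_ne_zero _

/-- The Weyl algebra is simple. -/
theorem weylHom_injective [CharZero K] {A : Type*} [Ring A] [Nontrivial A] [Algebra K A]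
    (φ : WeylAlgebra K →ₐ[K] A) : Function.Injective φ := by
  -- The kernel is stable under `adX` and `adY`, both locally nilpotent. Descending on the number of
  -- iterations leaves an element killed by both, which is a constant and hence zero if it lies in
  -- the kernel.
  have step1 : ∀ k z, φ z = 0 → adX z = 0 → adY^[k] z = 0 → z = 0 := by
    intro k
    induction k with
    | zero => exact fun z _ _ h => h
    | succ k ih =>
      intro z hz hX hk
      -- The two derivations commute because `[Y, X]` is central.
      have hXY : adX (adY z) = 0 := by
        have h1 : (genX * z : WeylAlgebra K) = z * genX := sub_eq_zero.1 hX
        have h2 := genY_mul_genX (K := K)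
        have h3 : adX (adY z) = genX * genY * z - (genX * z) * genY - genY * (z * genX)
            + z * (genY * genX) := by
          simp only [adX, adY, mul_sub, sub_mul, mul_assoc]
          abel
        rw [h3, ← h1, h2, ← mul_assoc genY, h2, h1]
        simp only [add_mul, mul_add, mul_one, one_mul, mul_assoc]
        abel
      have hY : adY z = 0 := ih (adY z) (by simp [adY, hz]) hXY hk
      obtain ⟨c, rfl⟩ := eq_algebraMap_of_ad_eq_zero hX hY
      rw [AlgHom.commutes] at hz
      rw [(map_eq_zero_iff _ (algebraMap K A).injective).1 hz, map_zero]
  have step2 : ∀ k z, φ z = 0 → adX^[k] z = 0 → z = 0 := by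
    intro k
    induction k with
    | zero => exact fun z _ h => h
    | succ k ih =>
      intro z hz hk
      have hX : adX z = 0 := ih (adX z) (by simp [adX, hz]) hk
      obtain ⟨l, hl⟩ := exists_iterate_adY_eq_zero z
      exact step1 l z hz hX hl
  rw [injective_iff_map_eq_zero]
  intro z hz
  obtain ⟨k, hk⟩ := exists_iterate_adX_eq_zero z
  exact step2 k z hz hk

instance : Nontrivial (SkewLaurent K) := inferInstance

open Polynomial

/-! ### Existence of the fixing element -/

section

variable [CharZero K] {α β N : ℤ}

/-- If all these brackets vanished, the degree of a symbol would be determined by its weight, so a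
symbol would be detected by one coefficient per weight. The subalgebra generated by `P` and `Q` is
too large for that. -/
theorem exists_pois_ne_zero (φ : WeylAlgebra K →ₐ[K] SkewLaurent K) (hα : 0 < α) (hβ : 0 < β)
    (hN : 0 < N) (hP : φ genX ∈ fil α β N) (hp : 0 < (sym α β N (φ genX)).natDegree) :
    ∃ z D, φ z ∈ fil α β D ∧ pois N D (sym α β N (φ genX)) (sym α β D (φ z)) ≠ 0 := by
  by_contra! hcon
  set p := sym α β N (φ genX) with hpdef
  have hp0 : p ≠ 0 := by intro h; rw [h] at hp; simp at hp
  obtain ⟨M₀, hM₀⟩ := exists_mem_fil (α := α) (β := β) (φ genY)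
  obtain ⟨M, hMpos, hM⟩ : ∃ M, 0 ≤ M ∧ φ genY ∈ fil α β M :=
    ⟨max M₀ 0, le_max_right _ _, fil_mono (le_max_left _ _) hM₀⟩
  -- There are `(S + 1)^2` monomials `P^i Q^j` with `i, j ≤ S`, of weight at most `S (N + M) = S^2`,
  -- but only `S^2 + 1` weights `0, ..., S^2`. Some nonzero combination is missed by all the
  -- coefficient functionals, although its leading coefficient is one of them.
  obtain ⟨S, hS⟩ : ∃ S : ℕ, (S : ℤ) = N + M := ⟨(N + M).toNat, by omega⟩
  have hS0 : 0 < S := by omega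
  let W : (Fin (S + 1) × Fin (S + 1) → K) →ₗ[K] WeylAlgebra K :=
    Fintype.linearCombination K fun x => genX ^ (x.1 : ℕ) * genY ^ (x.2 : ℕ)
  let Λ : (Fin (S + 1) × Fin (S + 1) → K) →ₗ[K] (Fin (S * S + 1) → K) :=
    LinearMap.pi fun D => Polynomial.lcoeff K ((D : ℕ) * p.natDegree / N.toNat) ∘ₗ
      sym α β ((D : ℕ) : ℤ) ∘ₗ φ.toLinearMap ∘ₗ W
  obtain ⟨c, hcker, hc0⟩ := Submodule.exists_mem_ne_zero_of_ne_bot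
    (LinearMap.ker_ne_bot_of_finrank_lt (f := Λ) (by
      simp only [Module.finrank_fintype_fun_eq_card, Fintype.card_prod, Fintype.card_fin]
      nlinarith))
  have hWc : W c = ∑ x, c x • (genX ^ (x.1 : ℕ) * genY ^ (x.2 : ℕ)) :=
    Fintype.linearCombination_apply _ _ _
  have hW0 : W c ≠ 0 := by
    intro h0
    apply hc0
    funext x
    have h1 : ∑ y : Fin (S + 1) × Fin (S + 1), c y • MvPolynomial.monomial
        (Finsupp.single (0 : Fin 2) (y.1 : ℕ) + Finsupp.single 1 (y.2 : ℕ)) (1 : K) = 0 := by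
      rw [← map_zero (symbol : WeylAlgebra K →ₗ[K] _), ← h0, hWc, map_sum]
      refine Finset.sum_congr rfl fun y _ => ?_
      rw [map_smul, symbol_monomial, ← X_pow_mul_X_pow]
      simp
    have h2 := congrArg (MvPolynomial.coeff
      (Finsupp.single (0 : Fin 2) (x.1 : ℕ) + Finsupp.single 1 (x.2 : ℕ))) h1
    rw [MvPolynomial.coeff_sum, Finset.sum_eq_single x] at h2
    · simpa using h2
    · intro y _ hyx
      rw [MvPolynomial.coeff_smul, MvPolynomial.coeff_monomial, if_neg, smul_zero]
      intro he
      apply hyx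
      have e0 := DFunLike.congr_fun he 0
      have e1 := DFunLike.congr_fun he 1
      simp at e0 e1
      exact Prod.ext (Fin.ext e0) (Fin.ext e1)
    · intro h
      exact absurd (Finset.mem_univ x) h
  have hG0 : φ (W c) ≠ 0 := fun h => hW0 (weylHom_injective φ (h.trans (map_zero φ).symm))
  have hGfil : φ (W c) ∈ fil α β (S * S) := by
    rw [hWc, map_sum]
    refine Submodule.sum_mem _ fun x _ => ?_
    rw [map_smul, map_mul, map_pow, map_pow]
    refine Submodule.smul_mem _ _ (fil_mono ?_ (fil_mul hβ (fil_pow hβ hP x.1).1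
      (fil_pow hβ hM x.2).1).1)
    have h1 : ((x.1 : ℕ) : ℤ) ≤ S := by have := x.1.2; omega
    have h2 : ((x.2 : ℕ) : ℤ) ≤ S := by have := x.2.2; omega
    nlinarith
  obtain ⟨D, hD, hg0⟩ := exists_sym_ne_zero hα.ne' hG0
  set g := sym α β D (φ (W c)) with hg
  have hdeg := mul_natDegree_eq_of_pois_eq_zero hp0 hg0 (hcon (W c) D hD)
  have hD0 : 0 ≤ D := by
    have h1 : 0 ≤ D * (p.natDegree : ℤ) := by rw [hdeg]; positivity
    exact nonneg_of_mul_nonneg_left h1 (by exact_mod_cast hp)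
  have hDS : D ≤ S * S := by
    by_contra! hlt
    exact hg0 (sym_eq_zero_of_mem_fil hlt hGfil)
  have hDT : D.toNat < S * S + 1 := by
    have : (D.toNat : ℤ) < S * S + 1 := by omega
    exact_mod_cast this
  have h1 : Λ c ⟨D.toNat, hDT⟩ = g.coeff (D.toNat * p.natDegree / N.toNat) := by
    have : ((D.toNat : ℕ) : ℤ) = D := by omega
    simp only [Λ, LinearMap.pi_apply, LinearMap.comp_apply, this]
    rfl
  have h2 : D.toNat * p.natDegree / N.toNat = g.natDegree := by
    have : D.toNat * p.natDegree = N.toNat * g.natDegree := by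
      zify
      rw [Int.toNat_of_nonneg hD0, Int.toNat_of_nonneg hN.le]
      exact hdeg
    rw [this, Nat.mul_div_cancel_left _ (by omega)]
  rw [h2, LinearMap.mem_ker.1 hcker] at h1
  exact hg0 (leadingCoeff_eq_zero.1 h1.symm)

/-- For an element `P` whose `X`-partner generates a copy of the Weyl algebra with it there is a
homogeneous `f` of weight `β` with `[p, f]` proportional to the leading form `p` of `P`. -/
theorem exists_fixing [IsAlgClosed K] (φ : WeylAlgebra K →ₐ[K] SkewLaurent K) (hα : 0 < α)
    (hβ : 0 < β) (hN : 0 < N) (hP : φ genX ∈ fil α β N)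
    (hp : 0 < (sym α β N (φ genX)).natDegree) :
    ∃ f, pois N β (sym α β N (φ genX)) f = C (α : K) * sym α β N (φ genX) ∧
      ExpClass α β β f := by
  have hp0 : sym α β N (φ genX) ≠ 0 := by intro h; rw [h] at hp; simp at hp
  have hαK : (α : K) ≠ 0 := by exact_mod_cast hα.ne'
  have hcomm : ∀ z D, φ z ∈ fil α β D → φ (adX z) ∈ fil α β (N + D - β) ∧
      (α : K) • sym α β (N + D - β) (φ (adX z))
        = pois N D (sym α β N (φ genX)) (sym α β D (φ z)) := by
    intro z D hz
    have := fil_comm hβ hP hz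
    rwa [← map_mul, ← map_mul, ← map_sub] at this
  -- Apply `[P, ·]` as long as the symbol still has nonzero bracket with `p`. Local nilpotence stops
  -- the process, and the last stage provides `g` and `h = [p, g] / α` with `[p, h] = 0`.
  have key : ∀ k z D, adX^[k] z = 0 → φ z ∈ fil α β D →
      pois N D (sym α β N (φ genX)) (sym α β D (φ z)) ≠ 0 →
      ∃ z D, φ z ∈ fil α β D ∧ pois N D (sym α β N (φ genX)) (sym α β D (φ z)) ≠ 0 ∧
        pois N (N + D - β) (sym α β N (φ genX)) (sym α β (N + D - β) (φ (adX z))) = 0 := by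
    intro k
    induction k with
    | zero =>
      intro z D hk _ hne
      rw [Function.iterate_zero, id] at hk
      rw [hk] at hne
      simp [pois] at hne
    | succ k ih =>
      intro z D hk hz hne
      by_cases h0 : pois N (N + D - β) (sym α β N (φ genX)) (sym α β (N + D - β) (φ (adX z))) = 0
      · exact ⟨z, D, hz, hne, h0⟩
      · exact ih (adX z) _ hk (hcomm z D hz).1 h0
  obtain ⟨z₀, D₀, hz₀, hne₀⟩ := exists_pois_ne_zero φ hα hβ hN hP hp
  obtain ⟨k, hk⟩ := exists_iterate_adX_eq_zero z₀
  obtain ⟨z, D, hz, hne, h0⟩ := key k z₀ D₀ hk hz₀ hne₀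
  have h1 := (hcomm z D hz).2
  rw [smul_eq_C_mul] at h1
  have hh : sym α β (N + D - β) (φ (adX z)) ≠ 0 := by
    intro h
    rw [h, mul_zero] at h1
    exact hne h1.symm
  obtain ⟨f, hf, hfp⟩ := exists_quotient_of_pois hN hβ (D := D) (D' := N + D - β) (by ring) hp0
    hαK h1.symm hh h0
  refine ⟨f, hfp, ?_⟩
  have hcl := ExpClass.of_mul (M := D + N) hα hh (expClass_sym α β _ _) (by
    rw [hf]
    exact (expClass_sym α β D _).mul hα (expClass_sym α β N _))
  rwa [show D + N - (N + D - β) = β by ring] at hcl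

end

end

section

open Polynomial

variable {K : Type*} [Field K]

/-! ### Edges of Newton polygons -/

theorem finite_coef_ne_zero (b : SkewLaurent K) : {x : ℤ × ℕ | coef x.1 x.2 b ≠ 0}.Finite := by
  obtain ⟨s, hs⟩ := eq_sum_coef b
  refine s.finite_toSet.subset fun x hx => ?_
  by_contra hxs
  apply hx
  rw [hs, map_sum]
  refine Finset.sum_eq_zero fun y hy => ?_
  rw [map_smul, coef_mono, if_neg, smul_zero]
  rintro ⟨h1, h2⟩
  have hyx : y = x := Prod.ext h1 h2
  exact hxs (hyx ▸ hy)

theorem nonneg_of_one_mem_fil {α β N : ℤ} (h : (1 : SkewLaurent K) ∈ fil α β N) : 0 ≤ N := by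
  have h1 : (1 : SkewLaurent K) = mono 0 0 := by rw [mono, pow_zero, polyMul_one]
  have := mem_fil_iff.1 h 0 0 (by rw [h1, coef_mono]; simp)
  simpa using this

/-- `(a, b)` is the lower end of the edge of `P` of weight direction `(α, β)`. -/
structure IsVertex (α β a : ℤ) (b : ℕ) (P : SkewLaurent K) : Prop where
  ne_zero : coef a b P ≠ 0
  lt_or : ∀ (i : ℤ) (j : ℕ), coef i j P ≠ 0 →
    α * i + β * j < α * a + β * b ∨ α * i + β * j = α * a + β * b ∧ b ≤ j

theorem isVertex_of_sym {α β a N : ℤ} {b : ℕ} {P : SkewLaurent K} (hα : α ≠ 0)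
    (hP : P ∈ fil α β N) (hN : α * a + β * b = N) (h0 : (sym α β N P).coeff b ≠ 0)
    (hlt : ∀ j < b, (sym α β N P).coeff j = 0) : IsVertex α β a b P := by
  refine ⟨by rwa [← coeff_sym hα N P b a hN], fun i j hij => ?_⟩
  rcases (mem_fil_iff.1 hP i j hij).lt_or_eq with h | h
  · exact Or.inl (by omega)
  · refine Or.inr ⟨by omega, ?_⟩
    by_contra! hj
    exact hij (by rw [← coeff_sym hα N P j i h]; exact hlt j hj)

section

variable {α₀ β₀ a₀ : ℤ} {b₀ m n : ℕ} {P Q : SkewLaurent K}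

/-- The finite set of `(i - a, b - j)` for the support points `(i, j)` with `j < b`. -/
theorem exists_finset_below (a : ℤ) (b : ℕ) (P : SkewLaurent K) :
    ∃ T : Finset (ℤ × ℤ), ∀ y : ℤ × ℤ, y ∈ T ↔
      0 < y.2 ∧ ∃ j : ℕ, (j : ℤ) = b - y.2 ∧ coef (y.1 + a) j P ≠ 0 := by
  classical
  refine ⟨((finite_coef_ne_zero P).toFinset.filter fun x => x.2 < b).image
    fun x => (x.1 - a, (b : ℤ) - x.2), fun y => ?_⟩
  simp only [Finset.mem_image, Finset.mem_filter, Set.Finite.mem_toFinset, Set.mem_ofPred_eq]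
  constructor
  · rintro ⟨⟨i, j⟩, ⟨h1, h2⟩, rfl⟩
    refine ⟨by simp only; omega, j, by simp, by simpa using h1⟩
  · rintro ⟨h1, j, h2, h3⟩
    exact ⟨(y.1 + a, j), ⟨h3, by simp only; omega⟩, Prod.ext (by simp) (by simp only; omega)⟩

theorem IsVertex.le_of_le {a : ℤ} {b : ℕ} (hα₀ : 0 < α₀) (hβ₀ : 0 < β₀)
    (hP : IsVertex α₀ β₀ a b P) {i : ℤ} {j : ℕ} (h : coef i j P ≠ 0) (hj : b ≤ j) : i ≤ a := by
  have h1 : (b : ℤ) ≤ j := by exact_mod_cast hj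
  have h2 : α₀ * i + β₀ * j ≤ α₀ * a + β₀ * b := by
    rcases hP.lt_or i j h with h | h
    · exact h.le
    · exact h.1.le
  have : α₀ * i ≤ α₀ * a := by nlinarith
  exact le_of_mul_le_mul_left this hα₀

/-- The weight is turned about the vertex. Points with larger `j` become strictly lighter, those
with smaller `j` are bounded by `hT`, so the vertex becomes the upper end of the new edge. -/
theorem IsVertex.mem_fil {a : ℤ} {b : ℕ} (hα₀ : 0 < α₀)
    (hP : IsVertex α₀ β₀ a b P) {α β : ℤ} (hα : 0 < α) (hlt : β * α₀ < β₀ * α)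
    (hT : ∀ (i : ℤ) (j : ℕ), coef i j P ≠ 0 → j < b → α * (i - a) ≤ β * (b - j)) :
    P ∈ fil α β (α * a + β * b) ∧ (sym α β (α * a + β * b) P).natDegree = b := by
  have key : ∀ (i : ℤ) (j : ℕ), coef i j P ≠ 0 → b < j → α * i + β * j < α * a + β * b := by
    intro i j h hj
    have h1 : (b : ℤ) < j := by exact_mod_cast hj
    have h2 : α₀ * i + β₀ * j ≤ α₀ * a + β₀ * b := by
      rcases hP.lt_or i j h with h | h
      · exact h.le
      · exact h.1.le
    have h3 : α * (α₀ * (i - a)) ≤ α * (-(β₀ * (j - b))) :=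
      mul_le_mul_of_nonneg_left (by linarith) hα.le
    have h4 : (β * α₀) * (j - b) < (β₀ * α) * (j - b) :=
      mul_lt_mul_of_pos_right hlt (by linarith)
    have h5 : α₀ * (α * (i - a) + β * (j - b)) < α₀ * 0 := by nlinarith
    have := lt_of_mul_lt_mul_left h5 hα₀.le
    linarith
  refine ⟨mem_fil_iff.2 fun i j h => ?_, ?_⟩
  · rcases lt_trichotomy j b with hj | hj | hj
    · have := hT i j h hj
      linarith
    · subst hj
      have h1 : i ≤ a := by
        rcases hP.lt_or i j h with h | h
        · exact (le_of_mul_le_mul_left (by linarith) hα₀)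
        · exact (le_of_mul_le_mul_left (by linarith) hα₀)
      nlinarith
    · exact (key i j h hj).le
  · refine natDegree_eq_of_le_of_coeff_ne_zero ?_ ?_
    · rw [natDegree_le_iff_coeff_eq_zero]
      intro j hj
      by_contra h
      obtain ⟨i, hi⟩ := exists_of_coeff_sym_ne_zero h
      rw [coeff_sym hα.ne' _ P j i hi] at h
      exact absurd hi (key i j h hj).ne
    · rw [coeff_sym hα.ne' _ P b a rfl]
      exact hP.ne_zero

/-- The next edge, below a vertex in the half plane `a < 0`. -/
theorem exists_next_edge (hQP : Q * P - P * Q = 1) (hα₀ : 0 < α₀) (hβ₀ : 0 < β₀) (hm : 0 < m)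
    (hn : 0 < n) (ha₀ : a₀ < 0) (hP : IsVertex α₀ β₀ (m * a₀) (m * b₀) P)
    (hQ : IsVertex α₀ β₀ (n * a₀) (n * b₀) Q) :
    ∃ α β κ : ℤ, 0 < α ∧ 0 < β ∧ IsCoprime α β ∧ β * α₀ < β₀ * α ∧ κ = α * a₀ + β * b₀ ∧
      0 < κ ∧ β ≤ (m + n) * κ ∧
      P ∈ fil α β (m * κ) ∧ Q ∈ fil α β (n * κ) ∧ (sym α β (m * κ) P).natDegree = m * b₀ ∧
      (sym α β (n * κ) Q).natDegree = n * b₀ ∧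
      ((∃ j < m * b₀, (sym α β (m * κ) P).coeff j ≠ 0) ∨
        ∃ j < n * b₀, (sym α β (n * κ) Q).coeff j ≠ 0) := by
  classical
  obtain ⟨TP, hTP⟩ := exists_finset_below (m * a₀) (m * b₀) P
  obtain ⟨TQ, hTQ⟩ := exists_finset_below (n * a₀) (n * b₀) Q
  -- Otherwise the exponents of `w` in `P` and `Q` are at most `m a₀` and `n a₀`, both negative. For
  -- weights `(L, 1)` with `L` large the commutator would have negative weight, but it equals `1`.
  have hmem : ∃ y ∈ TP ∪ TQ, 0 < y.1 := by
    by_contra! hno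
    have hle : ∀ {l : ℕ} {R : SkewLaurent K} (T : Finset (ℤ × ℤ)), (∀ y ∈ T, y.1 ≤ 0) →
        (∀ y : ℤ × ℤ, y ∈ T ↔
          0 < y.2 ∧ ∃ j : ℕ, (j : ℤ) = (l * b₀ : ℕ) - y.2 ∧ coef (y.1 + l * a₀) j R ≠ 0) →
        IsVertex α₀ β₀ (l * a₀) (l * b₀) R →
        ∃ J : ℤ, ∀ L : ℤ, 0 ≤ L → R ∈ fil L 1 (L * (l * a₀) + J) := by
      intro l R T hT0 hT hR
      obtain ⟨J, hJ⟩ := ((finite_coef_ne_zero R).image fun x => (x.2 : ℤ)).bddAbove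
      refine ⟨J, fun L hL => mem_fil_iff.2 fun i j hij => ?_⟩
      have h1 : (j : ℤ) ≤ J := hJ ⟨(i, j), hij, rfl⟩
      have h2 : i ≤ l * a₀ := by
        rcases lt_or_ge j (l * b₀) with hj | hj
        · have := hT0 (i - l * a₀, (l * b₀ : ℕ) - j) ((hT _).2 ⟨by simp only; omega, j, by simp,
            by simpa using hij⟩)
          simp only at this
          linarith
        · exact hR.le_of_le hα₀ hβ₀ hij hj
      nlinarith
    obtain ⟨J, hJ⟩ := hle TP (fun y hy => hno y (Finset.mem_union_left _ hy)) hTP hP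
    obtain ⟨J', hJ'⟩ := hle TQ (fun y hy => hno y (Finset.mem_union_right _ hy)) hTQ hQ
    obtain ⟨L, hL0, hL⟩ : ∃ L : ℤ, 0 ≤ L ∧ J + J' < L := ⟨max 0 (J + J' + 1), by omega, by omega⟩
    have h1 := (fil_comm one_pos (hJ' L hL0) (hJ L hL0)).1
    rw [hQP] at h1
    have h2 := nonneg_of_one_mem_fil h1
    have h3 : (n : ℤ) * a₀ ≤ -1 := by
      have : (1 : ℤ) ≤ n := by exact_mod_cast hn
      nlinarith
    have h4 : (m : ℤ) * a₀ ≤ -1 := by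
      have : (1 : ℤ) ≤ m := by exact_mod_cast hm
      nlinarith
    nlinarith
  -- The next edge goes through a point maximizing `(i - a) / (b - j)`, taken over `P` and `Q`
  -- together. Numerator and denominator of the maximum are `β` and `α`.
  obtain ⟨y, hyT, hy⟩ := Finset.exists_max_image (TP ∪ TQ) (fun y => (y.1 : ℚ) / y.2)
    (by obtain ⟨y, hy, -⟩ := hmem; exact ⟨y, hy⟩)
  have hpos : ∀ y ∈ TP ∪ TQ, 0 < y.2 := by
    intro y hy
    rcases Finset.mem_union.1 hy with h | h
    · exact ((hTP y).1 h).1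
    · exact ((hTQ y).1 h).1
  set q : ℚ := (y.1 : ℚ) / y.2 with hq
  have hy2 := hpos y hyT
  have hy2q : (0 : ℚ) < y.2 := by exact_mod_cast hy2
  have hq0 : 0 < q := by
    obtain ⟨x, hx, hx1⟩ := hmem
    have hx2 := hpos x hx
    refine lt_of_lt_of_le ?_ (hy x hx)
    have h1 : (0 : ℚ) < x.1 := by exact_mod_cast hx1
    have h2 : (0 : ℚ) < x.2 := by exact_mod_cast hx2
    positivity
  have hden : (0 : ℚ) < q.den := by exact_mod_cast q.den_pos
  have hqnd : q = (q.num : ℚ) / q.den := (Rat.num_div_den q).symm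
  have hTle : ∀ x ∈ TP ∪ TQ, (q.den : ℤ) * x.1 ≤ q.num * x.2 := by
    intro x hx
    have h1 := hy x hx
    have h2 : (0 : ℚ) < x.2 := by exact_mod_cast hpos x hx
    rw [hqnd, div_le_div_iff₀ h2 hden] at h1
    have h3 : x.1 * (q.den : ℤ) ≤ q.num * x.2 := by exact_mod_cast h1
    linarith
  have hyeq : (q.den : ℤ) * y.1 = q.num * y.2 := by
    have h1 : (y.1 : ℚ) / y.2 = (q.num : ℚ) / q.den := by rw [← hqnd]
    rw [div_eq_div_iff hy2q.ne' hden.ne'] at h1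
    have h3 : y.1 * (q.den : ℤ) = q.num * y.2 := by exact_mod_cast h1
    linarith
  have hα : (0 : ℤ) < q.den := by exact_mod_cast q.den_pos
  have hβ : 0 < q.num := Rat.num_pos.2 hq0
  have hcop : IsCoprime (q.den : ℤ) q.num := by
    rw [Int.isCoprime_iff_gcd_eq_one, Int.gcd_comm]
    exact q.reduced
  have hstrict : ∀ {l : ℕ} {R : SkewLaurent K} (T : Finset (ℤ × ℤ)),
      (∀ y : ℤ × ℤ, y ∈ T ↔
        0 < y.2 ∧ ∃ j : ℕ, (j : ℤ) = (l * b₀ : ℕ) - y.2 ∧ coef (y.1 + l * a₀) j R ≠ 0) →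
      IsVertex α₀ β₀ (l * a₀) (l * b₀) R → y ∈ T →
      q.num * α₀ < β₀ * q.den ∧ ∃ j < l * b₀, ∀ N : ℤ, N = l * (q.den * a₀ + q.num * b₀) →
        (sym q.den q.num N R).coeff j ≠ 0 := by
    intro l R T hT hR hyT
    obtain ⟨h1, j, hj, hc⟩ := (hT y).1 hyT
    have hlt : α₀ * y.1 < β₀ * y.2 := by
      rcases hR.lt_or _ _ hc with h | h
      · rw [hj] at h
        linarith
      · exfalso
        omega
    refine ⟨?_, j, by omega, fun N hN => ?_⟩
    · have h2 : (q.num * α₀) * y.2 < (β₀ * q.den) * y.2 := by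
        have : α₀ * (q.den * y.1) < β₀ * y.2 * q.den := by nlinarith
        rw [hyeq] at this
        linarith
      exact lt_of_mul_lt_mul_right h2 h1.le
    · rw [coeff_sym hα.ne' N R j (y.1 + l * a₀)]
      · exact hc
      · rw [hj, hN]
        push_cast
        linarith
  have hlt : q.num * α₀ < β₀ * q.den := by
    rcases Finset.mem_union.1 hyT with h | h
    · exact (hstrict TP hTP hP h).1
    · exact (hstrict TQ hTQ hQ h).1
  have hfP := hP.mem_fil hα₀ hα hlt fun i j hij hj => by
    have := hTle (i - m * a₀, (m * b₀ : ℕ) - j) (Finset.mem_union_left _ ((hTP _).2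
      ⟨by simp only; omega, j, by simp, by simpa using hij⟩))
    exact this
  have hfQ := hQ.mem_fil hα₀ hα hlt fun i j hij hj => by
    have := hTle (i - n * a₀, (n * b₀ : ℕ) - j) (Finset.mem_union_right _ ((hTQ _).2
      ⟨by simp only; omega, j, by simp, by simpa using hij⟩))
    exact this
  have eP : (q.den : ℤ) * (m * a₀) + q.num * (m * b₀ : ℕ) = m * (q.den * a₀ + q.num * b₀) := by
    push_cast
    ring
  have eQ : (q.den : ℤ) * (n * a₀) + q.num * (n * b₀ : ℕ) = n * (q.den * a₀ + q.num * b₀) := by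
    push_cast
    ring
  rw [eP] at hfP
  rw [eQ] at hfQ
  -- The commutator `1` has weight `0`, while it lies in weight at most `(m + n) κ - β`.
  have hκ : q.num ≤ (m + n) * (q.den * a₀ + q.num * b₀) := by
    have h1 := (fil_comm hβ hfQ.1 hfP.1).1
    rw [hQP] at h1
    have h2 := nonneg_of_one_mem_fil h1
    linarith
  refine ⟨q.den, q.num, _, hα, hβ, hcop, hlt, rfl, ?_, hκ, hfP.1, hfQ.1, hfP.2, hfQ.2, ?_⟩
  · have h1 : (0 : ℤ) < (m + n) * (q.den * a₀ + q.num * b₀) := by omega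
    exact (pos_iff_pos_of_mul_pos h1).1 (by positivity)
  · rcases Finset.mem_union.1 hyT with h | h
    · obtain ⟨-, j, hj, hc⟩ := hstrict TP hTP hP h
      exact Or.inl ⟨j, hj, hc _ rfl⟩
    · obtain ⟨-, j, hj, hc⟩ := hstrict TQ hTQ hQ h
      exact Or.inr ⟨j, hj, hc _ rfl⟩

end

/-! ### Descent on pairs with a vertex next to the diagonal -/

theorem coeff_eq_zero_of_pow {b m : ℕ} {r : K[X]} {c : K} (h : ∀ j < b, r.coeff j = 0) :
    ∀ j < m * b, (C c * r ^ m).coeff j = 0 := by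
  rw [← X_pow_dvd_iff] at h ⊢
  rw [mul_comm m b, pow_mul]
  exact Dvd.dvd.mul_left (pow_dvd_pow_of_dvd h m) _

/-- The bracket is the component of weight `N + M - β > 0` of a multiple of the commutator, which is
a constant of weight `0`. -/
theorem pois_eq_zero_of_lt {α β N M : ℤ} {P Q : SkewLaurent K} (hβ : 0 < β)
    (hQP : Q * P - P * Q = 1) (hP : P ∈ fil α β N) (hQ : Q ∈ fil α β M) (h : β < N + M) :
    pois N M (sym α β N P) (sym α β M Q) = 0 := by
  rw [← (fil_comm hβ hP hQ).2, ← neg_sub (Q * P), hQP, map_neg,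
    sym_eq_zero_of_mem_fil (N := 0) (by omega) one_mem_fil]
  simp

/-- There is no pair with `[Q, P] = 1` whose `(1, k)`-edges end at the vertices `m (-1, γ)` and
`n (-1, γ)`. -/
theorem no_pair_with_vertex [CharZero K] [IsAlgClosed K] {m n γ : ℕ} (hm : 0 < m) (hn : 0 < n)
    (hmn : m.Coprime n) (hγ : 2 ≤ γ) (k : ℕ) (hk : 0 < k) (P Q : SkewLaurent K)
    (hQP : Q * P - P * Q = 1) (hP : IsVertex 1 k (m * (-1)) (m * γ) P)
    (hQ : IsVertex 1 k (n * (-1)) (n * γ) Q) : False := by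
  -- Infinite descent on `k`: the edge below the vertex is shown to have weights `(1, β)` with `β <
  -- k` and a single root, and shearing that root to `0` yields a pair of the same kind for `β`.
  induction k using Nat.strong_induction_on generalizing P Q with
  | _ k ih =>
  obtain ⟨α, β, κ, hα, hβ, hcop, hlt, hκ, hκ0, hle, hPf, hQf, hPd, hQd, hedge⟩ :=
    exists_next_edge hQP one_pos (by exact_mod_cast hk) hm hn (by norm_num) hP hQ
  have hp0 : sym α β (m * κ) P ≠ 0 := by
    intro h
    rw [h, natDegree_zero] at hPd
    have : 0 < m * γ := by positivity
    omega
  have hq0 : sym α β (n * κ) Q ≠ 0 := by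
    intro h
    rw [h, natDegree_zero] at hQd
    have : 0 < n * γ := by positivity
    omega
  have hmZ : (1 : ℤ) ≤ m := by exact_mod_cast hm
  have hnZ : (1 : ℤ) ≤ n := by exact_mod_cast hn
  have hγZ : (2 : ℤ) ≤ γ := by exact_mod_cast hγ
  -- In the boundary case `κ` divides both `β` and `α`, so `κ = 1` and `α = (m + n) γ - 1`.
  -- Exponents on an edge differ by multiples of `α`, which leaves no room for a second point on
  -- either edge.
  have hltβ : β < m * κ + n * κ := by
    by_contra! hge
    have hβe : β = (m + n) * κ := by linarith
    have hκ1 : κ = 1 := by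
      have h1 : IsUnit κ := hcop.isUnit_of_dvd' ⟨(m + n) * γ - 1, by
        have : α = β * γ - κ := by rw [hκ]; ring
        rw [this, hβe]; ring⟩ ⟨m + n, by rw [hβe]; ring⟩
      rcases Int.isUnit_iff.1 h1 with h | h <;> omega
    have hαe : α = (m + n) * γ - 1 := by
      rw [hκ1] at hκ hβe
      rw [hβe] at hκ
      linarith
    have hno : ∀ (l : ℕ) (R : SkewLaurent K), (l : ℤ) * γ < α →
        ¬ ∃ j < l * γ, (sym α β (l * κ) R).coeff j ≠ 0 := by
      rintro l R hl ⟨j, hj, hc⟩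
      have h1 := expClass_sym α β (l * κ) R j hc
      rw [hκ, show (l : ℤ) * (α * -1 + β * γ) - β * j = β * (l * γ - j) - α * l by ring,
        dvd_sub_left (Dvd.intro _ rfl)] at h1
      have hj' : (j : ℤ) < l * γ := by exact_mod_cast hj
      have := Int.le_of_dvd (by linarith) (hcop.dvd_of_dvd_mul_left h1)
      omega
    rcases hedge with h | h
    · exact hno m P (by nlinarith) h
    · exact hno n Q (by nlinarith) h
  have hpois := pois_eq_zero_of_lt hβ hQP hPf hQf hltβ
  obtain ⟨r, c, d, hr0, hc0, hd0, hpr, hqr⟩ :=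
    exists_root_of_pois_eq_zero hm hmn hκ0.ne' hp0 hq0 hpois
  have hrd : r.natDegree = γ := by
    rw [hpr, natDegree_C_mul hc0, natDegree_pow] at hPd
    exact Nat.eq_of_mul_eq_mul_left hm hPd
  have hmono : ∃ j < γ, r.coeff j ≠ 0 := by
    by_contra! hno
    rcases hedge with ⟨j, hj, hc⟩ | ⟨j, hj, hc⟩
    · rw [hpr] at hc
      exact hc (coeff_eq_zero_of_pow hno j hj)
    · rw [hqr] at hc
      exact hc (coeff_eq_zero_of_pow hno j hj)
  let φ : WeylAlgebra K →ₐ[K] SkewLaurent K := weylLift P Q (by rw [← sub_eq_iff_eq_add', hQP])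
  have hφ : φ genX = P := weylLift_genX _ _ _
  obtain ⟨f, hf, hfcl⟩ := exists_fixing φ hα hβ (N := m * κ) (by positivity) (by rwa [hφ])
    (by rw [hφ, hPd]; positivity)
  rw [hφ, hpr] at hf
  have hrf := pois_root hm hc0 hr0 hf
  have hαK : (α : K) / m ≠ 0 := div_ne_zero (by exact_mod_cast hα.ne') (by exact_mod_cast hm.ne')
  have hrcl : ExpClass α β κ r := by
    refine ExpClass.of_pow hα hm hc0 hr0 (by rw [← hpr]; exact expClass_sym _ _ _ _) ?_
    rw [hrd, hκ]
    exact ⟨-1, by ring⟩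
  obtain ⟨hα1, a, ha⟩ := single_root_of_pois hα hβ hcop hγ (by rw [hκ]; ring) hrd hαK hrf hrcl hfcl
    hmono
  subst hα1
  obtain ⟨k', hk'⟩ : ∃ k' : ℕ, (k' : ℤ) = β := ⟨β.toNat, by omega⟩
  have hlc := leadingCoeff_ne_zero.2 hr0
  -- The shear turns `r` into a multiple of `E ^ γ`, so both sheared edges collapse to the same
  -- vertices as before.
  have hcomp : r.comp (X + C a) = C r.leadingCoeff * X ^ γ := by
    conv_lhs => rw [ha]
    rw [mul_comp, C_comp, pow_comp, sub_comp, X_comp, C_comp, add_sub_cancel_right]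
  have hvert : ∀ (l : ℕ) (R : SkewLaurent K) (e : K), e ≠ 0 → R ∈ fil 1 β (l * κ) →
      sym 1 β (l * κ) R = C e * r ^ l →
      IsVertex 1 k' (l * (-1)) (l * γ) (shear β a R) := by
    intro l R e he hR hs
    have h1 := shear_mem_fil hβ a hR
    rw [hs, mul_comp, C_comp, pow_comp, hcomp, mul_pow, ← pow_mul, ← C_pow, ← mul_assoc,
      ← C_mul, mul_comm γ l] at h1
    rw [hk']
    refine isVertex_of_sym one_ne_zero h1.1 (by rw [hκ]; push_cast; ring) ?_ fun j hj => ?_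
    · rw [h1.2, coeff_C_mul, coeff_X_pow, if_pos rfl, mul_one]
      exact mul_ne_zero he (pow_ne_zero _ hlc)
    · rw [h1.2, coeff_C_mul, coeff_X_pow, if_neg hj.ne, mul_zero]
  refine ih k' (by zify; linarith) (by omega) (shear β a P) (shear β a Q) ?_
    (hvert m P c hc0 hPf hpr) (hvert n Q d hd0 hQf hqr)
  rw [← map_mul, ← map_mul, ← map_sub, hQP, map_one]

end

section

open Polynomial

variable {K : Type*} [Field K]

/-! ### Supports, degrees and leading terms -/

theorem mem_suppL {f : MvPolynomial (Fin 2) K} {p : ℤ × ℤ} :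
    p ∈ suppL f ↔ ∃ e, f.coeff e ≠ 0 ∧ expPoint e = p := by
  simp only [suppL, Finset.mem_image, MvPolynomial.mem_support_iff]

theorem expPoint_injective : Function.Injective expPoint := by
  intro e e' h
  simp only [expPoint, Prod.mk.injEq, Nat.cast_inj] at h
  ext i
  fin_cases i
  · exact h.1
  · exact h.2

theorem mem_supp_nonneg {P : WeylAlgebra K} {p : ℤ × ℤ} (h : p ∈ supp P) : 0 ≤ p.1 ∧ 0 ≤ p.2 := by
  obtain ⟨e, -, rfl⟩ := mem_suppL.1 h
  exact ⟨Int.natCast_nonneg _, Int.natCast_nonneg _⟩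

theorem supp_nonempty {P : WeylAlgebra K} (hP : P ≠ 0) : (supp P).Nonempty := by
  have : symbol P ≠ 0 := fun h => hP (symbol_injective (h.trans (map_zero _).symm))
  obtain ⟨e, he⟩ := MvPolynomial.ne_zero_iff.1 this
  exact ⟨_, mem_suppL.2 ⟨e, he, rfl⟩⟩

theorem deg_eq_coe_iff {d : ℤ × ℤ} {P : WeylAlgebra K} {N : ℤ} :
    deg d P = (N : WithBot ℤ) ↔ (∃ p ∈ supp P, pointDeg d p = N) ∧
      ∀ p ∈ supp P, pointDeg d p ≤ N := by
  have hd : deg d P = (supp P).sup fun p => ((pointDeg d p : ℤ) : WithBot ℤ) := rfl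
  constructor
  · intro h
    have hle : ∀ p ∈ supp P, pointDeg d p ≤ N := by
      intro p hp
      have := Finset.le_sup (f := fun p => ((pointDeg d p : ℤ) : WithBot ℤ)) hp
      rw [← hd, h] at this
      exact_mod_cast this
    refine ⟨?_, hle⟩
    have hne : (supp P).Nonempty := by
      by_contra h0
      rw [Finset.not_nonempty_iff_eq_empty] at h0
      rw [h0, Finset.sup_empty] at hd
      rw [hd] at h
      exact absurd h WithBot.bot_ne_coe
    obtain ⟨p, hp, he⟩ := Finset.exists_mem_eq_sup _ hne
      fun p => ((pointDeg d p : ℤ) : WithBot ℤ)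
    rw [← hd, h] at he
    exact ⟨p, hp, by exact_mod_cast he.symm⟩
  · rintro ⟨⟨p, hp, he⟩, hle⟩
    rw [hd]
    refine le_antisymm (Finset.sup_le fun q hq => by exact_mod_cast hle q hq) ?_
    rw [← he]
    exact Finset.le_sup (f := fun p => ((pointDeg d p : ℤ) : WithBot ℤ)) hp

theorem exists_deg_eq (d : ℤ × ℤ) {P : WeylAlgebra K} (hP : P ≠ 0) :
    ∃ N : ℤ, deg d P = (N : WithBot ℤ) := by
  obtain ⟨p, hp, hmax⟩ := Finset.exists_max_image (supp P) (fun p => (pointDeg d p : ℤ))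
    (supp_nonempty hP)
  exact ⟨pointDeg d p, deg_eq_coe_iff.2 ⟨⟨p, hp, rfl⟩, hmax⟩⟩

theorem deg_zero (d : ℤ × ℤ) : deg d (0 : WeylAlgebra K) = ⊥ := by
  simp [deg, degL, suppL]

theorem degInt_eq {d : ℤ × ℤ} {P : WeylAlgebra K} {N : ℤ} (h : deg d P = (N : WithBot ℤ)) :
    degInt d P = N := by
  rw [degInt, h]
  rfl

theorem coeff_leadL {d : ℤ × ℤ} {f : MvPolynomial (Fin 2) K} {N : ℤ}
    (h : degL d f = (N : WithBot ℤ)) (e : Fin 2 →₀ ℕ) :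
    (leadL d f).coeff e = if pointDeg d (expPoint e) = N then f.coeff e else 0 := by
  classical
  rw [leadL, MvPolynomial.coeff_sum]
  simp only [MvPolynomial.coeff_monomial, Finset.sum_ite_eq', Finset.mem_filter, h,
    WithBot.coe_inj, MvPolynomial.mem_support_iff]
  split_ifs with h1 h2 h2
  · rfl
  · exact absurd h1.2 h2
  · by_contra h3
    exact h1 ⟨fun h4 => h3 h4.symm, h2⟩
  · rfl

theorem mem_suppL_leadL {d : ℤ × ℤ} {f : MvPolynomial (Fin 2) K} {N : ℤ}
    (h : degL d f = (N : WithBot ℤ)) {p : ℤ × ℤ} :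
    p ∈ suppL (leadL d f) ↔ p ∈ suppL f ∧ pointDeg d p = N := by
  simp only [mem_suppL, coeff_leadL h]
  constructor
  · rintro ⟨e, he, rfl⟩
    split_ifs at he with h1
    · exact ⟨⟨e, he, rfl⟩, h1⟩
    · exact absurd rfl he
  · rintro ⟨⟨e, he, rfl⟩, h1⟩
    exact ⟨e, by rwa [if_pos h1], rfl⟩

theorem mem_suppL_lead {d : ℤ × ℤ} {P : WeylAlgebra K} {N : ℤ} (h : deg d P = (N : WithBot ℤ))
    {p : ℤ × ℤ} : p ∈ suppL (lead d P) ↔ p ∈ supp P ∧ pointDeg d p = N :=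
  mem_suppL_leadL h

theorem lead_ne_zero {d : ℤ × ℤ} {P : WeylAlgebra K} (hP : P ≠ 0) : lead d P ≠ 0 := by
  obtain ⟨N, hN⟩ := exists_deg_eq d hP
  obtain ⟨p, hp, he⟩ := (deg_eq_coe_iff.1 hN).1
  have := (mem_suppL_lead hN).2 ⟨hp, he⟩
  intro h0
  rw [h0] at this
  simp [suppL] at this

theorem degL_eq_coe {d : ℤ × ℤ} {f : MvPolynomial (Fin 2) K} {N : ℤ}
    (h : ∃ p ∈ suppL f, pointDeg d p = N) (hle : ∀ p ∈ suppL f, pointDeg d p ≤ N) :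
    degL d f = (N : WithBot ℤ) := by
  obtain ⟨p, hp, he⟩ := h
  refine le_antisymm (Finset.sup_le fun q hq => by exact_mod_cast hle q hq) ?_
  rw [← he]
  exact Finset.le_sup (f := fun p => ((pointDeg d p : ℤ) : WithBot ℤ)) hp

theorem wL_eq {f : MvPolynomial (Fin 2) K} {p : ℤ × ℤ} (hp : p ∈ suppL f)
    (h : ∀ q ∈ suppL f, q = p ∨ q.1 - q.2 < p.1 - p.2) : wL f = p := by
  have hdeg : degL (1, -1) f = ((p.1 - p.2 : ℤ) : WithBot ℤ) := by
    refine degL_eq_coe ⟨p, hp, by simp only [pointDeg, Int.cast_id]; ring⟩ fun q hq => ?_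
    rcases h q hq with rfl | h
    · simp only [pointDeg, Int.cast_id]
      linarith
    · simp only [pointDeg, Int.cast_id]
      linarith
  have hset : {i : ℤ | (i, i - (p.1 - p.2)) ∈ suppL (leadL (1, -1) f)} = {p.1} := by
    ext i
    simp only [Set.mem_ofPred_eq, Set.mem_singleton_iff]
    rw [mem_suppL_leadL hdeg]
    constructor
    · rintro ⟨h1, -⟩
      rcases h _ h1 with h2 | h2
      · exact congrArg Prod.fst h2
      · simp at h2
    · rintro rfl
      refine ⟨by simpa using hp, ?_⟩
      simp only [pointDeg, Int.cast_id]
      ring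
  simp only [wL, hdeg, WithBot.unbotD_coe, hset, csSup_singleton]
  simp

theorem wbarL_eq {f : MvPolynomial (Fin 2) K} {p : ℤ × ℤ} (hp : p ∈ suppL f)
    (h : ∀ q ∈ suppL f, q = p ∨ q.2 - q.1 < p.2 - p.1) : wbarL f = p := by
  have hdeg : degL (-1, 1) f = ((p.2 - p.1 : ℤ) : WithBot ℤ) := by
    refine degL_eq_coe ⟨p, hp, by simp only [pointDeg, Int.cast_id]; ring⟩ fun q hq => ?_
    rcases h q hq with rfl | h
    · simp only [pointDeg, Int.cast_id]
      linarith
    · simp only [pointDeg, Int.cast_id]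
      linarith
  have hset : {i : ℤ | (i - (p.2 - p.1), i) ∈ suppL (leadL (-1, 1) f)} = {p.2} := by
    ext i
    simp only [Set.mem_ofPred_eq, Set.mem_singleton_iff]
    rw [mem_suppL_leadL hdeg]
    constructor
    · rintro ⟨h1, -⟩
      rcases h _ h1 with h2 | h2
      · exact congrArg Prod.snd h2
      · simp at h2
    · rintro rfl
      refine ⟨by simpa using hp, ?_⟩
      simp only [pointDeg, Int.cast_id]
      ring
  simp only [wbarL, hdeg, WithBot.unbotD_coe, hset, csSup_singleton]
  simp

/-- The part of weight `N` of `P`, with `x` set to `1`. -/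
def edge (d : ℤ × ℤ) (N : ℤ) (P : WeylAlgebra K) : K[X] :=
  ∑ e ∈ (symbol P).support,
    if pointDeg d (expPoint e) = N then C ((symbol P).coeff e) * X ^ (e 1) else 0

theorem coeff_edge_ne_zero_iff {d : ℤ × ℤ} (hd : d.1 ≠ 0) {N : ℤ} {P : WeylAlgebra K} {j : ℕ} :
    (edge d N P).coeff j ≠ 0 ↔ ∃ i : ℤ, (i, (j : ℤ)) ∈ supp P ∧ pointDeg d (i, (j : ℤ)) = N := by
  have huniq : ∀ e e' : Fin 2 →₀ ℕ, pointDeg d (expPoint e) = N → pointDeg d (expPoint e') = N →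
      e 1 = e' 1 → e = e' := by
    intro e e' h h' h1
    apply expPoint_injective
    simp only [pointDeg, expPoint, Int.cast_id] at h h' ⊢
    rw [h1] at h ⊢
    have : d.1 * (e 0 : ℤ) = d.1 * e' 0 := by linarith
    rw [mul_left_cancel₀ hd this]
  constructor
  · intro h
    rw [edge, finsetSum_coeff] at h
    obtain ⟨e, he, hne⟩ := Finset.exists_ne_zero_of_sum_ne_zero h
    split_ifs at hne with h1
    · rw [coeff_C_mul, coeff_X_pow] at hne
      have h2 : j = e 1 := by
        by_contra h2
        rw [if_neg h2, mul_zero] at hne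
        exact hne rfl
      refine ⟨(e 0 : ℤ), mem_suppL.2 ⟨e, MvPolynomial.mem_support_iff.1 he, ?_⟩, ?_⟩
      · rw [h2]; rfl
      · rw [h2]; exact h1
    · simp at hne
  · rintro ⟨i, hi, hN⟩
    obtain ⟨e, he, hp⟩ := mem_suppL.1 hi
    have hj : e 1 = j := by
      have := congrArg Prod.snd hp
      simpa [expPoint] using this
    rw [← hp] at hN
    rw [edge, finsetSum_coeff, Finset.sum_eq_single e]
    · rw [if_pos hN, coeff_C_mul, coeff_X_pow, if_pos hj.symm, mul_one]
      exact he
    · intro e' _ hne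
      split_ifs with h1
      · rw [coeff_C_mul, coeff_X_pow, if_neg, mul_zero]
        intro h2
        exact hne (huniq _ _ h1 hN (by rw [hj, h2]))
      · simp
    · intro h
      exact absurd (MvPolynomial.mem_support_iff.2 he) h

/-! ### The embeddings of the Weyl algebra into the skew Laurent ring -/

section

variable [CharZero K]

variable (K) in
/-- The embedding `X ↦ w ^ l`, `Y ↦ l⁻¹ E w ^ (-l)`. -/
def emb (l : ℕ) (hl : 0 < l) : WeylAlgebra K →ₐ[K] SkewLaurent K :=
  weylLift (mono l 0) (((l : K)⁻¹) • mono (-l) 1) (by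
    have hl' : (l : K) ≠ 0 := by exact_mod_cast hl.ne'
    rw [smul_mul_assoc, mul_smul_comm, mono, mono, polyMul_mul, polyMul_mul, ← polyMul_one,
      ← map_smul, ← map_smul, neg_add_cancel, add_neg_cancel, ← map_add]
    congr 1
    simp only [pow_one, pow_zero, one_comp, mul_one, X_comp, one_mul, smul_sub, Int.cast_natCast,
      smul_eq_C_mul, ← C_mul, inv_mul_cancel₀ hl', C_1, sub_add_cancel])

/-- The image of `X^i Y^j` has leading term `l⁻ʲ E^j w^(l (i - j))`, of weight `α l (i - j) + β j =
ρ i + σ j`. The choice `l = ρ` permits `α = 1`, as needed for shears. -/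
theorem emb_mem_fil {l : ℕ} (hl : 0 < l) {α β : ℤ} (hβ : 0 < β) {d : ℤ × ℤ} (h1 : d.1 = α * l)
    (h2 : d.1 + d.2 = β) {N : ℤ} {P : WeylAlgebra K} (hP : ∀ p ∈ supp P, pointDeg d p ≤ N) :
    emb K l hl P ∈ fil α β N ∧
      sym α β N (emb K l hl P) = (edge d N P).comp (C (l : K)⁻¹ * X) := by
  have hX : emb K l hl genX = mono l 0 := weylLift_genX _ _ _
  have hY : emb K l hl genY = ((l : K)⁻¹) • mono (-l) 1 := weylLift_genY _ _ _
  have hmon : ∀ i j : ℕ, emb K l hl (genX ^ i * genY ^ j) ∈ fil α β (d.1 * i + d.2 * j) ∧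
      sym α β (d.1 * i + d.2 * j) (emb K l hl (genX ^ i * genY ^ j)) = (C (l : K)⁻¹ * X) ^ j := by
    intro i j
    have hXf : emb K l hl genX ∈ fil α β d.1 := by
      rw [hX]
      exact mono_mem_fil (by simp [h1])
    have hYf : emb K l hl genY ∈ fil α β d.2 := by
      rw [hY]
      refine Submodule.smul_mem _ _ (mono_mem_fil ?_)
      push_cast
      linarith
    have hXs : sym α β d.1 (emb K l hl genX) = 1 := by
      rw [hX, sym_mono, if_pos (by simp [h1]), pow_zero]
    have hYs : sym α β d.2 (emb K l hl genY) = C (l : K)⁻¹ * X := by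
      rw [hY, map_smul, sym_mono, if_pos (by push_cast; linarith), pow_one, smul_eq_C_mul]
    have h3 := fil_pow hβ hXf i
    have h4 := fil_pow hβ hYf j
    have h5 := fil_mul hβ h3.1 h4.1
    rw [h3.2, h4.2, hXs, hYs, one_pow, one_mul] at h5
    rw [map_mul, map_pow, map_pow, mul_comm d.1, mul_comm d.2]
    exact h5
  have hterm : ∀ e ∈ (symbol P).support,
      emb K l hl ((symbol P).coeff e • (genX ^ e 0 * genY ^ e 1)) ∈ fil α β N ∧
      sym α β N (emb K l hl ((symbol P).coeff e • (genX ^ e 0 * genY ^ e 1)))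
        = (if pointDeg d (expPoint e) = N then C ((symbol P).coeff e) * X ^ (e 1) else 0).comp
            (C (l : K)⁻¹ * X) := by
    intro e he
    have hle := hP (expPoint e) (mem_suppL.2 ⟨e, MvPolynomial.mem_support_iff.1 he, rfl⟩)
    have hpd : pointDeg d (expPoint e) = d.1 * (e 0 : ℤ) + d.2 * (e 1 : ℤ) := by
      simp [pointDeg, expPoint]
    rw [hpd] at hle ⊢
    rw [map_smul, map_smul]
    refine ⟨Submodule.smul_mem _ _ (fil_mono hle (hmon _ _).1), ?_⟩
    split_ifs with heq
    · rw [← heq, (hmon _ _).2, mul_comp, C_comp, X_pow_comp, smul_eq_C_mul]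
    · rw [sym_eq_zero_of_mem_fil (lt_of_le_of_ne hle heq) (hmon _ _).1, smul_zero, zero_comp]
  constructor
  · rw [congrArg (emb K l hl) (weyl_eq_sum P), map_sum]
    exact Submodule.sum_mem _ fun e he => (hterm e he).1
  · rw [congrArg (emb K l hl) (weyl_eq_sum P), map_sum, map_sum, edge, Polynomial.sum_comp]
    exact Finset.sum_congr rfl fun e he => (hterm e he).2

end

end

section

open Polynomial

variable {K : Type*} [Field K]

theorem rootMultiplicity_zero_eq {p : K[X]} (hp : p ≠ 0) :
    p.coeff (rootMultiplicity 0 p) ≠ 0 ∧ ∀ j < rootMultiplicity 0 p, p.coeff j = 0 := by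
  obtain ⟨q, hq, hq0⟩ := exists_eq_pow_mul_eval_ne_zero hp 0
  rw [C_0, sub_zero] at hq
  generalize rootMultiplicity 0 p = s at hq ⊢
  subst hq
  constructor
  · rw [coeff_X_pow_mul', if_pos le_rfl, Nat.sub_self, coeff_zero_eq_eval_zero]
    exact hq0
  · intro j hj
    rw [coeff_X_pow_mul', if_neg (by omega)]

theorem rootMultiplicity_zero_le {p : K[X]} {j : ℕ} (h : p.coeff j ≠ 0) :
    rootMultiplicity 0 p ≤ j := by
  by_contra! hlt
  exact h ((rootMultiplicity_zero_eq (by rintro rfl; simp at h)).2 j hlt)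

theorem rootMultiplicity_C_mul_pow {r : K[X]} {c : K} (hc : c ≠ 0) (z : K) (m : ℕ) :
    rootMultiplicity z (C c * r ^ m) = m * rootMultiplicity z r := by
  classical
  rw [← count_roots, roots_C_mul _ hc, roots_pow, Multiset.count_nsmul, count_roots]

section

variable [CharZero K]

/-! ### Leading forms of elements of the Weyl algebra as polynomials in one variable -/

/-- The `(ρ, σ)`-part of degree `N` of `P` as a polynomial in one variable: the monomial `x^i y^j`
is sent to `E^j`. -/
def psym (ρ σ N : ℤ) (P : WeylAlgebra K) : K[X] := sym ρ (ρ + σ) N (emb K 1 one_pos P)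

section

variable {ρ σ N : ℤ} {P : WeylAlgebra K}

theorem emb_one_mem_fil (hβ : 0 < ρ + σ)
    (hP : ∀ p ∈ supp P, pointDeg (ρ, σ) p ≤ N) :
    emb K 1 one_pos P ∈ fil ρ (ρ + σ) N ∧ psym ρ σ N P = edge (ρ, σ) N P := by
  have h := emb_mem_fil (K := K) one_pos hβ (d := (ρ, σ)) (α := ρ) (by simp) rfl hP
  refine ⟨h.1, h.2.trans ?_⟩
  simp

theorem coeff_psym_ne_zero_iff (hρ : 0 < ρ) (hβ : 0 < ρ + σ)
    (h : deg (ρ, σ) P = (N : WithBot ℤ)) {j : ℕ} :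
    (psym ρ σ N P).coeff j ≠ 0 ↔ ∃ i : ℤ, (i, (j : ℤ)) ∈ supp P ∧ ρ * i + σ * j = N := by
  rw [(emb_one_mem_fil hβ (deg_eq_coe_iff.1 h).2).2, coeff_edge_ne_zero_iff hρ.ne']
  simp [pointDeg]

theorem psym_ne_zero (hρ : 0 < ρ) (hβ : 0 < ρ + σ)
    (h : deg (ρ, σ) P = (N : WithBot ℤ)) : psym ρ σ N P ≠ 0 := by
  obtain ⟨⟨i, j⟩, hp, he⟩ := (deg_eq_coe_iff.1 h).1
  have hj := (mem_supp_nonneg hp).2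
  lift j to ℕ using hj
  intro h0
  refine (coeff_psym_ne_zero_iff hρ hβ h (j := j)).2 ⟨i, hp, ?_⟩ (by rw [h0, coeff_zero])
  simpa [pointDeg] using he

theorem emb_mem_fil_of_deg (hβ : 0 < ρ + σ) (h : deg (ρ, σ) P = (N : WithBot ℤ)) :
    emb K 1 one_pos P ∈ fil ρ (ρ + σ) N :=
  (emb_one_mem_fil hβ (deg_eq_coe_iff.1 h).2).1

theorem deg_le_of_mem_fil (hρ : 0 < ρ) (hβ : 0 < ρ + σ) {M : ℤ}
    (hM : emb K 1 one_pos P ∈ fil ρ (ρ + σ) M) (h : deg (ρ, σ) P = (N : WithBot ℤ)) : N ≤ M := by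
  by_contra! hlt
  exact psym_ne_zero hρ hβ h (sym_eq_zero_of_mem_fil hlt hM)

theorem deg_eq_of_psym_ne_zero (hρ : 0 < ρ) (hβ : 0 < ρ + σ)
    (hM : emb K 1 one_pos P ∈ fil ρ (ρ + σ) N) (h : psym ρ σ N P ≠ 0) :
    deg (ρ, σ) P = (N : WithBot ℤ) := by
  have hP : P ≠ 0 := by
    rintro rfl
    exact h (by simp [psym])
  obtain ⟨M, hM'⟩ := exists_deg_eq (ρ, σ) hP
  have h1 := deg_le_of_mem_fil hρ hβ hM hM'
  rcases h1.lt_or_eq with h2 | h2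
  · exact absurd (sym_eq_zero_of_mem_fil h2 (emb_mem_fil_of_deg hβ hM')) h
  · rw [hM', h2]

/-- Along an edge `ρ (j - i) = (ρ + σ) j - N`, so `j - i` increases with `j` and its maximum is at
the top exponent. For `st_eq` the bottom exponent plays this role. -/
theorem en_eq (hρ : 0 < ρ) (hβ : 0 < ρ + σ) (h : deg (ρ, σ) P = (N : WithBot ℤ)) {i : ℤ} {j : ℕ}
    (hj : (psym ρ σ N P).natDegree = j) (hij : ρ * i + σ * j = N) :
    en (ρ, σ) P = (i, (j : ℤ)) ∧ (i, (j : ℤ)) ∈ supp P := by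
  have h0 := psym_ne_zero hρ hβ h
  have hc : (psym ρ σ N P).coeff j ≠ 0 := by
    rw [← hj]
    exact leadingCoeff_ne_zero.2 h0
  obtain ⟨i', hi', he⟩ := (coeff_psym_ne_zero_iff hρ hβ h).1 hc
  have hii : i' = i := mul_left_cancel₀ hρ.ne' (by linarith)
  subst hii
  refine ⟨wbarL_eq ((mem_suppL_lead h).2 ⟨hi', by simpa [pointDeg] using he⟩) fun q hq => ?_, hi'⟩
  obtain ⟨hq1, hq2⟩ := (mem_suppL_lead h).1 hq
  obtain ⟨k, l⟩ := q
  have hl := (mem_supp_nonneg hq1).2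
  lift l to ℕ using hl
  simp only [pointDeg, Int.cast_id] at hq2
  have hlj : l ≤ j := by
    rw [← hj]
    exact le_natDegree_of_ne_zero ((coeff_psym_ne_zero_iff hρ hβ h).2 ⟨k, hq1, hq2⟩)
  rcases hlj.lt_or_eq with hlt | rfl
  · right
    have hlt' : (l : ℤ) < j := by exact_mod_cast hlt
    simp only
    nlinarith
  · left
    rw [mul_left_cancel₀ hρ.ne' (by linarith : ρ * k = ρ * i')]

theorem st_eq (hρ : 0 < ρ) (hβ : 0 < ρ + σ) (h : deg (ρ, σ) P = (N : WithBot ℤ)) {i : ℤ} {j : ℕ}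
    (hj : rootMultiplicity 0 (psym ρ σ N P) = j) (hij : ρ * i + σ * j = N) :
    st (ρ, σ) P = (i, (j : ℤ)) ∧ (i, (j : ℤ)) ∈ supp P := by
  have h0 := psym_ne_zero hρ hβ h
  have hc : (psym ρ σ N P).coeff j ≠ 0 := by
    rw [← hj]
    exact (rootMultiplicity_zero_eq h0).1
  obtain ⟨i', hi', he⟩ := (coeff_psym_ne_zero_iff hρ hβ h).1 hc
  have hii : i' = i := mul_left_cancel₀ hρ.ne' (by linarith)
  subst hii
  refine ⟨wL_eq ((mem_suppL_lead h).2 ⟨hi', by simpa [pointDeg] using he⟩) fun q hq => ?_, hi'⟩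
  obtain ⟨hq1, hq2⟩ := (mem_suppL_lead h).1 hq
  obtain ⟨k, l⟩ := q
  have hl := (mem_supp_nonneg hq1).2
  lift l to ℕ using hl
  simp only [pointDeg, Int.cast_id] at hq2
  have hlj : j ≤ l := by
    rw [← hj]
    exact rootMultiplicity_zero_le ((coeff_psym_ne_zero_iff hρ hβ h).2 ⟨k, hq1, hq2⟩)
  rcases hlj.lt_or_eq with hlt | rfl
  · right
    have hlt' : (j : ℤ) < l := by exact_mod_cast hlt
    simp only
    nlinarith
  · left
    rw [mul_left_cancel₀ hρ.ne' (by linarith : ρ * k = ρ * i')]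

theorem mem_Dir_iff (hρ : 0 < ρ) (hβ : 0 < ρ + σ) (h : deg (ρ, σ) P = (N : WithBot ℤ)) :
    (ρ, σ) ∈ Dir P ↔ (ρ, σ) ∈ directions ∧
      rootMultiplicity 0 (psym ρ σ N P) < (psym ρ σ N P).natDegree := by
  have h0 := psym_ne_zero hρ hβ h
  rw [Dir, Set.mem_ofPred_eq, and_congr_right_iff]
  intro _
  have hlc : (psym ρ σ N P).coeff (psym ρ σ N P).natDegree ≠ 0 := leadingCoeff_ne_zero.2 h0
  constructor
  · intro hcard
    obtain ⟨⟨k, l⟩, hp, ⟨k', l'⟩, hq, hne⟩ := Finset.one_lt_card.1 hcard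
    obtain ⟨hp1, hp2⟩ := (mem_suppL_lead h).1 hp
    obtain ⟨hq1, hq2⟩ := (mem_suppL_lead h).1 hq
    have hl := (mem_supp_nonneg hp1).2
    have hl' := (mem_supp_nonneg hq1).2
    lift l to ℕ using hl
    lift l' to ℕ using hl'
    simp only [pointDeg, Int.cast_id] at hp2 hq2
    have c1 := (coeff_psym_ne_zero_iff hρ hβ h).2 ⟨k, hp1, hp2⟩
    have c2 := (coeff_psym_ne_zero_iff hρ hβ h).2 ⟨k', hq1, hq2⟩
    have hll : l ≠ l' := by
      rintro rfl
      exact hne (by rw [mul_left_cancel₀ hρ.ne' (by linarith : ρ * k = ρ * k')])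
    have := rootMultiplicity_zero_le c1
    have := rootMultiplicity_zero_le c2
    have := le_natDegree_of_ne_zero c1
    have := le_natDegree_of_ne_zero c2
    omega
  · intro hlt
    obtain ⟨k, hk, hk'⟩ := (coeff_psym_ne_zero_iff hρ hβ h).1 hlc
    obtain ⟨l, hl, hl'⟩ := (coeff_psym_ne_zero_iff hρ hβ h).1 (rootMultiplicity_zero_eq h0).1
    refine Finset.one_lt_card.2 ⟨_, (mem_suppL_lead h).2 ⟨hk, by simpa [pointDeg] using hk'⟩, _,
      (mem_suppL_lead h).2 ⟨hl, by simpa [pointDeg] using hl'⟩, fun he => ?_⟩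
    have := congrArg Prod.snd he
    simp only [Nat.cast_inj] at this
    omega

end

/-! ### Common edges of `P` and `Q` -/

/-- Numbers in the ratio `m : n`. -/
theorem exists_eq_mul_of_mul_eq {m n : ℕ} (hm : 0 < m) (hmn : m.Coprime n) {a b : ℤ}
    (h : n * a = m * b) : ∃ k : ℤ, a = m * k ∧ b = n * k := by
  have hc : IsCoprime (m : ℤ) (n : ℤ) := Nat.isCoprime_iff_coprime.2 hmn
  obtain ⟨k, hk⟩ := hc.dvd_of_dvd_mul_left (Dvd.intro _ h.symm)
  refine ⟨k, hk, ?_⟩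
  have hm' : (m : ℤ) ≠ 0 := by exact_mod_cast hm.ne'
  refine mul_left_cancel₀ hm' ?_
  rw [← h, hk]
  ring

/-- The data of a common edge of `P` and `Q` in the direction `(ρ, σ)`: the leading forms are
powers of `r`, whose ends are the points `(u, v)` and `(a, b)`. -/
structure CommonEdge (P Q : WeylAlgebra K) (m n : ℕ) (ρ σ κ : ℤ) (r : K[X]) (u a : ℕ) : Prop where
  ne_zero : r ≠ 0
  left : ∃ c : K, c ≠ 0 ∧ psym ρ σ (m * κ) P = C c * r ^ m
  right : ∃ c : K, c ≠ 0 ∧ psym ρ σ (n * κ) Q = C c * r ^ n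
  en_deg : ρ * u + σ * r.natDegree = κ
  st_deg : ρ * a + σ * rootMultiplicity 0 r = κ
  en_left : en (ρ, σ) P = ((m : ℤ) * u, (m : ℤ) * r.natDegree)
  st_left : st (ρ, σ) P = ((m : ℤ) * a, (m : ℤ) * rootMultiplicity 0 r)
  mem_Dir_left : rootMultiplicity 0 r < r.natDegree → (ρ, σ) ∈ directions → (ρ, σ) ∈ Dir P
  mem_Dir_right : rootMultiplicity 0 r < r.natDegree → (ρ, σ) ∈ directions → (ρ, σ) ∈ Dir Q
  lt_of_mem_Dir : (ρ, σ) ∈ Dir P → rootMultiplicity 0 r < r.natDegree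

theorem exists_commonEdge [IsAlgClosed K] {P Q : WeylAlgebra K} (hQP : Q * P - P * Q = 1) {m n : ℕ}
    (hm : 0 < m) (hn : 0 < n) (hmn : m.Coprime n) {ρ σ κ : ℤ} (hρ : 0 < ρ) (hβ : 0 < ρ + σ)
    (hκ : 0 < κ) (hP : deg (ρ, σ) P = ((m * κ : ℤ) : WithBot ℤ))
    (hQ : deg (ρ, σ) Q = ((n * κ : ℤ) : WithBot ℤ)) (hlt : ρ + σ < (m + n) * κ) :
    ∃ r u a, CommonEdge P Q m n ρ σ κ r u a := by
  have hP0 := psym_ne_zero hρ hβ hP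
  have hQ0 := psym_ne_zero hρ hβ hQ
  have hQP' : emb K 1 one_pos Q * emb K 1 one_pos P - emb K 1 one_pos P * emb K 1 one_pos Q = 1 := by
    rw [← map_mul, ← map_mul, ← map_sub, hQP, map_one]
  obtain ⟨r, c, d, hr0, hc0, hd0, hpr, hqr⟩ := exists_root_of_pois_eq_zero hm hmn hκ.ne' hP0 hQ0
    (pois_eq_zero_of_lt hβ hQP' (emb_mem_fil_of_deg hβ hP) (emb_mem_fil_of_deg hβ hQ)
      (by linarith))
  have hpd : (psym ρ σ (m * κ) P).natDegree = m * r.natDegree := by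
    rw [hpr, natDegree_C_mul hc0, natDegree_pow]
  have hqd : (psym ρ σ (n * κ) Q).natDegree = n * r.natDegree := by
    rw [hqr, natDegree_C_mul hd0, natDegree_pow]
  have hpt : rootMultiplicity 0 (psym ρ σ (m * κ) P) = m * rootMultiplicity 0 r := by
    rw [hpr, rootMultiplicity_C_mul_pow hc0]
  have hqt : rootMultiplicity 0 (psym ρ σ (n * κ) Q) = n * rootMultiplicity 0 r := by
    rw [hqr, rootMultiplicity_C_mul_pow hd0]
  -- A point of `P` at height `m j` and one of `Q` at height `n j` also have abscissas in the ratio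
  -- `m : n`. By coprimality the ends of `r` are lattice points.
  have key : ∀ j : ℕ, (psym ρ σ (m * κ) P).coeff (m * j) ≠ 0 →
      (psym ρ σ (n * κ) Q).coeff (n * j) ≠ 0 → ∃ u : ℕ, ρ * u + σ * j = κ := by
    intro j h1 h2
    obtain ⟨i, hi, hi'⟩ := (coeff_psym_ne_zero_iff hρ hβ hP).1 h1
    obtain ⟨i', -, hii'⟩ := (coeff_psym_ne_zero_iff hρ hβ hQ).1 h2
    push_cast at hi' hii'
    obtain ⟨k, hk, -⟩ := exists_eq_mul_of_mul_eq hm hmn (a := i) (b := i')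
      (mul_left_cancel₀ hρ.ne' (by linear_combination (n : ℤ) * hi' - (m : ℤ) * hii'))
    have hm' : (0 : ℤ) < m := by exact_mod_cast hm
    have hk0 : 0 ≤ k := by
      have := (mem_supp_nonneg hi).1
      rw [hk] at this
      exact nonneg_of_mul_nonneg_right this hm'
    lift k to ℕ using hk0
    refine ⟨k, mul_left_cancel₀ hm'.ne' ?_⟩
    rw [← hi', hk]
    ring
  obtain ⟨u, hu⟩ := key r.natDegree
    (by rw [← hpd]; exact leadingCoeff_ne_zero.2 hP0) (by rw [← hqd]; exact leadingCoeff_ne_zero.2 hQ0)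
  obtain ⟨a, ha⟩ := key (rootMultiplicity 0 r)
    (by rw [← hpt]; exact (rootMultiplicity_zero_eq hP0).1)
    (by rw [← hqt]; exact (rootMultiplicity_zero_eq hQ0).1)
  have hen := (en_eq hρ hβ hP (i := m * u) hpd (by push_cast; rw [← hu]; ring)).1
  have hst := (st_eq hρ hβ hP (i := m * a) hpt (by push_cast; rw [← ha]; ring)).1
  push_cast at hen hst
  refine ⟨r, u, a, hr0, ⟨c, hc0, hpr⟩, ⟨d, hd0, hqr⟩, hu, ha, hen, hst, fun h hd => ?_,
    fun h hd => ?_, fun h => ?_⟩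
  · rw [mem_Dir_iff hρ hβ hP, hpd, hpt]
    exact ⟨hd, Nat.mul_lt_mul_of_pos_left h hm⟩
  · rw [mem_Dir_iff hρ hβ hQ, hqd, hqt]
    exact ⟨hd, Nat.mul_lt_mul_of_pos_left h hn⟩
  · rw [mem_Dir_iff hρ hβ hP, hpd, hpt] at h
    exact lt_of_mul_lt_mul_left h.2 (Nat.zero_le _)

theorem CommonEdge.exists_fixing [IsAlgClosed K] {P Q : WeylAlgebra K} (hQP : Q * P - P * Q = 1)
    {m n : ℕ} (hm : 0 < m) {ρ σ κ : ℤ} (hρ : 0 < ρ) (hβ : 0 < ρ + σ)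
    (hκ : 0 < κ) (hP : deg (ρ, σ) P = ((m * κ : ℤ) : WithBot ℤ)) {r : K[X]} {u a : ℕ}
    (h : CommonEdge P Q m n ρ σ κ r u a) (hr : 0 < r.natDegree) :
    ∃ f, pois (m * κ) (ρ + σ) (psym ρ σ (m * κ) P) f = C (ρ : K) * psym ρ σ (m * κ) P ∧
      ExpClass ρ (ρ + σ) (ρ + σ) f := by
  let φ : WeylAlgebra K →ₐ[K] SkewLaurent K :=
    (emb K 1 one_pos).comp (weylLift P Q (by rw [← sub_eq_iff_eq_add', hQP]))
  have hφ : φ genX = emb K 1 one_pos P := by simp [φ]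
  obtain ⟨c, hc, hpr⟩ := h.left
  have := Dixmier.exists_fixing φ hρ hβ (N := m * κ) (by positivity)
    (by rw [hφ]; exact emb_mem_fil_of_deg hβ hP)
    (by
      rw [hφ]
      change 0 < (psym ρ σ (m * κ) P).natDegree
      rw [hpr, natDegree_C_mul hc, natDegree_pow]
      positivity)
  rwa [hφ] at this

end

end

section

open Polynomial

variable {K : Type*} [Field K]

/-! ### Counterexamples and minimality -/

theorem IsCounterexample.comm {P Q : WeylAlgebra K} (h : IsCounterexample P Q) :
    Q * P - P * Q = 1 := by
  obtain ⟨φ, rfl, rfl, -⟩ := h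
  rw [← map_mul, ← map_mul, genY_mul_genX, map_add, map_one, add_sub_cancel_left]

theorem IsCounterexample.ne_zero {P Q : WeylAlgebra K} (h : IsCounterexample P Q) :
    P ≠ 0 ∧ Q ≠ 0 := by
  have h1 := h.comm
  have : Nontrivial (WeylAlgebra K) := ⟨0, 1, fun h0 => by
    have := congrArg (regularRep K) h0
    rw [map_zero, map_one] at this
    exact zero_ne_one this⟩
  constructor <;> rintro rfl <;> simp at h1

theorem IsCounterexample.comp {P Q : WeylAlgebra K} (h : IsCounterexample P Q)
    {ψ θ : WeylAlgebra K →ₐ[K] WeylAlgebra K} (h1 : ψ.comp θ = AlgHom.id K _)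
    (h2 : θ.comp ψ = AlgHom.id K _) {P' Q' : WeylAlgebra K}
    (hP : ∀ φ : WeylAlgebra K →ₐ[K] WeylAlgebra K, φ genX = P → φ genY = Q →
      φ (ψ genX) = P' ∧ φ (ψ genY) = Q') : IsCounterexample P' Q' := by
  obtain ⟨φ, hX, hY, hb⟩ := h
  refine ⟨φ.comp ψ, (hP φ hX hY).1, (hP φ hX hY).2, fun hbij => hb ?_⟩
  have hθ : Function.Bijective θ :=
    Function.bijective_iff_has_inverse.2 ⟨ψ, DFunLike.congr_fun h1, DFunLike.congr_fun h2⟩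
  have : φ = (φ.comp ψ).comp θ := by rw [AlgHom.comp_assoc, h1, AlgHom.comp_id]
  rw [this]
  exact hbij.comp hθ

theorem sub_smul_sub_neg_smul {V : Type*} [AddCommGroup V] [Module K V] (c : K) (x y : V) :
    y - c • x - -c • x = y := by
  module

variable (K) in
/-- The automorphism `X ↦ X`, `Y ↦ Y - c X ^ j`. -/
def elementary (c : K) (j : ℕ) : WeylAlgebra K →ₐ[K] WeylAlgebra K :=
  weylLift genX (genY - c • genX ^ j) (by
    rw [sub_mul, mul_sub, genY_mul_genX, smul_mul_assoc, mul_smul_comm, ← pow_succ, ← pow_succ']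
    abel)

theorem elementary_comp (c : K) (j : ℕ) :
    (elementary K c j).comp (elementary K (-c) j) = AlgHom.id K _ := by
  apply weylHom_ext
  · simp [elementary]
  · simp only [elementary, AlgHom.comp_apply, weylLift_genY, map_sub, map_smul, map_pow,
      weylLift_genX, AlgHom.id_apply]
    exact sub_smul_sub_neg_smul c (genX ^ j) genY

theorem IsCounterexample.sub_smul_pow {P Q : WeylAlgebra K} (h : IsCounterexample P Q) (c : K)
    (j : ℕ) : IsCounterexample P (Q - c • P ^ j) := by
  refine h.comp (elementary_comp c j) (by simpa using elementary_comp (-c) j) ?_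
  rintro φ rfl rfl
  simp [elementary]

theorem neg_swap_comm {A : Type*} [Ring A] {x y : A} (h : y * x = x * y + 1) :
    -x * y = y * -x + 1 ∧ x * -y = -y * x + 1 := by
  rw [neg_mul, mul_neg, mul_neg, neg_mul, h]
  constructor <;> abel

theorem IsCounterexample.swap {P Q : WeylAlgebra K} (h : IsCounterexample P Q) :
    IsCounterexample Q (-P) := by
  have h0 := neg_swap_comm (genY_mul_genX (K := K))
  refine h.comp (ψ := weylLift genY (-genX) h0.1) (θ := weylLift (-genY) genX h0.2) ?_ ?_ ?_
  · apply weylHom_ext <;> simp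
  · apply weylHom_ext <;> simp
  · rintro φ rfl rfl
    simp

theorem IsMinimalPair.le {P Q P' Q' : WeylAlgebra K} (h : IsMinimalPair P Q)
    (h' : IsCounterexample P' Q') : degGcd P Q ≤ degGcd P' Q' := by
  have : (degGcd P Q : ℕ∞) ≤ degGcd P' Q' := by
    rw [h.2, minGcd]
    exact iInf_le_of_le P' (iInf_le_of_le Q' (iInf_le_of_le h' le_rfl))
  exact_mod_cast this

theorem supp_neg (P : WeylAlgebra K) : supp (-P) = supp P := by
  ext p
  simp [supp, mem_suppL]

theorem deg_neg (d : ℤ × ℤ) (P : WeylAlgebra K) : deg d (-P) = deg d P := by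
  unfold deg degL
  change (supp (-P)).sup _ = (supp P).sup _
  rw [supp_neg]

theorem commute_of_deg_eq_zero {P Q : WeylAlgebra K} (h : deg (1, 1) Q = ((0 : ℤ) : WithBot ℤ)) :
    Commute P Q := by
  rw [weyl_eq_sum Q]
  refine Commute.sum_right _ _ _ fun e he => ?_
  have hp : expPoint e ∈ supp Q := mem_suppL.2 ⟨e, MvPolynomial.mem_support_iff.1 he, rfl⟩
  have := (deg_eq_coe_iff.1 h).2 _ hp
  simp only [pointDeg, expPoint, Int.cast_id] at this
  have h0 : e 0 = 0 := by omega
  have h1 : e 1 = 0 := by omega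
  rw [h0, h1]
  simp [Commute.smul_right]

/-- The corner `(a, b)` maximizes both coordinates, hence the degrees in the directions `(1, 1)` and
`(1, 0)`. -/
theorem IsSubrectangular.exists_deg [CharZero K] {P : WeylAlgebra K} (h : IsSubrectangular P) :
    ∃ a b : ℕ, 0 < a ∧ 0 < b ∧ deg (1, 1) P = ((a + b : ℕ) : ℤ) ∧ deg (1, 0) P = (a : ℤ) ∧
      (psym 1 1 (a + b : ℕ) P).natDegree = b := by
  obtain ⟨a, b, ha, hb, hab, hle⟩ := h
  lift a to ℕ using ha.le
  lift b to ℕ using hb.le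
  have h1 : deg (1, 1) P = ((a + b : ℕ) : ℤ) := by
    refine deg_eq_coe_iff.2 ⟨⟨_, hab, by simp [pointDeg]⟩, fun p hp => ?_⟩
    have := hle p hp
    simp only [pointDeg, Int.cast_id]
    push_cast
    linarith
  refine ⟨a, b, by exact_mod_cast ha, by exact_mod_cast hb, h1, ?_, le_antisymm ?_ ?_⟩
  · refine deg_eq_coe_iff.2 ⟨⟨_, hab, by simp [pointDeg]⟩, fun p hp => ?_⟩
    have := hle p hp
    simp only [pointDeg, Int.cast_id]
    linarith
  · rw [natDegree_le_iff_coeff_eq_zero]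
    intro j hj
    by_contra h0
    obtain ⟨i, hi, -⟩ := (coeff_psym_ne_zero_iff one_pos (by norm_num) h1).1 h0
    have := (hle _ hi).2.2.2
    simp only [Nat.cast_le] at this
    omega
  · refine le_natDegree_of_ne_zero ((coeff_psym_ne_zero_iff one_pos (by norm_num) h1).2
      ⟨a, hab, ?_⟩)
    push_cast
    ring

section

variable [CharZero K] [IsAlgClosed K]

/-- If the degree of `P` is at most the minimum of the degree gcds, the degree of `Q` can be
lowered indefinitely. -/
theorem IsCounterexample.false_of_le {P Q : WeylAlgebra K} (h : IsCounterexample P Q) {D : ℕ}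
    (hP : deg (1, 1) P = ((D : ℤ) : WithBot ℤ)) (hD : 2 ≤ D)
    (hmin : ∀ Q', IsCounterexample P Q' → D ≤ degGcd P Q') : False := by
  obtain ⟨E, hE⟩ := exists_deg_eq (1, 1) h.ne_zero.2
  have hE0 : 0 ≤ E := by
    obtain ⟨p, hp, he⟩ := (deg_eq_coe_iff.1 hE).1
    have := mem_supp_nonneg hp
    simp only [pointDeg, Int.cast_id, one_mul] at he
    omega
  lift E to ℕ using hE0
  induction E using Nat.strong_induction_on generalizing Q with
  | _ E ih =>
    have hcomm := h.comm
    have hpos : 0 < E := by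
      rw [Nat.pos_iff_ne_zero]
      rintro rfl
      rw [(commute_of_deg_eq_zero (P := P) hE).eq, sub_self] at hcomm
      have := h.ne_zero.1
      exact this (by rw [← one_mul P, ← hcomm, zero_mul])
    -- The gcd of the degrees divides `D` and is at least `D`. The degree of `Q` is thus a multiple
    -- `D j`, and its leading form is proportional to the `j`-th power of that of `P`.
    have hdvd : D ∣ E := by
      have h1 := hmin Q h
      rw [degGcd, degInt_eq hP, degInt_eq hE, Int.gcd_natCast_natCast] at h1
      have h2 : Nat.gcd D E = D := le_antisymm (Nat.gcd_le_left _ (by omega)) h1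
      exact Nat.gcd_eq_left_iff_dvd.1 h2
    obtain ⟨j, rfl⟩ := hdvd
    have hfP := emb_mem_fil_of_deg (by norm_num) hP
    have hfQ := emb_mem_fil_of_deg (by norm_num) hE
    have hpois : pois ((1 : ℕ) * (D : ℤ)) (j * D) (psym 1 1 D P) (psym 1 1 (D * j : ℕ) Q) = 0 := by
      have := pois_eq_zero_of_lt (by norm_num) (by rw [← map_mul, ← map_mul, ← map_sub, hcomm, map_one])
        hfP hfQ (by
          have : 1 ≤ D * j := hpos
          zify at this hD
          push_cast
          linarith)
      rw [Nat.cast_one, one_mul, mul_comm (j : ℤ)]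
      exact_mod_cast this
    have hp0 := psym_ne_zero one_pos (by norm_num) hP
    have hq0 := psym_ne_zero one_pos (by norm_num) hE
    obtain ⟨r, c, d, hr, hc, hd, hpr, hqr⟩ := exists_root_of_pois_eq_zero one_pos
      (Nat.coprime_one_left j) (by positivity : (D : ℤ) ≠ 0) hp0 hq0 hpois
    -- The scalar cancels the leading forms; the pair stays a counterexample with the same `P`, and
    -- the degree of `Q` drops.
    have h' := h.sub_smul_pow (d / c ^ j) j
    obtain ⟨E', hE'⟩ := exists_deg_eq (1, 1) h'.ne_zero.2
    have hpow := fil_pow (by norm_num) hfP j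
    have hcast : ((D * j : ℕ) : ℤ) = j * D := by push_cast; ring
    rw [hcast] at hfQ hqr
    have hmem : emb K 1 one_pos (Q - (d / c ^ j) • P ^ j) ∈ fil 1 (1 + 1) (j * D : ℤ) := by
      rw [map_sub, map_smul, map_pow]
      exact Submodule.sub_mem _ hfQ (Submodule.smul_mem _ _ hpow.1)
    have hsym : psym 1 1 (j * D) (Q - (d / c ^ j) • P ^ j) = 0 := by
      rw [psym, map_sub, map_smul, map_pow, map_sub, map_smul, hpow.2]
      change psym 1 1 (j * D) Q - (d / c ^ j) • psym 1 1 D P ^ j = 0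
      rw [hqr, hpr, pow_one, mul_pow, smul_eq_C_mul, ← C_pow, ← mul_assoc, ← C_mul,
        div_mul_cancel₀ _ (pow_ne_zero _ hc), sub_self]
    have hE'0 : 0 ≤ E' := by
      obtain ⟨p, hp, he⟩ := (deg_eq_coe_iff.1 hE').1
      have := mem_supp_nonneg hp
      simp only [pointDeg, Int.cast_id, one_mul] at he
      omega
    have hle := deg_le_of_mem_fil one_pos (by norm_num) hmem hE'
    have hne : E' ≠ j * D := by
      rintro rfl
      exact psym_ne_zero one_pos (by norm_num) hE' hsym
    lift E' to ℕ using hE'0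
    refine ih E' ?_ h' hE'
    zify
    rw [mul_comm]
    exact lt_of_le_of_ne hle hne

/-- In a minimal pair neither degree divides the other. -/
theorem IsMinimalPair.two_le {P Q : WeylAlgebra K} (h : IsMinimalPair P Q) {m n g : ℕ}
    (hmn : m.Coprime n) (hm : 0 < m) (hn : 0 < n)
    (hP : deg (1, 1) P = ((m * g : ℕ) : ℤ)) (hQ : deg (1, 1) Q = ((n * g : ℕ) : ℤ))
    (hP2 : 2 ≤ m * g) (hQ2 : 2 ≤ n * g) : 2 ≤ m ∧ 2 ≤ n := by
  have hg : degGcd P Q = g := by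
    rw [degGcd, degInt_eq hP, degInt_eq hQ, Int.gcd_natCast_natCast, Nat.gcd_mul_right, hmn, one_mul]
  constructor
  · by_contra! hlt
    obtain rfl : m = 1 := by omega
    rw [one_mul] at hP hP2
    exact h.1.false_of_le hP hP2 fun Q' hQ' => hg ▸ h.le hQ'
  · by_contra! hlt
    obtain rfl : n = 1 := by omega
    rw [one_mul] at hQ hQ2
    exact h.1.swap.false_of_le hQ hQ2 fun Q' hQ' => hg ▸ h.le hQ'

end

end

section

open Polynomial

variable {K : Type*} [Field K] [CharZero K]

/-! ### Existence of a cutting direction -/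

theorem deg_neg_one {ρ σ : ℤ} (hρ : 0 < ρ) (hβ : 0 < ρ + σ) :
    deg (ρ, σ) (-1 : WeylAlgebra K) = ((0 : ℤ) : WithBot ℤ) := by
  rw [deg_neg]
  refine deg_eq_of_psym_ne_zero hρ hβ ?_ ?_
  · rw [map_one]
    exact one_mem_fil
  · rw [psym, map_one, sym_one]
    exact one_ne_zero

/-- The commutator is `-1`, of degree `0` in every such direction. -/
theorem isProportional_iff {ρ σ N M : ℤ} (hρ : 0 < ρ) (hβ : 0 < ρ + σ) {P Q : WeylAlgebra K}
    (hQP : Q * P - P * Q = 1) (hP : deg (ρ, σ) P = (N : WithBot ℤ))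
    (hQ : deg (ρ, σ) Q = (M : WithBot ℤ)) : IsProportional (ρ, σ) P Q ↔ ρ + σ < N + M := by
  have h : P * Q - Q * P = -1 := by
    rw [← hQP]
    exact (neg_sub _ _).symm
  rw [IsProportional, h, deg_neg_one hρ hβ, hP, hQ]
  norm_cast
  simp

theorem bracket_eq_zero_iff {d : ℤ × ℤ} {P Q : WeylAlgebra K} (hQP : Q * P - P * Q = 1) :
    bracket d P Q = 0 ↔ IsProportional d P Q := by
  rw [bracket]
  split_ifs with h
  · simp [h]
  · simp only [h, iff_false]
    apply lead_ne_zero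
    intro h0
    rw [sub_eq_zero.1 h0, sub_self] at hQP
    have := congrArg (emb K 1 one_pos) hQP
    rw [map_zero, map_one] at this
    exact zero_ne_one this

theorem CommonEdge.isVertex_left {P Q : WeylAlgebra K} {m n : ℕ} {ρ σ κ : ℤ} {r : K[X]} {u a : ℕ}
    (h : CommonEdge P Q m n ρ σ κ r u a) (hρ : 0 < ρ)
    (hP : emb K 1 one_pos P ∈ fil ρ (ρ + σ) (m * κ)) :
    IsVertex ρ (ρ + σ) (m * (a - rootMultiplicity 0 r)) (m * rootMultiplicity 0 r)
      (emb K 1 one_pos P) := by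
  obtain ⟨c, hc, hpr⟩ := h.left
  have hm := rootMultiplicity_C_mul_pow (r := r) hc 0 m
  rw [← hpr] at hm
  have h0 := rootMultiplicity_zero_eq (p := psym ρ σ (m * κ) P) (by
    rw [hpr]; exact mul_ne_zero (C_ne_zero.2 hc) (pow_ne_zero _ h.ne_zero))
  rw [hm] at h0
  refine isVertex_of_sym hρ.ne' hP ?_ h0.1 h0.2
  rw [← h.st_deg]
  push_cast
  ring

theorem CommonEdge.isVertex_right {P Q : WeylAlgebra K} {m n : ℕ} {ρ σ κ : ℤ} {r : K[X]} {u a : ℕ}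
    (h : CommonEdge P Q m n ρ σ κ r u a) (hρ : 0 < ρ)
    (hQ : emb K 1 one_pos Q ∈ fil ρ (ρ + σ) (n * κ)) :
    IsVertex ρ (ρ + σ) (n * (a - rootMultiplicity 0 r)) (n * rootMultiplicity 0 r)
      (emb K 1 one_pos Q) := by
  obtain ⟨c, hc, hqr⟩ := h.right
  have hm := rootMultiplicity_C_mul_pow (r := r) hc 0 n
  rw [← hqr] at hm
  have h0 := rootMultiplicity_zero_eq (p := psym ρ σ (n * κ) Q) (by
    rw [hqr]; exact mul_ne_zero (C_ne_zero.2 hc) (pow_ne_zero _ h.ne_zero))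
  rw [hm] at h0
  refine isVertex_of_sym hρ.ne' hQ ?_ h0.1 h0.2
  rw [← h.st_deg]
  push_cast
  ring

/-- Leading forms of degrees with sum `ρ + σ` are excluded for positive degrees. -/
theorem add_ne_of_comm {P Q : WeylAlgebra K} (hQP : Q * P - P * Q = 1) {ρ σ N M : ℤ} (hρ : 0 < ρ)
    (hσ : σ < 0) (hβ : 0 < ρ + σ) (hN : 0 < N) (hM : 0 < M)
    (hP : deg (ρ, σ) P = (N : WithBot ℤ)) (hQ : deg (ρ, σ) Q = (M : WithBot ℤ)) :
    N + M ≠ ρ + σ := by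
  intro hNM
  have h := (fil_comm hβ (emb_mem_fil_of_deg hβ hQ) (emb_mem_fil_of_deg hβ hP)).2
  rw [← map_mul, ← map_mul, ← map_sub, hQP, map_one,
    show M + N - (ρ + σ) = 0 by omega, sym_one] at h
  change _ = pois M N (psym ρ σ M Q) (psym ρ σ N P) at h
  have h0 := congrArg (fun f => f.coeff 0) h
  -- The constant term of the bracket needs a point `(i, 1)` of one element and `(j, 0)` of the
  -- other. Equality of weights gives `i + j = 1`, while positive degrees and `σ < 0` force `i, j >
  -- 0`.
  have key : ∀ {A B : WeylAlgebra K} {N M : ℤ}, 0 < N → 0 < M → N + M = ρ + σ →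
      deg (ρ, σ) A = (N : WithBot ℤ) → deg (ρ, σ) B = (M : WithBot ℤ) →
      (psym ρ σ N A).coeff 1 * (psym ρ σ M B).coeff 0 = 0 := by
    intro A B N M hN hM hNM hA hB
    by_contra hne
    obtain ⟨i, hi, hi'⟩ := (coeff_psym_ne_zero_iff hρ hβ hA).1 (left_ne_zero_of_mul hne)
    obtain ⟨j, hj, hj'⟩ := (coeff_psym_ne_zero_iff hρ hβ hB).1 (right_ne_zero_of_mul hne)
    push_cast at hi' hj'
    have h1 : i + j = 1 := mul_left_cancel₀ hρ.ne' (by linarith)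
    have h2 : 0 < i := pos_of_mul_pos_right (by linarith : 0 < ρ * i) hρ.le
    have h3 : 0 < j := pos_of_mul_pos_right (by linarith : 0 < ρ * j) hρ.le
    omega
  have k1 := key hM hN (by omega) hQ hP
  have k2 := key hN hM hNM hP hQ
  have hd : ∀ p : K[X], (derivative p).coeff 0 = p.coeff 1 := by
    intro p
    simp [coeff_derivative]
  simp only [pois, coeff_sub, coeff_smul, mul_coeff_zero, hd, coeff_one_zero] at h0
  rw [k1, mul_comm, k2] at h0
  simp at h0
  exact hρ.ne' (by exact_mod_cast h0)

section

variable [IsAlgClosed K]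

/-- Going down along the edges from a vertex above the diagonal, one meets an edge that crosses the
diagonal. -/
theorem exists_crossing_edge {P Q : WeylAlgebra K} (hQP : Q * P - P * Q = 1) {m n : ℕ} (hm : 0 < m)
    (hn : 0 < n) (hmn : m.Coprime n) (b₀ : ℕ) (α₀ β₀ a₀ : ℤ) (hα₀ : 0 < α₀) (hβ₀ : 0 < β₀)
    (hle : β₀ ≤ α₀) (ha₀ : a₀ < 0) (hP : IsVertex α₀ β₀ (m * a₀) (m * b₀) (emb K 1 one_pos P))
    (hQ : IsVertex α₀ β₀ (n * a₀) (n * b₀) (emb K 1 one_pos Q)) :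
    ∃ (ρ σ κ : ℤ) (r : K[X]) (u a : ℕ), 0 < ρ ∧ σ < 0 ∧ 0 < ρ + σ ∧ IsCoprime ρ σ ∧ 0 < κ ∧
      deg (ρ, σ) P = ((m * κ : ℤ) : WithBot ℤ) ∧ deg (ρ, σ) Q = ((n * κ : ℤ) : WithBot ℤ) ∧
      ρ + σ < (m + n) * κ ∧ CommonEdge P Q m n ρ σ κ r u a ∧ u < r.natDegree ∧
      rootMultiplicity 0 r < r.natDegree ∧ rootMultiplicity 0 r < a := by
  induction b₀ using Nat.strong_induction_on generalizing α₀ β₀ a₀ with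
  | _ b₀ ih =>
    have hQP' : emb K 1 one_pos Q * emb K 1 one_pos P - emb K 1 one_pos P * emb K 1 one_pos Q
        = 1 := by
      rw [← map_mul, ← map_mul, ← map_sub, hQP, map_one]
    obtain ⟨ρ, β, κ, hρ, hβ, hcop, hlt, hκ, hκ0, hβκ, hPf, hQf, hPd, hQd, hlow⟩ :=
      exists_next_edge hQP' hα₀ hβ₀ hm hn ha₀ hP hQ
    obtain ⟨σ, rfl⟩ : ∃ σ, β = ρ + σ := ⟨β - ρ, by ring⟩
    -- Edges turn during the descent: `(ρ + σ) / ρ < β₀ / α₀ ≤ 1`.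
    have hσ : σ < 0 := by
      by_contra! h
      nlinarith
    have hb₀ : 0 < b₀ := by
      rcases Nat.eq_zero_or_pos b₀ with rfl | h
      · exfalso
        rw [hκ] at hκ0
        push_cast at hκ0
        nlinarith
      · exact h
    have hPdeg : deg (ρ, σ) P = ((m * κ : ℤ) : WithBot ℤ) :=
      deg_eq_of_psym_ne_zero hρ hβ hPf fun h0 => by
        rw [psym] at h0
        rw [h0, natDegree_zero] at hPd
        have := Nat.mul_pos hm hb₀
        omega
    have hQdeg : deg (ρ, σ) Q = ((n * κ : ℤ) : WithBot ℤ) :=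
      deg_eq_of_psym_ne_zero hρ hβ hQf fun h0 => by
        rw [psym] at h0
        rw [h0, natDegree_zero] at hQd
        have := Nat.mul_pos hn hb₀
        omega
    have hm' : (0 : ℤ) < m := by exact_mod_cast hm
    have hn' : (0 : ℤ) < n := by exact_mod_cast hn
    have hne := add_ne_of_comm hQP hρ hσ hβ (mul_pos hm' hκ0) (mul_pos hn' hκ0) hPdeg hQdeg
    have hβlt : ρ + σ < (m + n) * κ := lt_of_le_of_ne hβκ fun h => hne (by rw [h]; ring)
    obtain ⟨r, u, a, hedge⟩ := exists_commonEdge hQP hm hn hmn hρ hβ hκ0 hPdeg hQdeg hβlt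
    obtain ⟨c, hc, hpr⟩ := hedge.left
    obtain ⟨d, hd, hqr⟩ := hedge.right
    have hrb : r.natDegree = b₀ := by
      change (psym ρ σ (m * κ) P).natDegree = m * b₀ at hPd
      rw [hpr, natDegree_C_mul hc, natDegree_pow] at hPd
      exact Nat.eq_of_mul_eq_mul_left hm hPd
    have htb : rootMultiplicity 0 r < r.natDegree := by
      rw [hrb]
      rcases hlow with ⟨j, hj, hj0⟩ | ⟨j, hj, hj0⟩
      · have := rootMultiplicity_zero_le hj0
        change rootMultiplicity 0 (psym ρ σ (m * κ) P) ≤ j at this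
        rw [hpr, rootMultiplicity_C_mul_pow hc] at this
        exact lt_of_mul_lt_mul_left (this.trans_lt hj) (Nat.zero_le _)
      · have := rootMultiplicity_zero_le hj0
        change rootMultiplicity 0 (psym ρ σ (n * κ) Q) ≤ j at this
        rw [hqr, rootMultiplicity_C_mul_pow hd] at this
        exact lt_of_mul_lt_mul_left (this.trans_lt hj) (Nat.zero_le _)
    have hu : u < r.natDegree := by
      have h1 := hedge.en_deg
      rw [hrb, hκ] at h1
      have h2 : (u : ℤ) = a₀ + b₀ := mul_left_cancel₀ hρ.ne' (by linarith)
      zify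
      rw [hrb, h2]
      linarith
    rcases lt_trichotomy a (rootMultiplicity 0 r) with hlt' | heq | hgt
    -- The lower end is still above the diagonal and strictly lower, so the descent continues from
    -- it.
    · refine ih (rootMultiplicity 0 r) (hrb ▸ htb) ρ (ρ + σ) (a - rootMultiplicity 0 r) hρ hβ
        (by linarith) (by zify at hlt'; linarith) (hedge.isVertex_left hρ hPf)
        (hedge.isVertex_right hρ hQf)
    -- A lower end on the diagonal gives `κ = (ρ + σ) t` with `t` the multiplicity of the root `0`.
    -- The factor in `sub_mul_eval_derivative_of_pois` then vanishes, but its right-hand side does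
    -- not.
    · exfalso
      obtain ⟨f, hf, -⟩ := hedge.exists_fixing hQP hm hρ hβ hκ0 hPdeg (by omega)
      rw [hpr] at hf
      have hf' := pois_root hm hc hedge.ne_zero hf
      have h1 := hedge.st_deg
      rw [heq] at h1
      have ht : rootMultiplicity 0 r ≠ 0 := by
        intro h0
        rw [h0] at h1
        simp at h1
        omega
      have hr0 : r.eval 0 = 0 := by
        by_contra h0
        exact ht (rootMultiplicity_eq_zero h0)
      have h2 := sub_mul_eval_derivative_of_pois hedge.ne_zero hf'
        (eval_eq_zero_of_pois hβ hedge.ne_zero hf' hr0)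
      have h3 : (((ρ + σ : ℤ) : K) * rootMultiplicity 0 r - κ) = 0 := by
        rw [← h1]
        push_cast
        ring
      rw [h3, zero_mul, eq_comm, div_eq_zero_iff] at h2
      rcases h2 with h2 | h2
      · exact hρ.ne' (by exact_mod_cast h2)
      · exact hm.ne' (by exact_mod_cast h2)
    · have hcop' : IsCoprime ρ σ := by
        obtain ⟨x, y, hxy⟩ := hcop
        exact ⟨x + y, y, by linear_combination hxy⟩
      exact ⟨ρ, σ, κ, r, u, a, hρ, hσ, hβ,
        hcop', hκ0, hPdeg, hQdeg, hβlt, hedge, hu, htb, hgt⟩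

/-- Minimality makes `m` and `n` at least `2`. The `(1, 1)`-leading forms commute, so the heights of
the corners are in the ratio `m : n`, as are the total degrees; hence so are the abscissas. -/
theorem IsStandardMinimalPair.exists_shape {P Q : WeylAlgebra K} (h : IsStandardMinimalPair P Q)
    {m n : ℕ} (hm : 0 < m) (hn : 0 < n) (hmn : m.Coprime n)
    (hratio : (m : ℚ) / n = (degInt (1, 1) P : ℚ) / degInt (1, 1) Q) :
    2 ≤ m ∧ 2 ≤ n ∧ ∃ a₁ : ℕ, 0 < a₁ ∧ deg (1, 0) P = ((m * a₁ : ℤ) : WithBot ℤ) ∧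
      deg (1, 0) Q = ((n * a₁ : ℤ) : WithBot ℤ) := by
  have hQP := h.minimal.1.comm
  obtain ⟨a, b, ha, hb, hP, hP', hPd⟩ := h.subrectangular_left.exists_deg
  obtain ⟨a', b', ha', hb', hQ, hQ', hQd⟩ := h.subrectangular_right.exists_deg
  rw [degInt_eq hP, degInt_eq hQ, div_eq_div_iff (by exact_mod_cast hn.ne')
    (by push_cast; positivity)] at hratio
  have hr : m * (a' + b') = (a + b) * n := by exact_mod_cast hratio
  obtain ⟨g, hg1, hg2⟩ := exists_eq_mul_of_mul_eq (a := ((a + b : ℕ) : ℤ))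
    (b := ((a' + b' : ℕ) : ℤ)) hm hmn (by exact_mod_cast (mul_comm n (a + b)).trans hr.symm)
  have hg0 : 0 ≤ g := by
    by_contra! hlt
    have : (0 : ℤ) < m := by exact_mod_cast hm
    push_cast at hg1
    nlinarith
  lift g to ℕ using hg0
  have hg1' : a + b = m * g := by exact_mod_cast hg1
  have hg2' : a' + b' = n * g := by exact_mod_cast hg2
  have h2 := h.minimal.two_le hmn hm hn (hg1' ▸ hP) (hg2' ▸ hQ) (by omega) (by omega)
  refine ⟨h2.1, h2.2, ?_⟩
  have hpois := pois_eq_zero_of_lt (by norm_num)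
    (by rw [← map_mul, ← map_mul, ← map_sub, hQP, map_one])
    (emb_mem_fil_of_deg (by norm_num) hP) (emb_mem_fil_of_deg (by norm_num) hQ)
    (by push_cast; omega)
  have hdeg := mul_natDegree_eq_of_pois_eq_zero (psym_ne_zero one_pos (by norm_num) hP)
    (psym_ne_zero one_pos (by norm_num) hQ) hpois
  rw [hPd, hQd] at hdeg
  have hb1 : (a' + b') * b = (a + b) * b' := by exact_mod_cast hdeg
  have hg : 0 < g := by
    rcases Nat.eq_zero_or_pos g with rfl | h
    · omega
    · exact h
  have hnb : n * b = m * b' := by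
    rw [hg1', hg2'] at hb1
    exact Nat.eq_of_mul_eq_mul_left hg (by linarith)
  have hna : n * a = m * a' := by nlinarith
  obtain ⟨a₁, h1, h2⟩ := exists_eq_mul_of_mul_eq (a := (a : ℤ)) (b := (a' : ℤ)) hm hmn
    (by exact_mod_cast hna)
  have hm' : (0 : ℤ) < m := by exact_mod_cast hm
  have ha₁ : 0 < a₁ := pos_of_mul_pos_right (by rw [← h1]; exact_mod_cast ha : 0 < (m : ℤ) * a₁) hm'.le
  lift a₁ to ℕ using ha₁.le
  exact ⟨a₁, by exact_mod_cast ha₁, by rw [hP', h1], by rw [hQ', h2]⟩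

theorem IsStandardMinimalPair.exists_isCuttingDirection {P Q : WeylAlgebra K}
    (h : IsStandardMinimalPair P Q) {m n : ℕ} (hm : 0 < m) (hn : 0 < n) (hmn : m.Coprime n)
    (hratio : (m : ℚ) / n = (degInt (1, 1) P : ℚ) / degInt (1, 1) Q) :
    ∃ d, IsCuttingDirection P Q d := by
  have hQP := h.minimal.1.comm
  obtain ⟨hm2, hn2, a₁, ha₁, hP, hQ⟩ := h.exists_shape hm hn hmn hratio
  have ha₁' : (0 : ℤ) < a₁ := by exact_mod_cast ha₁
  have hm2' : (2 : ℤ) ≤ m := by exact_mod_cast hm2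
  have hn2' : (2 : ℤ) ≤ n := by exact_mod_cast hn2
  -- The strict inequality needed here is `1 < (m + n) a₁`. The lower end of this `(1, 0)`-edge lies
  -- above the diagonal by standardness and starts the descent.
  obtain ⟨r₁, u₁, a₂, h₁⟩ := exists_commonEdge hQP hm hn hmn one_pos (by norm_num) ha₁' hP hQ
    (by nlinarith)
  have hst := h.st_left
  rw [h₁.st_left] at hst
  simp only [pointDeg, Int.cast_id] at hst
  have hlt : (a₂ : ℤ) - rootMultiplicity 0 r₁ < 0 := by
    by_contra! hge
    nlinarith
  obtain ⟨ρ, σ, κ, r, u, a, hρ, hσ, hβ, hcop, hκ, hPd, hQd, hβκ, he, hu, ht, hta⟩ :=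
    exists_crossing_edge hQP hm hn hmn (rootMultiplicity 0 r₁) 1 (1 + 0) _ one_pos (by norm_num)
      (by norm_num) hlt (h₁.isVertex_left one_pos (emb_mem_fil_of_deg (by norm_num) hP))
      (h₁.isVertex_right one_pos (emb_mem_fil_of_deg (by norm_num) hQ))
  have hdir : (ρ, σ) ∈ directions := ⟨Int.isCoprime_iff_gcd_eq_one.1 hcop, hβ⟩
  have hm0 : (m : ℚ) ≠ 0 := by exact_mod_cast hm.ne'
  have hn0 : (n : ℚ) ≠ 0 := by exact_mod_cast hn.ne'
  have hκ0 : (κ : ℚ) ≠ 0 := by exact_mod_cast hκ.ne'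
  refine ⟨(ρ, σ), he.mem_Dir_left ht hdir, he.mem_Dir_right ht hdir, hσ, ?_, ?_, ?_, ?_, ?_, ?_,
    ?_, ?_⟩
  · rw [hPd]
    exact_mod_cast (by positivity : 0 < (m : ℤ) * κ)
  · rw [hQd]
    exact_mod_cast (by positivity : 0 < (n : ℤ) * κ)
  · rw [bracket_eq_zero_iff hQP, isProportional_iff hρ hβ hQP hPd hQd]
    linarith
  · rw [degInt_eq hPd, degInt_eq hQd, ← hratio]
    push_cast
    exact mul_div_mul_right _ _ hκ0
  · intro k hk
    rw [degInt_eq hPd, degInt_eq hQd] at hk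
    push_cast at hk
    rw [mul_div_mul_right _ _ hκ0, div_eq_iff hm0] at hk
    have hk' : n = k * m := by exact_mod_cast hk
    have := Nat.Coprime.eq_one_of_dvd hmn (Dvd.intro_left k hk'.symm)
    omega
  · intro k hk
    rw [degInt_eq hPd, degInt_eq hQd] at hk
    push_cast at hk
    rw [mul_div_mul_right _ _ hκ0, div_eq_iff hn0] at hk
    have hk' : m = k * n := by exact_mod_cast hk
    have := Nat.Coprime.eq_one_of_dvd hmn.symm (Dvd.intro_left k hk'.symm)
    omega
  · rw [he.st_left]
    simp only [pointDeg, Int.cast_id]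
    zify at hta
    nlinarith
  · rw [he.en_left]
    simp only [pointDeg, Int.cast_id]
    zify at hu
    nlinarith

end

end

section

open Polynomial

variable {K : Type*} [Field K]

/-! ### Leading terms and homogeneous elements -/

theorem isHomog_of_forall {d : ℤ × ℤ} {F : WeylAlgebra K} {N : ℤ}
    (h : deg d F = (N : WithBot ℤ)) (hF : ∀ p ∈ supp F, pointDeg d p = N) :
    symbol F = lead d F := by
  ext e
  rw [lead, coeff_leadL h]
  split_ifs with h1
  · rfl
  · by_contra h2
    exact h1 (hF _ (mem_suppL.2 ⟨e, h2, rfl⟩))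

theorem edge_eq_aeval_lead {d : ℤ × ℤ} {P : WeylAlgebra K} {N : ℤ}
    (h : deg d P = (N : WithBot ℤ)) :
    edge d N P = MvPolynomial.aeval ![(1 : K[X]), X] (lead d P) := by
  rw [lead, leadL, map_sum, edge, Finset.sum_filter]
  refine Finset.sum_congr rfl fun e he => ?_
  have h' : degL d (symbol P) = (N : WithBot ℤ) := h
  simp only [h', WithBot.coe_inj]
  split_ifs
  · rw [MvPolynomial.aeval_monomial, Finsupp.prod_fintype _ _ (by simp)]
    simp [Fin.prod_univ_two]
  · rfl

/-- Homogeneous elements with a prescribed leading form. -/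
theorem exists_symbol_eq (f : K[X]) (i : ℕ → ℕ) :
    ∃ F : WeylAlgebra K, MvPolynomial.aeval ![(1 : K[X]), X] (symbol F) = f ∧
      ∀ p ∈ supp F, ∃ j : ℕ, f.coeff j ≠ 0 ∧ p = ((i j : ℤ), (j : ℤ)) := by
  classical
  obtain ⟨F, hF⟩ := (symbol_bijective (K := K)).2 (∑ j ∈ f.support,
    MvPolynomial.monomial (Finsupp.single 0 (i j) + Finsupp.single 1 j) (f.coeff j))
  refine ⟨F, ?_, fun p hp => ?_⟩
  · rw [hF, map_sum]
    conv_rhs => rw [f.as_sum_support_C_mul_X_pow]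
    refine Finset.sum_congr rfl fun j _ => ?_
    rw [MvPolynomial.aeval_monomial, Finsupp.prod_fintype _ _ (by simp)]
    simp [Fin.prod_univ_two]
  · obtain ⟨e, he, rfl⟩ := mem_suppL.1 hp
    rw [hF, MvPolynomial.coeff_sum] at he
    obtain ⟨j, hj, hj'⟩ := Finset.exists_ne_zero_of_sum_ne_zero he
    rw [MvPolynomial.coeff_monomial] at hj'
    split_ifs at hj' with h1
    · refine ⟨j, hj', ?_⟩
      rw [← h1]
      simp [expPoint]
    · exact absurd rfl hj'

section

variable [CharZero K] {ρ σ N : ℤ} {P F : WeylAlgebra K}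

theorem psym_eq_aeval_lead (hβ : 0 < ρ + σ) (h : deg (ρ, σ) P = (N : WithBot ℤ)) :
    psym ρ σ N P = MvPolynomial.aeval ![(1 : K[X]), X] (lead (ρ, σ) P) := by
  rw [(emb_one_mem_fil hβ (deg_eq_coe_iff.1 h).2).2, edge_eq_aeval_lead h]

/-- For `ρ ≠ 0` the degree and the exponent of `y` determine that of `x`, so setting `x = 1` is
injective on forms of one degree. -/
theorem lead_eq_of_psym_eq (hρ : 0 < ρ) (hβ : 0 < ρ + σ) {R : WeylAlgebra K}
    (hP : deg (ρ, σ) P = (N : WithBot ℤ)) (hR : deg (ρ, σ) R = (N : WithBot ℤ))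
    (h : psym ρ σ N P = psym ρ σ N R) : lead (ρ, σ) P = lead (ρ, σ) R := by
  have hle : ∀ p ∈ supp (P - R), pointDeg (ρ, σ) p ≤ N := by
    intro p hp
    obtain ⟨e, he, rfl⟩ := mem_suppL.1 hp
    by_contra hlt
    have h1 : (symbol P).coeff e = 0 := by
      by_contra h0
      exact hlt ((deg_eq_coe_iff.1 hP).2 _ (mem_suppL.2 ⟨e, h0, rfl⟩))
    have h2 : (symbol R).coeff e = 0 := by
      by_contra h0
      exact hlt ((deg_eq_coe_iff.1 hR).2 _ (mem_suppL.2 ⟨e, h0, rfl⟩))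
    exact he (by rw [map_sub, MvPolynomial.coeff_sub, h1, h2, sub_zero])
  have h0 : edge (ρ, σ) N (P - R) = 0 := by
    rw [← (emb_one_mem_fil hβ hle).2, psym, map_sub, map_sub]
    exact sub_eq_zero.2 h
  ext e
  rw [lead, lead, coeff_leadL hP, coeff_leadL hR]
  split_ifs with h1
  · by_contra hne
    have := (coeff_edge_ne_zero_iff (d := (ρ, σ)) hρ.ne' (N := N) (P := P - R) (j := e 1)).2
      ⟨e 0, mem_suppL.2 ⟨e, by rwa [map_sub, MvPolynomial.coeff_sub, sub_ne_zero], rfl⟩, h1⟩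
    rw [h0] at this
    exact this (coeff_zero _)
  · rfl

theorem isBracketFixing_of_psym (hρ : 0 < ρ) (hβ : 0 < ρ + σ)
    (hP : deg (ρ, σ) P = (N : WithBot ℤ)) (hF : IsHomog (ρ, σ) F)
    (hFd : deg (ρ, σ) F = ((ρ + σ : ℤ) : WithBot ℤ))
    (h : pois N (ρ + σ) (psym ρ σ N P) (psym ρ σ (ρ + σ) F) = C (ρ : K) * psym ρ σ N P) :
    IsBracketFixing (ρ, σ) P F := by
  have hc := fil_comm hβ (emb_mem_fil_of_deg hβ hP) (emb_mem_fil_of_deg hβ hFd)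
  rw [add_sub_cancel_right, ← map_mul, ← map_mul, ← map_sub] at hc
  have hs : psym ρ σ N (P * F - F * P) = psym ρ σ N P := by
    have h1 := hc.2.trans h
    rw [← smul_eq_C_mul] at h1
    exact smul_right_injective _ (by exact_mod_cast hρ.ne' : (ρ : K) ≠ 0) h1
  have hR : deg (ρ, σ) (P * F - F * P) = (N : WithBot ℤ) :=
    deg_eq_of_psym_ne_zero hρ hβ hc.1 (by rw [hs]; exact psym_ne_zero hρ hβ hP)
  refine ⟨hF, ?_, hFd⟩
  rw [bracket, if_neg]
  · exact lead_eq_of_psym_eq hρ hβ hR hP hs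
  · rw [IsProportional, hR, hP, hFd]
    exact lt_irrefl _

/-- A nonzero bracket means that `[P, F]` attains the expected degree, here that of `P` itself since
`F` has degree `ρ + σ`. Its leading form is then given by the Poisson bracket. -/
theorem IsBracketFixing.pois_eq (hρ : 0 < ρ) (hβ : 0 < ρ + σ)
    (hP : deg (ρ, σ) P = (N : WithBot ℤ)) (h : IsBracketFixing (ρ, σ) P F) :
    pois N (ρ + σ) (psym ρ σ N P) (psym ρ σ (ρ + σ) F) = C (ρ : K) * psym ρ σ N P := by
  have hFd := h.deg_eq
  simp only at hFd
  have hP0 : P ≠ 0 := by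
    rintro rfl
    exact WithBot.bot_ne_coe ((deg_zero _).symm.trans hP)
  have hb := h.bracket_eq
  rw [bracket] at hb
  split_ifs at hb with hprop
  · exact absurd hb.symm (lead_ne_zero hP0)
  rw [IsProportional, hP, hFd] at hprop
  have hR0 : P * F - F * P ≠ 0 := by
    intro h0
    apply hprop
    rw [h0, deg_zero, WithBot.bot_add]
    exact WithBot.bot_lt_coe _
  obtain ⟨M, hM⟩ := exists_deg_eq (ρ, σ) hR0
  have hc := fil_comm hβ (emb_mem_fil_of_deg hβ hP) (emb_mem_fil_of_deg hβ hFd)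
  rw [add_sub_cancel_right, ← map_mul, ← map_mul, ← map_sub] at hc
  have hMN : M = N := by
    refine le_antisymm (deg_le_of_mem_fil hρ hβ hc.1 hM) ?_
    rw [hM] at hprop
    by_contra! hlt
    apply hprop
    exact_mod_cast (by linarith : M + (ρ + σ) < N + (ρ + σ))
  subst hMN
  refine hc.2.symm.trans ?_
  rw [smul_eq_C_mul]
  congr 1
  change psym ρ σ M (P * F - F * P) = _
  rw [psym_eq_aeval_lead hβ hM, psym_eq_aeval_lead hβ hP, hb]

/-- A polynomial whose exponents are `1` modulo `ρ` is the leading form of a homogeneous element of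
degree `ρ + σ`. -/
theorem exists_isHomog (hρ : 2 ≤ ρ) (hσ : σ < 0) (hβ : 0 < ρ + σ) (hcop : IsCoprime ρ σ)
    {f : K[X]} (hf : f ≠ 0) (hcl : ExpClass ρ (ρ + σ) (ρ + σ) f) :
    ∃ F : WeylAlgebra K, IsHomog (ρ, σ) F ∧ deg (ρ, σ) F = ((ρ + σ : ℤ) : WithBot ℤ) ∧
      psym ρ σ (ρ + σ) F = f := by
  -- Realizing `f` in `A₁` requires nonnegative exponents of `x`. As `ρ ≥ 2`, the exponents `j = 1 -
  -- ρ y` satisfy `j ≥ 1`, so `y ≤ 0`, and the exponent of `x` is `1 + σ y ≥ 1`.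
  have hdiv : ∀ j : ℕ, f.coeff j ≠ 0 →
      ρ * (((ρ + σ - σ * j) / ρ).toNat : ℤ) + σ * j = ρ + σ := by
    intro j hj
    have h1 : ρ ∣ ρ + σ - (ρ + σ) * j := hcl j hj
    have h2 : ρ ∣ σ * (1 - j) := by
      obtain ⟨x, hx⟩ := h1
      exact ⟨x - 1 + j, by linear_combination hx⟩
    have h3 : ρ ∣ 1 - (j : ℤ) := hcop.dvd_of_dvd_mul_left h2
    have hj1 : 1 ≤ j := by
      rw [Nat.one_le_iff_ne_zero]
      rintro rfl
      have := Int.le_of_dvd (by norm_num) h3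
      norm_num at this
      omega
    obtain ⟨y, hy⟩ := h3
    have e : ρ + σ - σ * j = ρ * (1 + σ * y) := by linear_combination σ * hy
    have hj1' : (1 : ℤ) ≤ j := by exact_mod_cast hj1
    have hy0 : y ≤ 0 := by
      by_contra! hlt
      nlinarith
    rw [e, Int.mul_ediv_cancel_left _ (by omega), Int.toNat_of_nonneg (by nlinarith)]
    linear_combination -e
  obtain ⟨F, hF, hsupp⟩ := exists_symbol_eq f fun j => ((ρ + σ - σ * j) / ρ).toNat
  have hall : ∀ p ∈ supp F, pointDeg (ρ, σ) p = ρ + σ := by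
    intro p hp
    obtain ⟨j, hj, rfl⟩ := hsupp p hp
    exact hdiv j hj
  have hF0 : F ≠ 0 := by
    rintro rfl
    rw [map_zero, map_zero] at hF
    exact hf hF.symm
  obtain ⟨p, hp⟩ := supp_nonempty hF0
  have hd : deg (ρ, σ) F = ((ρ + σ : ℤ) : WithBot ℤ) :=
    deg_eq_coe_iff.2 ⟨⟨p, hp, hall p hp⟩, fun q hq => (hall q hq).le⟩
  have hh := isHomog_of_forall hd hall
  exact ⟨F, Or.inr hh, hd, by rw [psym_eq_aeval_lead hβ hd, ← hh, hF]⟩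

end

end

section

open Polynomial

variable {K : Type*} [Field K]

/-! ### The last corner of a cutting edge -/

theorem coeff_comp_shift {p : K[X]} (hp : p ≠ 0) {l : K} (hl : l ≠ 0) (z : K) :
    ((p.comp (C l⁻¹ * X)).comp (X + C (l * z))).coeff (rootMultiplicity z p) ≠ 0 ∧
      ∀ j < rootMultiplicity z p,
        ((p.comp (C l⁻¹ * X)).comp (X + C (l * z))).coeff j = 0 := by
  obtain ⟨q, hq, hq0⟩ := exists_eq_pow_mul_eval_ne_zero hp z
  generalize rootMultiplicity z p = s at hq ⊢
  have e : (p.comp (C l⁻¹ * X)).comp (X + C (l * z))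
      = X ^ s * (C (l⁻¹ ^ s) * q.comp (C l⁻¹ * X + C z)) := by
    have h1 : (C l⁻¹ * X : K[X]).comp (X + C (l * z)) = C l⁻¹ * X + C z := by
      rw [mul_comp, C_comp, X_comp, mul_add, ← C_mul, inv_mul_cancel_left₀ hl]
    rw [comp_assoc, h1, hq, mul_comp, pow_comp, sub_comp, X_comp, C_comp, add_sub_cancel_right,
      mul_pow, C_pow]
    ring
  rw [e]
  constructor
  · rw [coeff_X_pow_mul', if_pos le_rfl, Nat.sub_self, coeff_C_mul, coeff_zero_eq_eval_zero,
      eval_comp]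
    refine mul_ne_zero (pow_ne_zero _ (inv_ne_zero hl)) ?_
    simpa using hq0
  · intro j hj
    rw [coeff_X_pow_mul', if_neg (by omega)]

section

variable [CharZero K]

theorem isVertex_shear {l k : ℕ} (hl : 0 < l) (hk : 0 < k) {ρ σ : ℤ} (hρ : ρ = l)
    (hβ : ρ + σ = k) {m γ : ℕ} {κ : ℤ} (hκ : κ = k * γ - 1) {P : WeylAlgebra K}
    (hP : deg (ρ, σ) P = ((m * κ : ℤ) : WithBot ℤ)) {z : K}
    (hz : rootMultiplicity z (psym ρ σ (m * κ) P) = m * γ) :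
    IsVertex 1 k (m * (-1)) (m * γ) (shear k (l * z) (emb K l hl P)) := by
  have hk' : (0 : ℤ) < k := by exact_mod_cast hk
  have hle := (deg_eq_coe_iff.1 hP).2
  have h1 := emb_mem_fil (α := 1) (β := k) hl hk' (d := (ρ, σ)) (by simp [hρ]) hβ hle
  have h2 := shear_mem_fil hk' (l * z) h1.1
  rw [h1.2, ← (emb_one_mem_fil (by omega) hle).2] at h2
  have h3 := coeff_comp_shift (psym_ne_zero (by omega) (by omega) hP)
    (l := (l : K)) (by exact_mod_cast hl.ne') z
  rw [← h2.2, hz] at h3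
  refine isVertex_of_sym one_ne_zero h2.1 ?_ h3.1 h3.2
  rw [hκ]
  push_cast
  ring

section

variable [IsAlgClosed K]

/-- Under `X ↦ w^ρ` the element `w` gets weight `1`, and the root `z` becomes `ρ z`. Shearing it to
`0` produces a lowest exponent `m γ`, and the condition on `κ` says that the corresponding exponent
of `w` is `-m`; likewise for `n`. -/
theorem CommonEdge.false_of_corner {P Q : WeylAlgebra K} (hQP : Q * P - P * Q = 1) {m n : ℕ}
    (hm : 0 < m) (hn : 0 < n) (hmn : m.Coprime n) {ρ σ κ : ℤ} (hρ : 0 < ρ) (hβ : 0 < ρ + σ)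
    {r : K[X]} {u a : ℕ} (he : CommonEdge P Q m n ρ σ κ r u a)
    (hP : deg (ρ, σ) P = ((m * κ : ℤ) : WithBot ℤ))
    (hQ : deg (ρ, σ) Q = ((n * κ : ℤ) : WithBot ℤ)) {z : K} (hγ : 2 ≤ rootMultiplicity z r)
    (hκ : κ = (ρ + σ) * rootMultiplicity z r - 1) : False := by
  obtain ⟨c, hc, hpr⟩ := he.left
  obtain ⟨d, hd, hqr⟩ := he.right
  obtain ⟨k, hk⟩ := Int.eq_ofNat_of_zero_le hβ.le
  lift ρ to ℕ using hρ.le with l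
  have hl : 0 < l := by exact_mod_cast hρ
  have hk0 : 0 < k := by omega
  rw [hk] at hκ
  refine no_pair_with_vertex hm hn hmn hγ k hk0 (shear k (l * z) (emb K l hl P))
    (shear k (l * z) (emb K l hl Q)) ?_ (isVertex_shear hl hk0 rfl hk hκ hP ?_)
    (isVertex_shear hl hk0 rfl hk hκ hQ ?_)
  · simp only [← map_mul, ← map_sub]
    rw [hQP, map_one, map_one]
  · rw [hpr, rootMultiplicity_C_mul_pow hc]
  · rw [hqr, rootMultiplicity_C_mul_pow hd]

theorem IsCuttingDirection.exists_commonEdge {P Q : WeylAlgebra K} (hPQ : IsCounterexample P Q)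
    {m n : ℕ} (hm : 0 < m) (hn : 0 < n) (hmn : m.Coprime n)
    (hratio : (m : ℚ) / n = (degInt (1, 1) P : ℚ) / degInt (1, 1) Q) {ρ σ : ℤ}
    (h : IsCuttingDirection P Q (ρ, σ)) :
    2 ≤ ρ ∧ σ < 0 ∧ 0 < ρ + σ ∧ IsCoprime ρ σ ∧ ∃ (κ : ℤ) (r : K[X]) (u a : ℕ), 0 < κ ∧
      deg (ρ, σ) P = ((m * κ : ℤ) : WithBot ℤ) ∧ deg (ρ, σ) Q = ((n * κ : ℤ) : WithBot ℤ) ∧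
      CommonEdge P Q m n ρ σ κ r u a ∧ u < r.natDegree ∧
      rootMultiplicity 0 r < r.natDegree ∧ rootMultiplicity 0 r < a := by
  have hQP := hPQ.comm
  have hσ : σ < 0 := h.sigma_neg
  have hβ : 0 < ρ + σ := h.mem_left.1.2
  have hcop : IsCoprime ρ σ := Int.isCoprime_iff_gcd_eq_one.2 h.mem_left.1.1
  have hρ : 0 < ρ := by omega
  refine ⟨by omega, hσ, hβ, hcop, ?_⟩
  obtain ⟨N, hN⟩ := exists_deg_eq (ρ, σ) hPQ.ne_zero.1
  obtain ⟨M, hM⟩ := exists_deg_eq (ρ, σ) hPQ.ne_zero.2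
  have hN0 : 0 < N := by
    have := h.deg_left_pos
    rw [hN] at this
    exact_mod_cast this
  have hM0 : 0 < M := by
    have := h.deg_right_pos
    rw [hM] at this
    exact_mod_cast this
  have hr := h.ratio
  rw [← hratio, degInt_eq hN, degInt_eq hM, div_eq_div_iff (by exact_mod_cast hM0.ne')
    (by exact_mod_cast hn.ne')] at hr
  have hr' : N * n = m * M := by exact_mod_cast hr
  obtain ⟨κ, rfl, rfl⟩ := exists_eq_mul_of_mul_eq hm hmn (by rw [mul_comm, hr'])
  have hm' : (0 : ℤ) < m := by exact_mod_cast hm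
  have hκ : 0 < κ := pos_of_mul_pos_right hN0 hm'.le
  have hlt := (isProportional_iff hρ hβ hQP hN hM).1
    ((bracket_eq_zero_iff hQP).1 h.bracket_eq_zero)
  obtain ⟨r, u, a, he⟩ := Dixmier.exists_commonEdge hQP hm hn hmn hρ hβ hκ hN hM (by linarith)
  have hst := h.st_pos
  have hen := h.en_neg
  rw [he.st_left] at hst
  rw [he.en_left] at hen
  simp only [pointDeg, Int.cast_id] at hst hen
  refine ⟨κ, r, u, a, hκ, hN, hM, he, ?_, he.lt_of_mem_Dir h.mem_left, ?_⟩
  · zify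
    nlinarith
  · zify
    nlinarith

theorem CommonEdge.exists_isBracketFixing {P Q : WeylAlgebra K} (hQP : Q * P - P * Q = 1)
    {m n : ℕ} (hm : 0 < m) {ρ σ κ : ℤ} (hρ : 2 ≤ ρ) (hσ : σ < 0) (hβ : 0 < ρ + σ)
    (hcop : IsCoprime ρ σ) (hκ : 0 < κ) (hP : deg (ρ, σ) P = ((m * κ : ℤ) : WithBot ℤ)) {r : K[X]}
    {u a : ℕ} (h : CommonEdge P Q m n ρ σ κ r u a) (hr : 0 < r.natDegree) :
    ∃ F, IsBracketFixing (ρ, σ) P F := by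
  have hρ0 : 0 < ρ := by omega
  obtain ⟨f, hf, hcl⟩ := h.exists_fixing hQP hm hρ0 hβ hκ hP hr
  have hf0 : f ≠ 0 := by
    rintro rfl
    simp only [pois, derivative_zero, mul_zero, smul_zero, sub_zero] at hf
    refine mul_ne_zero (C_ne_zero.2 (by exact_mod_cast hρ0.ne')) (psym_ne_zero hρ0 hβ hP) hf.symm
  obtain ⟨F, hF, hFd, rfl⟩ := exists_isHomog hρ hσ hβ hcop hf0 hcl
  exact ⟨F, isBracketFixing_of_psym hρ0 hβ hP hF hFd hf⟩

end

/-- The shape of a solution `f` of `pois κ (ρ + σ) r f = c r`, with its end point. -/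
theorem natDegree_psym_of_pois [IsAlgClosed K] {ρ σ κ : ℤ} (hρ : 2 ≤ ρ) (hβ : 0 < ρ + σ)
    (hcop : IsCoprime ρ σ) {F : WeylAlgebra K}
    (hF : deg (ρ, σ) F = ((ρ + σ : ℤ) : WithBot ℤ)) {r : K[X]}
    (hlt : rootMultiplicity 0 r < r.natDegree) {c : K} (hc : c ≠ 0)
    (h : pois κ (ρ + σ) r (psym ρ σ (ρ + σ) F) = C c * r) :
    2 ≤ (psym ρ σ (ρ + σ) F).natDegree ∧
      (ρ + σ) * r.natDegree = κ * (psym ρ σ (ρ + σ) F).natDegree ∧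
      ∀ j, (psym ρ σ (ρ + σ) F).coeff j ≠ 0 → ρ ∣ j - 1 := by
  have hρ0 : 0 < ρ := by omega
  have hcl : ∀ j, (psym ρ σ (ρ + σ) F).coeff j ≠ 0 → ρ ∣ j - 1 := by
    intro j hj
    obtain ⟨i, -, hi⟩ := (coeff_psym_ne_zero_iff hρ0 hβ hF).1 hj
    exact hcop.dvd_of_dvd_mul_left ⟨1 - i, by linear_combination hi⟩
  have hr0 : r ≠ 0 := by
    rintro rfl
    simp at hlt
  obtain ⟨hf0, hd | hd⟩ := natDegree_of_pois hβ hc (by omega) h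
  -- A linear `f` would be a multiple of `E`, because its exponents are `1` modulo `ρ ≥ 2`. Its only
  -- root is `0`, so `r` would be a monomial.
  · exfalso
    obtain ⟨z, hz, hr⟩ := exists_eq_pow_of_natDegree_eq_one hβ hr0 h hd
    have h0 : (psym ρ σ (ρ + σ) F).coeff 0 = 0 := by
      by_contra h0
      have := hcl 0 h0
      norm_num at this
      have := Int.le_of_dvd (by norm_num) this
      omega
    have h1 : (psym ρ σ (ρ + σ) F).coeff 1 ≠ 0 := by
      rw [← hd]
      exact leadingCoeff_ne_zero.2 hf0
    have hz0 : z = 0 := by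
      rw [eq_X_add_C_of_natDegree_le_one hd.le, h0, C_0, add_zero, eval_mul, eval_C, eval_X,
        mul_eq_zero] at hz
      exact hz.resolve_left h1
    rw [hz0] at hr
    have := rootMultiplicity_C_mul_pow (r := X - C (0 : K)) (leadingCoeff_ne_zero.2 hr0) 0
      r.natDegree
    rw [← hr, rootMultiplicity_X_sub_C_self, mul_one] at this
    omega
  · exact ⟨hd.1, hd.2, hcl⟩

end

end

section

open Polynomial

variable {K : Type*} [Field K]

/-! ### Properties of the cutting edge -/

/-- Arithmetic of the end point of `F` for a homogeneous `F` fixing the edge. -/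
theorem endpoint_arith {ρ σ κ : ℤ} {u v a t f₂ : ℕ} {f₁ : ℤ} (hρ : 2 ≤ ρ) (hσ : σ < 0)
    (hβ : 0 < ρ + σ) (hu : ρ * u + σ * v = κ) (ha : ρ * a + σ * t = κ) (hta : t < a) (huv : u < v)
    (hf₂ : 2 ≤ f₂) (hf : (ρ + σ) * v = κ * f₂) (hf₁ : ρ * f₁ + σ * f₂ = ρ + σ) :
    ρ + σ < κ ∧ κ * f₁ = (ρ + σ) * u ∧ 2 ≤ f₁ ∧ f₁ < f₂ ∧ 3 ≤ u ∧ 1 < Nat.gcd u v := by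
  have hρ0 : 0 < ρ := by omega
  -- From `a ≥ t + 1` one gets `κ ≥ ρ + (ρ + σ) t ≥ ρ`, and `σ < 0`.
  have hκ : ρ + σ < κ := by
    have h1 : (t : ℤ) + 1 ≤ a := by exact_mod_cast hta
    have h2 : 0 ≤ (ρ + σ) * t := by positivity
    nlinarith
  have hκ0 : 0 < κ := by omega
  have h1 : κ * f₁ = (ρ + σ) * u := by
    refine mul_left_cancel₀ hρ0.ne' ?_
    linear_combination κ * hf₁ - (ρ + σ) * hu + σ * hf
  have hf₂' : (2 : ℤ) ≤ f₂ := by exact_mod_cast hf₂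
  have h2 : 1 < f₁ := by
    have : ρ * (f₁ - 1) = -σ * (f₂ - 1) := by linear_combination hf₁
    have h3 : 0 < -σ * ((f₂ : ℤ) - 1) := mul_pos (by omega) (by omega)
    rw [← this] at h3
    have := pos_of_mul_pos_right h3 hρ0.le
    omega
  have huv' : (u : ℤ) < v := by exact_mod_cast huv
  have h3 : f₁ < f₂ := by
    refine lt_of_mul_lt_mul_left (a := κ) ?_ hκ0.le
    rw [h1, ← hf]
    exact mul_lt_mul_of_pos_left huv' hβ
  have h4 : f₁ < u := by
    have : κ * f₁ < κ * u := by
      rw [h1]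
      refine mul_lt_mul_of_pos_right hκ ?_
      exact pos_of_mul_pos_right (by rw [← h1]; positivity : 0 < (ρ + σ) * (u : ℤ)) hβ.le
    exact lt_of_mul_lt_mul_left this hκ0.le
  refine ⟨hκ, h1, h2, h3, by omega, ?_⟩
  -- The points `(f₁, f₂)` and `(u, v)` are proportional. If `u` and `v` were coprime, `u` would
  -- divide `f₁`, but `0 < f₁ < u`.
  by_contra! hg
  have hg1 : Nat.gcd u v = 1 := by
    have := Nat.gcd_pos_of_pos_left v (by omega : 0 < u)
    omega
  have hc : IsCoprime (u : ℤ) (v : ℤ) := Nat.isCoprime_iff_coprime.2 hg1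
  have hd : (u : ℤ) ∣ f₁ := by
    refine hc.dvd_of_dvd_mul_right ⟨f₂, mul_left_cancel₀ hβ.ne' (mul_left_cancel₀ hκ0.ne' ?_)⟩
    linear_combination (ρ + σ) * (v : ℤ) * h1
      + (ρ + σ) * (u : ℤ) * hf
  have := Int.le_of_dvd (by omega) hd
  omega

theorem eq_of_dir_eq {ρ σ f₁ f₂ : ℤ} (hlt : f₁ < f₂) (hg : Int.gcd (f₁ - 1) (f₂ - 1) = 1)
    (h : (ρ, σ) = dir (f₁ - 1, f₂ - 1)) : ρ = f₂ - 1 := by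
  rw [dir, if_neg (by simp only; omega)] at h
  simp only [hg, Nat.cast_one, Int.ediv_one, Prod.mk.injEq] at h
  exact h.1

theorem eq_C_mul_X_add_C_mul_X_pow {ρ : ℕ} (hρ : 2 ≤ ρ) {f : K[X]} (hd : f.natDegree = ρ + 1)
    (hcl : ∀ j : ℕ, f.coeff j ≠ 0 → (ρ : ℤ) ∣ j - 1) :
    f = C (f.coeff 1) * X + C (f.coeff (ρ + 1)) * X ^ (ρ + 1) := by
  ext j
  rw [coeff_add, coeff_C_mul, coeff_C_mul, coeff_X, coeff_X_pow]
  by_cases h1 : j = 1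
  · subst h1
    rw [if_pos rfl, if_neg (by omega)]
    ring
  by_cases h2 : j = ρ + 1
  · subst h2
    rw [if_neg (by omega), if_pos rfl]
    ring
  rw [if_neg (by omega), if_neg h2, mul_zero, mul_zero, add_zero]
  by_contra hj
  have hjle : j ≤ ρ + 1 := by
    rw [← hd]
    exact le_natDegree_of_ne_zero hj
  obtain ⟨y, hy⟩ := hcl j hj
  have hρ' : (2 : ℤ) ≤ ρ := by exact_mod_cast hρ
  have hj1 : (j : ℤ) ≠ 1 := by exact_mod_cast h1
  have hj2 : (j : ℤ) < ρ + 1 := by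
    have : j < ρ + 1 := by omega
    exact_mod_cast this
  rcases lt_trichotomy y 0 with h | rfl | h
  · nlinarith
  · omega
  · nlinarith

theorem scaled_mul {m : ℕ} (hm : 0 < m) (u v : ℕ) :
    scaled m ((m : ℤ) * u, (m : ℤ) * v) = ((u : ℚ), (v : ℚ)) := by
  have hm' : (m : ℚ) ≠ 0 := by exact_mod_cast hm.ne'
  simp only [scaled]
  push_cast
  rw [mul_div_cancel_left₀ _ hm', mul_div_cancel_left₀ _ hm']

/-- The numerical meaning of `C₂ = (r - 1 / ρ, r)`. -/
theorem derivedPoint_eq {ρ : ℕ} {σ κ : ℤ} (hρ : 0 < ρ) {u v a t γ : ℕ} (ha : ρ * a + σ * t = κ)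
    (hγ : t + ρ * γ = v) {x : ℚ} (hx : 2 ≤ x)
    (h : derivedPoint (ρ, σ) ((u : ℚ), (v : ℚ)) ((a : ℚ), (t : ℚ)) = (x - 1 / ((ρ : ℤ) : ℚ), x)) :
    2 ≤ γ ∧ κ = (ρ + σ) * γ - 1 := by
  have hρ' : (ρ : ℚ) ≠ 0 := by exact_mod_cast hρ.ne'
  have hv : ((v : ℚ) - t) / ρ = γ := by
    rw [div_eq_iff hρ', ← hγ]
    push_cast
    ring
  simp only [derivedPoint, Int.cast_natCast, hv, Prod.smul_mk, smul_eq_mul, mul_one,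
    Prod.mk_add_mk, add_sub_cancel, Prod.mk.injEq] at h
  obtain ⟨h1, rfl⟩ := h
  refine ⟨by exact_mod_cast hx, ?_⟩
  have ha' : (ρ : ℚ) * a + σ * t = κ := by exact_mod_cast ha
  field_simp at h1
  have : (κ : ℚ) = (ρ + σ) * γ - 1 := by linear_combination h1 - ha'
  exact_mod_cast this

variable [CharZero K] [IsAlgClosed K]

/-- The exponents of `f` are `1` modulo `ρ` and its degree is `ρ + 1`, so `f` has only two terms.
The number `γ` in `C₂` is then the common multiplicity of the nonzero roots of `r`, and the
forbidden form of `C₂` is exactly the corner condition. -/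
theorem CommonEdge.derivedPoint_ne {P Q : WeylAlgebra K} (hQP : Q * P - P * Q = 1) {m n : ℕ}
    (hm : 0 < m) (hn : 0 < n) (hmn : m.Coprime n) {ρ σ κ : ℤ} (hρ : 2 ≤ ρ) (hβ : 0 < ρ + σ)
    {r f : K[X]} {u a : ℕ} (he : CommonEdge P Q m n ρ σ κ r u a)
    (hP : deg (ρ, σ) P = ((m * κ : ℤ) : WithBot ℤ))
    (hQ : deg (ρ, σ) Q = ((n * κ : ℤ) : WithBot ℤ))
    (hlt : rootMultiplicity 0 r < r.natDegree) {c : K} (hc : c ≠ 0)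
    (h : pois κ (ρ + σ) r f = C c * r) (hcl : ∀ j : ℕ, f.coeff j ≠ 0 → ρ ∣ j - 1)
    (hf : (f.natDegree : ℤ) = ρ + 1) {x : ℚ} (hx : 2 ≤ x) :
    derivedPoint (ρ, σ) ((u : ℚ), (r.natDegree : ℚ)) ((a : ℚ), (rootMultiplicity 0 r : ℚ))
      ≠ (x - 1 / (ρ : ℚ), x) := by
  intro hd
  lift ρ to ℕ using by omega
  have hρ2 : 2 ≤ ρ := by exact_mod_cast hρ
  rw [eq_C_mul_X_add_C_mul_X_pow hρ2 (by exact_mod_cast hf) hcl] at h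
  obtain ⟨z, -, -, hz⟩ := exists_root_mul_rootMultiplicity hβ (by omega) hc he.ne_zero h hlt
  obtain ⟨hγ, hκ⟩ := derivedPoint_eq (by omega) he.st_deg hz hx hd
  exact he.false_of_corner hQP hm hn hmn (by omega) hβ hP hQ hγ hκ

end

end Dixmier

end

/-! ### Assembly of the proposition -/

theorem mainTheorem5 {K : Type*} [Field K] [CharZero K] [IsAlgClosed K]
    (P Q : WeylAlgebra K) (hPQ : IsStandardMinimalPair P Q)
    (m n : ℕ) (hm : 0 < m) (hn : 0 < n) (hmn : Nat.Coprime m n)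
    (hratio : (m : ℚ) / n = (degInt (1, 1) P : ℚ) / degInt (1, 1) Q) :
    (∃ d : ℤ × ℤ, IsCuttingDirection P Q d) ∧
    ∀ ρ σ : ℤ, IsCuttingDirection P Q (ρ, σ) →
      (∃ F : WeylAlgebra K, IsBracketFixing (ρ, σ) P F) ∧
      ∀ F : WeylAlgebra K, IsBracketFixing (ρ, σ) P F →
      ∀ f₁ f₂ : ℤ, (f₁, f₂) = en (ρ, σ) F →
      ∀ C₀ C₁ : ℚ × ℚ, C₀ = scaled m (en (ρ, σ) P) → C₁ = scaled m (st (ρ, σ) P) →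
        ∃ u v r' s' : ℕ,
          C₀ = ((u : ℚ), (v : ℚ)) ∧ C₁ = ((r' : ℚ), (s' : ℚ)) ∧
          pointDeg (ρ, σ) C₀ = pointDeg (ρ, σ) C₁ ∧
          u < v ∧ s' < r' ∧
          2 ≤ f₁ ∧ 3 ≤ u ∧
          1 < Nat.gcd u v ∧
          (∃ μ : ℚ, 0 < μ ∧ μ < 1 ∧ ((f₁ : ℚ), (f₂ : ℚ)) = μ • C₀) ∧
          (ρ, σ) = dir (f₁ - 1, f₂ - 1) ∧
          (Int.gcd (f₁ - 1) (f₂ - 1) = 1 →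
            ∀ r : ℚ, 2 ≤ r → derivedPoint (ρ, σ) C₀ C₁ ≠ (r - 1 / (ρ : ℚ), r)) := by
  have hce := hPQ.minimal.1
  have hQP := hce.comm
  refine ⟨hPQ.exists_isCuttingDirection hm hn hmn hratio, fun ρ σ hd => ?_⟩
  obtain ⟨hρ, hσ, hβ, hcop, κ, r, u, a, hκ, hP, hQ, he, huv, htv, hta⟩ :=
    hd.exists_commonEdge hce hm hn hmn hratio
  have hρ0 : 0 < ρ := by omega
  refine ⟨he.exists_isBracketFixing hQP hm hρ hσ hβ hcop hκ hP (by omega), ?_⟩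
  rintro F hF f₁ f₂ hen C₀ C₁ rfl rfl
  have hFd : deg (ρ, σ) F = ((ρ + σ : ℤ) : WithBot ℤ) := hF.deg_eq
  obtain ⟨c, hc, hpr⟩ := he.left
  have hpois := hF.pois_eq hρ0 hβ hP
  rw [hpr] at hpois
  have hpois' := pois_root hm hc he.ne_zero hpois
  have hc' : (ρ : K) / m ≠ 0 :=
    div_ne_zero (by exact_mod_cast hρ0.ne') (by exact_mod_cast hm.ne')
  obtain ⟨hf2, hfv, hcl⟩ := natDegree_psym_of_pois hρ hβ hcop hFd htv hc' hpois'
  have hlc : (psym ρ σ (ρ + σ) F).coeff (psym ρ σ (ρ + σ) F).natDegree ≠ 0 :=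
    Polynomial.leadingCoeff_ne_zero.2 (psym_ne_zero hρ0 hβ hFd)
  obtain ⟨i, -, hi⟩ := (coeff_psym_ne_zero_iff hρ0 hβ hFd).1 hlc
  rw [(en_eq hρ0 hβ hFd rfl hi).1, Prod.mk.injEq] at hen
  obtain ⟨rfl, rfl⟩ := hen
  obtain ⟨hκβ, hfu, hf1, hf12, hu3, hgcd⟩ :=
    endpoint_arith hρ hσ hβ he.en_deg he.st_deg hta huv hf2 hfv hi
  -- Both the top point of `F` and `(1, 1)` have degree `ρ + σ`, so their difference has degree `0`.
  have hdir : (ρ, σ) = dir (f₁ - 1, ((psym ρ σ (ρ + σ) F).natDegree : ℤ) - 1) := by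
    refine (dir_spec _ (by simp only; omega) _).2 ⟨hd.mem_left.1, ?_⟩
    simp only [pointDeg, Int.cast_id]
    linear_combination hi
  have hκ0 : (κ : ℚ) ≠ 0 := by exact_mod_cast hκ.ne'
  rw [he.en_left, he.st_left, scaled_mul hm, scaled_mul hm]
  -- The ratio `μ = (ρ + σ) / κ` is that of the degrees of `F` and `C₀`; it is below `1` because `ρ
  -- + σ < κ`.
  refine ⟨u, r.natDegree, a, Polynomial.rootMultiplicity 0 r, rfl, rfl, ?_, huv, hta, hf1, hu3,
    hgcd, ⟨((ρ + σ : ℤ) : ℚ) / κ, ?_, ?_, ?_⟩, hdir, fun hg x hx => ?_⟩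
  · have := he.en_deg.trans he.st_deg.symm
    simp only [pointDeg]
    exact_mod_cast this
  · exact div_pos (by exact_mod_cast hβ) (by exact_mod_cast hκ)
  · rw [div_lt_one (by exact_mod_cast hκ)]
    exact_mod_cast hκβ
  · rw [Prod.smul_mk, Prod.mk.injEq, smul_eq_mul, smul_eq_mul, div_mul_eq_mul_div,
      div_mul_eq_mul_div, eq_div_iff hκ0, eq_div_iff hκ0]
    constructor
    · rw [mul_comm]
      exact_mod_cast hfu
    · rw [mul_comm]
      exact_mod_cast hfv.symm
  · have := eq_of_dir_eq hf12 hg hdir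
    exact he.derivedPoint_ne hQP hm hn hmn hρ hβ hP hQ htv hc' hpois' hcl (by omega) hx
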